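/- Let $\Gamma$ be a finite simplicial graph with vertex set $V$, let $A=A_\Gamma$ be its right-angled Artin group (generators $V$, adjacent generators commute), and let $d=|V|$. Let $P$ be the cube $[-1,1]^V$ in which every ideal face, i.e. every face cut out by equations $x_a=\pm1$ for a set of generators $a$ that do not all commute, is expanded into a facet (an ideal facet). Tile the universal cover by copies $gP$, $g\in A$, where the side of $gP$ belonging to $s\in V^{\pm1}$ is glued to the side of $gsP$ belonging to $s^{-1}$. Put $B(0)=P$, and let $B(i+1)$ be the union of $B(i)$ and all copies of $P$ that share a cell of codimension $1,\dots,d$ with $B(i)$. Let $S(i)=\partial B(i)$. A ridge of $S(i)$ is flat if it lies in exactly two of the copies of $P$ in $B(i)$. For $n\ge 0$, the tiles of $R^n(X)$ are the classes of facets of $S(n+1)$ under the equivalence relation generated by sharing a non-flat ridge; a tile is ideal if all of its facets are ideal. Let $Y$ be a compact special cube complex, given with a local isometry $f:Y\to \mathrm{Salv}(\Gamma)$ into the Salvetti complex of $A$, and let $y$ be a vertex of $Y$. Let $H_Y\subseteq A$ be the set of all $g$ such that the lift $g\tilde b$ of the vertex of $\mathrm{Salv}(\Gamma)$ lies in the image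 of the lift $\tilde Y\to\widetilde{\mathrm{Salv}(\Gamma)}$ of $f$ that takes a lift of $y$ to $\tilde b$. The subdivision rule of $\pi_1(Y,y)$ has the same tilings as that of $A$, but also those tiles are declared ideal that do not belong to a copy $gP$ with $g\in H_Y$. For $A$ itself put $H_A=A$. The history graph has as vertices an origin and the non-ideal tiles of all $R^n(X)$, $n\ge0$. The origin is joined to the non-ideal tiles of $R^0(X)$; two non-ideal tiles of $R^n(X)$ are joined if they share a ridge; and a non-ideal tile of $R^n(X)$ is joined to the non-ideal tiles of $R^{n+1}(X)$ that it contains, where the tile of a copy $hP$ outside $B(n+1)$ that meets $B(n+1)$ exactly in a non-ideal cell $c$ lying in only one copy of $P$ in $B(n+1)$ is contained in the tile of $R^n(X)$ that contains $c$. For a group $G$ with finite generating set $S$, let $\sigma_S(n)$ be the number of elements of $G$ at distance $n$ from $1$ in the word metric of $S$. Write $f\preceq g$ if there is a constant $C$ with $f(n)\le C\,g(Cn+C)+C$ for all $n$. **Theorem.** Let $G$ be either $A$ or $\pi_1(Y,y)$, with its subdivision rule. Let $N(n)$ be the number of non-ideal tiles of $R^n(X)$. Then $G$ is finitely generated, every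 $N(n)$ is finite, and the history graph is connected. For every $n\ge 0$, the non-ideal tiles of $R^n(X)$ are exactly the vertices at distance $n+1$ from the origin in the history graph. For every finite generating set $S$ of $G$, the history graph is quasi-isometric to the Cayley graph of $(G,S)$, and the growth function of $G$ is given by the number of non-ideal tiles up to equivalence: $\sigma_S\preceq N$ and $N\preceq\sigma_S$. For $G=A$ there is moreover a finite generating set $S$ with $N(n)=\sigma_S(n+1)$ for all $n\ge 0$. -/

import Mathlib

/-! ### Right-angled Artin groups -/

/-- The right-angled Artin group with generators the vertices of `Γ`, in which two generators
commute whenever they are adjacent. -/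
abbrev RAAG {V : Type*} (Γ : SimpleGraph V) : Type _ :=
  PresentedGroup {r : FreeGroup V | ∃ a b : V, Γ.Adj a b ∧
    r = FreeGroup.of a * FreeGroup.of b * (FreeGroup.of a)⁻¹ * (FreeGroup.of b)⁻¹}

/-- A letter is a standard generator (`(a, false)`) or its inverse (`(a, true)`). The letters are
also the facets of the cube `[-1,1]^V`. -/
abbrev Letter (V : Type*) : Type _ := V × Bool

/-- The inverse letter. -/
def Letter.inv {V : Type*} (s : Letter V) : Letter V := (s.1, !s.2)

/-- The group element given by a letter. -/
def Letter.toGroup {V : Type*} (Γ : SimpleGraph V) (s : Letter V) : RAAG Γ :=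
  if s.2 then (PresentedGroup.of s.1)⁻¹ else PresentedGroup.of s.1

/-- The reflection of `[-1,1]^V` in the direction `a`, on facets of the cube. -/
def Letter.flip {V : Type*} [DecidableEq V] (a : V) (t : Letter V) : Letter V :=
  if t.1 = a then t.inv else t

/-! ### The truncated cube

A face of the cube `[-1,1]^V` is a set of letters with distinct underlying generators (the facets
that contain the face). It is non-ideal if its generators commute pairwise, and ideal otherwise.
The truncated cube is the fundamental domain: every ideal face of the cube is expanded into a
facet. It is a simple polytope in which every set of `k` pairwise adjacent facets meets in exactly
one face of codimension `k`, and all faces arise so. -/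

/-- Facets of the truncated cube: the sides `x_a = ±1` of the cube, and one ideal facet for every
ideal face of the cube (see `DomainFacet.Valid`). -/
inductive DomainFacet (V : Type*) : Type _
  | side (s : Letter V)
  | ideal (F : Set (Letter V))

namespace DomainFacet

variable {V : Type*}

/-- An ideal facet has to come from a face of the cube that is ideal. -/
def Valid (Γ : SimpleGraph V) : DomainFacet V → Prop
  | side _ => True
  | ideal F => F.Pairwise (fun s t => s.1 ≠ t.1) ∧ ¬ F.Pairwise (fun s t => Γ.Adj s.1 t.1)

/-- Two facets of the truncated cube share a ridge. -/
def Adjacent (Γ : SimpleGraph V) : DomainFacet V → DomainFacet V → Prop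
  | side s, side t => Γ.Adj s.1 t.1
  | side s, ideal F => s ∈ F
  | ideal F, side s => s ∈ F
  | ideal F, ideal F' => F ⊂ F' ∨ F' ⊂ F

/-- The reflection of the truncated cube in the direction `a`, on facets. -/
def flip [DecidableEq V] (a : V) : DomainFacet V → DomainFacet V
  | side s => side (s.flip a)
  | ideal F => ideal (Letter.flip a '' F)

end DomainFacet

/-! ### The universal cover

The universal cover is tiled by one copy `g P` of the truncated cube `P` for every `g` in the
right-angled Artin group; the side `s` of `g P` is glued to the side `s⁻¹` of `(g s) P` by the
translation, which on the level of faces is the reflection in the direction of `s`. -/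

/-- A face of the copy of the truncated cube with index `dom`, given by the set of facets of this
copy that contain it. -/
structure DomainFace {V : Type*} (Γ : SimpleGraph V) where
  dom : RAAG Γ
  face : Set (DomainFacet V)
  valid : ∀ f ∈ face, f.Valid Γ
  adjacent : face.Pairwise (DomainFacet.Adjacent Γ)

/-- The face `p` lies on a side of its domain, and `q` is the same face seen from the domain on
the other side. -/
def DomainFace.Glued {V : Type*} [DecidableEq V] {Γ : SimpleGraph V} (p q : DomainFace Γ) : Prop :=
  ∃ s : Letter V, DomainFacet.side s ∈ p.face ∧ q.dom = p.dom * s.toGroup Γ ∧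
    q.face = DomainFacet.flip s.1 '' p.face

/-- The cells of the universal cover: faces of domains, up to the gluing. -/
def Cell {V : Type*} [DecidableEq V] (Γ : SimpleGraph V) : Type _ :=
  Quot (DomainFace.Glued (Γ := Γ))

namespace Cell

variable {V : Type*} [DecidableEq V] {Γ : SimpleGraph V}

/-- The cell of the universal cover given by a face of a domain. -/
def mk (p : DomainFace Γ) : Cell Γ := Quot.mk _ p

/-- The (indices of the) domains that contain the cell. -/
def domains (c : Cell Γ) : Set (RAAG Γ) := {g | ∃ p : DomainFace Γ, mk p = c ∧ p.dom = g}

/-- The cell has codimension `k` (in the universal cover). -/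
def HasCodim (c : Cell Γ) (k : ℕ) : Prop := ∃ p : DomainFace Γ, mk p = c ∧ p.face.ncard = k

/-- The cell is ideal: it is contained in an ideal facet. -/
def IsIdeal (c : Cell Γ) : Prop :=
  ∃ p : DomainFace Γ, mk p = c ∧ ∃ F, DomainFacet.ideal F ∈ p.face

/-- The closed cell `c` is contained in the closed cell `c'`. -/
def IsFaceOf (c c' : Cell Γ) : Prop :=
  ∃ p p' : DomainFace Γ, mk p = c ∧ mk p' = c' ∧ p.dom = p'.dom ∧ p'.face ⊆ p.face

/-- The cell is a facet of the boundary of the union of the domains in `B`: it is a facet of a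
domain in `B`, and it is ideal or not covered up by a second domain in `B`. -/
def IsBoundaryFacet (B : Set (RAAG Γ)) (c : Cell Γ) : Prop :=
  c.HasCodim 1 ∧ (c.domains ∩ B).Nonempty ∧ (c.IsIdeal ∨ ∃ g ∈ c.domains, g ∉ B)

/-- The cell touches exactly two domains in `B`. For ridges, this is the notion of a flat (or flat
ideal) ridge. -/
def IsFlat (B : Set (RAAG Γ)) (c : Cell Γ) : Prop := (c.domains ∩ B).ncard = 2

/-- The cell touches exactly one domain in `B`. -/
def IsConvex (B : Set (RAAG Γ)) (c : Cell Γ) : Prop := (c.domains ∩ B).ncard = 1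

end Cell

section Tilings

variable {V : Type*} [DecidableEq V]

/-! ### Balls, spheres and tilings -/

/-- Given the ball `B = B(i,0)`, this is the ball `B(i,j)`: one passes from `B(i,j)` to
`B(i,j+1)` by adding the domains that share a cell of codimension `j+1` with `B(i,0)`. -/
def growBall (Γ : SimpleGraph V) (B : Set (RAAG Γ)) : ℕ → Set (RAAG Γ)
  | 0 => B
  | j + 1 => growBall Γ B j ∪
      {g | ∃ c : Cell Γ, c.HasCodim (j + 1) ∧ g ∈ c.domains ∧ (c.domains ∩ B).Nonempty}

/-- The ball `B(i,0)`: `B(0,0)` is one domain and `B(i+1,0) = B(i,d)`, where `d` is the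
dimension, i.e. the number of generators. -/
def ball [Fintype V] (Γ : SimpleGraph V) : ℕ → Set (RAAG Γ)
  | 0 => {1}
  | i + 1 => growBall Γ (ball Γ i) (Fintype.card V)

/-- The facets of the sphere `S(n+1,0)`, the boundary of `B(n+1,0)`. -/
def SphereFacet [Fintype V] (Γ : SimpleGraph V) (n : ℕ) : Type _ :=
  {c : Cell Γ // c.IsBoundaryFacet (ball Γ (n + 1))}

/-- Two facets of the sphere `S(n+1,0)` share a ridge that is not flat. -/
def ShareNonflatRidge [Fintype V] (Γ : SimpleGraph V) (n : ℕ) (c c' : SphereFacet Γ n) : Prop :=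
  ∃ r : Cell Γ, r.HasCodim 2 ∧ r.IsFaceOf c.1 ∧ r.IsFaceOf c'.1 ∧ ¬ r.IsFlat (ball Γ (n + 1))

/-- The tiles of `R^n(X)`, i.e. the top-dimensional cells of the flat structure of the sphere
`S(n+1,0)`: any two facets that share a non-flat ridge are identified. -/
def Tile [Fintype V] (Γ : SimpleGraph V) (n : ℕ) : Type _ :=
  Quot (ShareNonflatRidge Γ n)

/-- The facet `c` of the sphere `S(n+1,0)` lies in the tile `T`. -/
def Tile.HasFacet [Fintype V] {Γ : SimpleGraph V} {n : ℕ} (T : Tile Γ n) (c : SphereFacet Γ n) :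
    Prop :=
  Quot.mk _ c = T

/-- The tiles of `R^n(X)` that are not ideal, if all tiles are declared ideal that consist of ideal
facets only, and also all tiles that do not belong to a domain in `H`. With `H = Set.univ` this is
the subdivision rule of the right-angled Artin group itself. -/
def NonIdealTile [Fintype V] (Γ : SimpleGraph V) (H : Set (RAAG Γ)) (n : ℕ) : Type _ :=
  {T : Tile Γ n // ∃ c : SphereFacet Γ n, T.HasFacet c ∧ ¬ c.1.IsIdeal ∧
    ∃ g ∈ c.1.domains, g ∈ ball Γ (n + 1) ∧ g ∈ H}

/-- Two tiles of `R^n(X)` share a ridge. -/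
def ShareRidge [Fintype V] {Γ : SimpleGraph V} {n : ℕ} (T T' : Tile Γ n) : Prop :=
  ∃ c c' : SphereFacet Γ n, T.HasFacet c ∧ T'.HasFacet c' ∧
    ∃ r : Cell Γ, r.HasCodim 2 ∧ r.IsFaceOf c.1 ∧ r.IsFaceOf c'.1

/-- The domain `h` outside `B` is glued onto `B` along the star of the cell `c`, i.e. `c` is the
largest cell of `h` that touches `B`. -/
def GluedOnto {Γ : SimpleGraph V} (B : Set (RAAG Γ)) (h : RAAG Γ) (c : Cell Γ) : Prop :=
  h ∉ B ∧ h ∈ c.domains ∧ (c.domains ∩ B).Nonempty ∧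
    ∀ c' : Cell Γ, h ∈ c'.domains → (c'.domains ∩ B).Nonempty → c'.IsFaceOf c

/-- The tile `T'` of `R^(n+1)(X)` is contained in the tile `T` of `R^n(X)`. The convex non-ideal
cells of `S(n+1,0)` are inflated to the tiles of the domains in the next layer: the
domain that is glued onto `B(n+1,0)` along the star of a convex cell `c` gives a tile inside
the tile that contains `c`. -/
def Subdivides [Fintype V] {Γ : SimpleGraph V} {n : ℕ} (T : Tile Γ n) (T' : Tile Γ (n + 1)) :
    Prop :=
  ∃ (c : Cell Γ) (h : RAAG Γ), ¬ c.IsIdeal ∧ c.IsConvex (ball Γ (n + 1)) ∧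
    GluedOnto (ball Γ (n + 1)) h c ∧
    (∃ f : SphereFacet Γ n, T.HasFacet f ∧ c.IsFaceOf f.1) ∧
    (∃ f : SphereFacet Γ (n + 1), T'.HasFacet f ∧ h ∈ f.1.domains)

/-- The vertices of the history graph: the origin (`none`, which stands for the single domain
`B(0,0)`), and the non-ideal tiles of `R^n(X)` for `n = 0, 1, 2, …`. -/
abbrev HistoryVertex [Fintype V] (Γ : SimpleGraph V) (H : Set (RAAG Γ)) : Type _ :=
  Option (Σ n, NonIdealTile Γ H n)

/-- The edges of the history graph: the origin is joined to the tiles of `X = R^0(X)`, two tiles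
of `R^n(X)` are joined if they share a ridge (the dual graph), and a tile of `R^n(X)` is
joined to the tiles of `R^(n+1)(X)` that are contained in it. -/
inductive HistoryEdge [Fintype V] (Γ : SimpleGraph V) (H : Set (RAAG Γ)) :
    HistoryVertex Γ H → HistoryVertex Γ H → Prop
  | root (T : NonIdealTile Γ H 0) : HistoryEdge Γ H none (some ⟨0, T⟩)
  | dual {n : ℕ} (T T' : NonIdealTile Γ H n) (hT : ShareRidge T.1 T'.1) :
      HistoryEdge Γ H (some ⟨n, T⟩) (some ⟨n, T'⟩)
  | vertical {n : ℕ} (T : NonIdealTile Γ H n) (T' : NonIdealTile Γ H (n + 1))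
      (hT : Subdivides T.1 T'.1) : HistoryEdge Γ H (some ⟨n, T⟩) (some ⟨n + 1, T'⟩)

/-- The history graph (loops are dropped). -/
def historyGraph [Fintype V] (Γ : SimpleGraph V) (H : Set (RAAG Γ)) :
    SimpleGraph (HistoryVertex Γ H) :=
  SimpleGraph.fromRel (HistoryEdge Γ H)

end Tilings

/-! ### Growth and quasi-isometry -/

/-- The growth function: the number of elements of `G` at distance `n` from `1` in the word metric
of the generating set `S`. -/
noncomputable def growthFunction {G : Type*} [Group G] (S : Finset G) (n : ℕ) : ℕ :=
  Nat.card {g : G // (SimpleGraph.mulCayley (S : Set G)).dist 1 g = n}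

/-- `f(n) ≤ C g(C n + C) + C` for a constant `C`. -/
def GrowthLE (f g : ℕ → ℕ) : Prop := ∃ C : ℕ, ∀ n, f n ≤ C * g (C * n + C) + C

/-- Two functions have the same growth. -/
def GrowthEquiv (f g : ℕ → ℕ) : Prop := GrowthLE f g ∧ GrowthLE g f

/-- The (vertex sets of the) connected graphs `A` and `B` are quasi-isometric. -/
def QuasiIsometricGraphs {α β : Type*} (A : SimpleGraph α) (B : SimpleGraph β) : Prop :=
  ∃ (f : α → β) (C D : ℝ), 0 < C ∧
    (∀ x y, 1 / C * (B.dist (f x) (f y) : ℝ) - C ≤ (A.dist x y : ℝ) ∧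
      (A.dist x y : ℝ) ≤ C * (B.dist (f x) (f y) : ℝ) + C) ∧
    ∀ z, ∃ x, (B.dist (f x) z : ℝ) ≤ D

/-- The growth of the finitely generated group `G` is given by the numbers of non-ideal tiles (of
domains in `H`): the non-ideal tiles of `R^n(X)` are exactly the vertices at distance `n + 1` from
the origin in the history graph, this graph is quasi-isometric to `G`, and the number of non-ideal
tiles of `R^n(X)`, as a function of `n`, has the same growth as the growth function of `G`. -/
def GrowthIsTileCount {V : Type*} [DecidableEq V] [Fintype V] (Γ : SimpleGraph V)
    (H : Set (RAAG Γ)) (G : Type*) [Group G] : Prop :=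
  Group.FG G ∧
  (∀ n, Finite (NonIdealTile Γ H n)) ∧
  (historyGraph Γ H).Connected ∧
  (∀ n, {v | (historyGraph Γ H).dist none v = n + 1} =
    Set.range fun T : NonIdealTile Γ H n => (some ⟨n, T⟩ : HistoryVertex Γ H)) ∧
  ∀ S : Finset G, Subgroup.closure (S : Set G) = ⊤ →
    QuasiIsometricGraphs (historyGraph Γ H) (SimpleGraph.mulCayley (S : Set G)) ∧
    GrowthEquiv (growthFunction S) (fun n => Nat.card (NonIdealTile Γ H n))

/-! ### Cube complexes -/

/-- An isometric embedding of the `m`-cube `{0,1}^m` onto a face of the `n`-cube: the `i`-th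
coordinate direction goes to the direction `coord i`, and the origin goes to `base`. -/
@[ext]
structure CubeFace (m n : ℕ) where
  coord : Fin m ↪ Fin n
  base : Fin n → Bool

namespace CubeFace

/-- The image of a vertex of the `m`-cube. -/
noncomputable def apply {m n : ℕ} (φ : CubeFace m n) (x : Fin m → Bool) (j : Fin n) : Bool :=
  open Classical in
  if h : ∃ i, φ.coord i = j then xor (x h.choose) (φ.base j) else φ.base j

/-- The identity. -/
def id (n : ℕ) : CubeFace n n := ⟨Function.Embedding.refl _, fun _ => false⟩

/-- The composition `ψ ∘ φ`. -/
noncomputable def comp {m n k : ℕ} (ψ : CubeFace n k) (φ : CubeFace m n) : CubeFace m k :=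
  ⟨φ.coord.trans ψ.coord, ψ.apply φ.base⟩

/-- A vertex of the `n`-cube. -/
def vertex {n : ℕ} (x : Fin n → Bool) : CubeFace 0 n := ⟨⟨Fin.elim0, fun i => i.elim0⟩, x⟩

/-- The edge of the `n`-cube that leaves the vertex `x` in the direction `i`. -/
def edge {n : ℕ} (i : Fin n) (x : Fin n → Bool) : CubeFace 1 n :=
  ⟨⟨fun _ => i, fun _ _ _ => Subsingleton.elim _ _⟩, x⟩

lemma apply_coord {m n : ℕ} (φ : CubeFace m n) (x : Fin m → Bool) (i : Fin m) :
    φ.apply x (φ.coord i) = xor (x i) (φ.base (φ.coord i)) := by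
  have h : ∃ i', φ.coord i' = φ.coord i := ⟨i, rfl⟩
  have h2 : h.choose = i := φ.coord.injective h.choose_spec
  simp only [apply, dif_pos h, h2]

end CubeFace

/-- A cube complex: `cube n` is the set of parametrized `n`-cubes (characteristic maps of the
`n`-cubes, with all choices of coordinates), which can be restricted to parametrized faces; different
parametrizations of a cube are different. -/
structure CubeComplex where
  cube : ℕ → Type*
  restrict : ∀ {m n : ℕ}, CubeFace m n → cube n → cube m
  restrict_id : ∀ {n : ℕ} (x : cube n), restrict (CubeFace.id n) x = x
  restrict_comp : ∀ {m n k : ℕ} (ψ : CubeFace n k) (φ : CubeFace m n) (x : cube k),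
    restrict (ψ.comp φ) x = restrict φ (restrict ψ x)
  free : ∀ {n : ℕ} (φ : CubeFace n n) (x : cube n), restrict φ x = x → φ = CubeFace.id n

namespace CubeComplex

/-- A cube complex is compact if it has finitely many cubes. -/
def IsCompact (Y : CubeComplex) : Prop := Finite (Σ n, Y.cube n)

/-- The corner of a parametrized cube that is the image of the origin. -/
def corner (Y : CubeComplex) {n : ℕ} (x : Y.cube n) : Y.cube 0 :=
  Y.restrict (CubeFace.vertex fun _ => false) x

/-- The edges of a parametrized cube that leave its corner. -/
def cornerEdge (Y : CubeComplex) {n : ℕ} (x : Y.cube n) (i : Fin n) : Y.cube 1 :=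
  Y.restrict (CubeFace.edge i fun _ => false) x

/-- The vertices of a cube complex. -/
def Vertex (Y : CubeComplex) : Type _ := Y.cube 0

/-- The oriented edges are the parametrized `1`-cubes. -/
instance (Y : CubeComplex) : Quiver Y.Vertex where
  Hom a b := {e : Y.cube 1 // Y.restrict (CubeFace.vertex fun _ => false) e = a ∧
    Y.restrict (CubeFace.vertex fun _ => true) e = b}

/-- Elementary homotopies of edge paths: an edge followed by the inverse edge is deleted, and two
consecutive edges of a square are replaced by the two opposite ones. -/
inductive ElementaryHomotopy (Y : CubeComplex) : HomRel (CategoryTheory.Paths Y.Vertex)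
  | backtrack {a b : Y.Vertex} (e : a ⟶ b) (e' : b ⟶ a)
      (h : e'.1 = Y.restrict (CubeFace.edge 0 fun _ => true) e.1) :
      ElementaryHomotopy Y (e.toPath.comp e'.toPath) (Quiver.Path.nil (a := a))
  | square {a b c d : Y.Vertex} (e₁ : a ⟶ b) (e₂ : b ⟶ d) (e₃ : a ⟶ c) (e₄ : c ⟶ d)
      (q : Y.cube 2)
      (h₁ : e₁.1 = Y.restrict (CubeFace.edge 0 ![false, false]) q)
      (h₂ : e₂.1 = Y.restrict (CubeFace.edge 1 ![true, false]) q)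
      (h₃ : e₃.1 = Y.restrict (CubeFace.edge 1 ![false, false]) q)
      (h₄ : e₄.1 = Y.restrict (CubeFace.edge 0 ![false, true]) q) :
      ElementaryHomotopy Y (e₁.toPath.comp e₂.toPath) (e₃.toPath.comp e₄.toPath)

/-- The fundamental groupoid: edge paths up to homotopy. -/
abbrev FundamentalGroupoid.{u} (Y : CubeComplex.{u}) : Type u :=
  CategoryTheory.Quotient (ElementaryHomotopy Y)

/-- The (edge path) fundamental group: closed edge paths up to homotopy. -/
abbrev FundamentalGroup.{u} (Y : CubeComplex.{u}) (y : Y.Vertex) : Type u :=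
  CategoryTheory.Aut (⟨y⟩ : Y.FundamentalGroupoid)

end CubeComplex

/-- A combinatorial map of cube complexes: it maps parametrized cubes to parametrized cubes. -/
structure CubeMap (Y X : CubeComplex) where
  toFun : ∀ n : ℕ, Y.cube n → X.cube n
  map_restrict : ∀ {m n : ℕ} (φ : CubeFace m n) (x : Y.cube n),
    toFun m (Y.restrict φ x) = X.restrict φ (toFun n x)

/-- A combinatorial map is a local isometry (of non-positively curved cube complexes) if it is
injective on the link of every vertex, with a full subcomplex as image: edges at a vertex span a
cube as soon as their images do. -/
structure CubeMap.IsLocalIsometry {Y X : CubeComplex} (f : CubeMap Y X) : Prop where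
  injective : ∀ {n : ℕ} (x x' : Y.cube n), Y.corner x = Y.corner x' →
    f.toFun n x = f.toFun n x' → x = x'
  full : ∀ {n : ℕ} (y : Y.cube 0) (e : Fin n → Y.cube 1) (c : X.cube n),
    (∀ i, Y.corner (e i) = y) → X.corner c = f.toFun 0 y →
    (∀ i, X.cornerEdge c i = f.toFun 1 (e i)) →
    ∃ x : Y.cube n, Y.corner x = y ∧ ∀ i, Y.cornerEdge x i = e i

/-- The Salvetti complex of a right-angled Artin group: it has one vertex, the oriented edges are the
letters, and the parametrized `n`-cubes are the sequences of `n` letters whose generators are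
distinct and commute pairwise. -/
def salvettiComplex {V : Type*} (Γ : SimpleGraph V) : CubeComplex where
  cube n := {w : Fin n → Letter V // Pairwise fun i j => Γ.Adj (w i).1 (w j).1}
  restrict φ w := ⟨fun i => ((w.1 (φ.coord i)).1, xor (φ.base (φ.coord i)) (w.1 (φ.coord i)).2),
    fun i j hij => w.2 fun h => hij (φ.coord.injective h)⟩
  restrict_id w := by
    apply Subtype.ext
    funext i
    simp [CubeFace.id]
  restrict_comp ψ φ w := by
    apply Subtype.ext
    funext i
    simp [CubeFace.comp, CubeFace.apply_coord]
  free φ w h := by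
    have h1 : ∀ i, φ.coord i = i := by
      intro i
      by_contra hne
      have h2 := congrArg Prod.fst (congrFun (congrArg Subtype.val h) i)
      exact (w.2 hne).ne h2
    have h3 : ∀ i, φ.base i = false := by
      intro i
      have h2 := congrArg Prod.snd (congrFun (congrArg Subtype.val h) i)
      simp only [h1] at h2
      cases hb : φ.base i <;> simp_all
    ext i
    · simp [CubeFace.id, h1]
    · simp [CubeFace.id, h3]

namespace CubeMap

variable {V : Type*} {Γ : SimpleGraph V} {Y : CubeComplex}

/-- The element of the right-angled Artin group that is spelled by the image of an edge path. -/
def label (f : CubeMap Y (salvettiComplex Γ)) {a : Y.Vertex} :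
    ∀ {b : Y.Vertex}, Quiver.Path a b → RAAG Γ
  | _, .nil => 1
  | _, .cons p e => label f p * ((f.toFun 1 e.1).1 0).toGroup Γ

/-- The elements `g` such that the lift `g b` of the vertex of the Salvetti complex lies in the image
of the universal cover of `Y`, where the lift of `f` to universal covers takes a
lift of the base point `y` to `b`: the end points of the lifts of edge paths that start at `y`. -/
def coverVertices (f : CubeMap Y (salvettiComplex Γ)) (y : Y.Vertex) : Set (RAAG Γ) :=
  {g | ∃ (z : Y.Vertex) (p : Quiver.Path y z), f.label p = g}

end CubeMap

section

namespace Letter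

variable {V : Type*}

@[simp] lemma inv_inv (s : Letter V) : s.inv.inv = s := by simp [Letter.inv]

@[simp] lemma inv_fst (s : Letter V) : s.inv.1 = s.1 := rfl

lemma inv_ne (s : Letter V) : s.inv ≠ s := fun h => by
  have := congrArg Prod.snd h
  simp [Letter.inv] at this

lemma inv_injective : Function.Injective (Letter.inv : Letter V → Letter V) :=
  Function.LeftInverse.injective inv_inv

lemma eq_or_eq_inv_of_fst_eq {s t : Letter V} (h : s.1 = t.1) : s = t ∨ s = t.inv := by
  obtain ⟨a, x⟩ := s
  obtain ⟨b, y⟩ := t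
  simp only at h
  subst h
  cases x <;> cases y <;> simp [Letter.inv]

variable {Γ : SimpleGraph V}

@[simp] lemma toGroup_inv (s : Letter V) : s.inv.toGroup Γ = (s.toGroup Γ)⁻¹ := by
  obtain ⟨a, x⟩ := s
  cases x <;> simp [Letter.inv, Letter.toGroup]

@[simp] lemma mul_toGroup_inv (g : RAAG Γ) (s : Letter V) :
    g * s.toGroup Γ * s.inv.toGroup Γ = g := by simp

end Letter

namespace RAAG

variable {V : Type*} {Γ : SimpleGraph V}

lemma of_mul_of {a b : V} (h : Γ.Adj a b) :
    (PresentedGroup.of a * PresentedGroup.of b : RAAG Γ) =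
      PresentedGroup.of b * PresentedGroup.of a := by
  have h1 : (PresentedGroup.mk _ (FreeGroup.of a * FreeGroup.of b * (FreeGroup.of a)⁻¹ *
      (FreeGroup.of b)⁻¹) : RAAG Γ) = 1 :=
    PresentedGroup.one_of_mem ⟨a, b, h, rfl⟩
  simp only [map_mul, map_inv] at h1
  rw [mul_inv_eq_one, mul_inv_eq_iff_eq_mul] at h1
  exact h1

lemma toGroup_commute {s t : Letter V} (h : Γ.Adj s.1 t.1) :
    Commute (s.toGroup Γ) (t.toGroup Γ) := by
  have h1 : Commute (PresentedGroup.of s.1 : RAAG Γ) (PresentedGroup.of t.1) := of_mul_of h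
  unfold Letter.toGroup
  split_ifs <;> simp [h1]

lemma mul_mul_comm {s t : Letter V} (h : Γ.Adj s.1 t.1) (g : RAAG Γ) :
    g * s.toGroup Γ * t.toGroup Γ = g * t.toGroup Γ * s.toGroup Γ := by
  rw [mul_assoc, mul_assoc, (toGroup_commute h).eq]

theorem induction_mul {P : RAAG Γ → Prop} (one : P 1)
    (mul : ∀ g (s : Letter V), P g → P (g * s.toGroup Γ)) (g : RAAG Γ) : P g := by
  have hg : g ∈ Subgroup.closure (Set.range (PresentedGroup.of : V → RAAG Γ)) := by
    rw [PresentedGroup.closure_range_of]; trivial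
  induction hg using Subgroup.closure_induction_right with
  | one => exact one
  | mul_right x y hx hy ih =>
    obtain ⟨a, rfl⟩ := hy
    exact mul x (a, false) ih
  | mul_inv_cancel x y hx hy ih =>
    obtain ⟨a, rfl⟩ := hy
    exact mul x (a, true) ih

/-! ### Normal forms

An element is determined by the projections of a reduced word to all pairs of generators that do
not commute. Such a family of words is a pile. The words are stored with the last letter first. -/

/-- A word for every pair of generators. -/
abbrev Pile (V : Type*) : Type _ := V → V → List (Letter V)

/-- The letter `s` is recorded in the word of the pair `(x, y)`. -/
def Touches (Γ : SimpleGraph V) (s : Letter V) (x y : V) : Prop :=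
  ¬ Γ.Adj x y ∧ (x = s.1 ∨ y = s.1)

lemma Touches.not_touches {s t : Letter V} (h : Γ.Adj s.1 t.1) {x y : V} (hs : Touches Γ s x y) :
    ¬ Touches Γ t x y := by
  rintro ⟨h1, h2⟩
  rcases hs.2 with rfl | rfl <;> rcases h2 with h2 | h2
  · exact h.ne h2
  · exact h1 (h2 ▸ h)
  · exact h1 (h2 ▸ h.symm)
  · exact h.ne h2

@[simp] lemma touches_inv {s : Letter V} {x y : V} : Touches Γ s.inv x y ↔ Touches Γ s x y :=
  Iff.rfl

namespace Pile

/-- The letter `s` cancels with the last letters of the pile. -/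
def Cancels (Γ : SimpleGraph V) (s : Letter V) (σ : Pile V) : Prop :=
  ∀ x y, Touches Γ s x y → (σ x y).head? = some s.inv

open Classical in
/-- Add a letter. -/
noncomputable def add (Γ : SimpleGraph V) (s : Letter V) (σ : Pile V) : Pile V :=
  fun x y => if Touches Γ s x y then s :: σ x y else σ x y

open Classical in
/-- Remove a letter. -/
noncomputable def pop (Γ : SimpleGraph V) (s : Letter V) (σ : Pile V) : Pile V :=
  fun x y => if Touches Γ s x y then (σ x y).tail else σ x y

lemma cancels_inv_add (s : Letter V) (σ : Pile V) : Cancels Γ s.inv (add Γ s σ) := by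
  intro x y h
  simp [add, touches_inv.1 h]

lemma pop_inv_add (s : Letter V) (σ : Pile V) : pop Γ s.inv (add Γ s σ) = σ := by
  funext x y
  by_cases h : Touches Γ s x y <;> simp [add, pop, h]

lemma add_inv_pop {s : Letter V} {σ : Pile V} (hs : Cancels Γ s σ) :
    add Γ s.inv (pop Γ s σ) = σ := by
  funext x y
  by_cases h : Touches Γ s x y
  · have := hs x y h
    simp only [add, touches_inv, h, if_true, pop]
    exact List.cons_head?_tail this
  · simp [add, pop, h]

lemma cancels_add {s t : Letter V} (h : Γ.Adj s.1 t.1) (σ : Pile V) :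
    Cancels Γ s (add Γ t σ) ↔ Cancels Γ s σ := by
  refine forall_congr' fun x => forall_congr' fun y => forall_congr' fun hs => ?_
  simp [add, hs.not_touches h]

lemma cancels_pop {s t : Letter V} (h : Γ.Adj s.1 t.1) (σ : Pile V) :
    Cancels Γ s (pop Γ t σ) ↔ Cancels Γ s σ := by
  refine forall_congr' fun x => forall_congr' fun y => forall_congr' fun hs => ?_
  simp [pop, hs.not_touches h]

lemma add_add {s t : Letter V} (h : Γ.Adj s.1 t.1) (σ : Pile V) :
    add Γ s (add Γ t σ) = add Γ t (add Γ s σ) := by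
  funext x y
  by_cases hs : Touches Γ s x y
  · simp [add, hs, hs.not_touches h]
  · by_cases ht : Touches Γ t x y <;> simp [add, hs, ht]

lemma pop_add {s t : Letter V} (h : Γ.Adj s.1 t.1) (σ : Pile V) :
    pop Γ s (add Γ t σ) = add Γ t (pop Γ s σ) := by
  funext x y
  by_cases hs : Touches Γ s x y
  · simp [add, pop, hs, hs.not_touches h]
  · by_cases ht : Touches Γ t x y <;> simp [add, pop, hs, ht]

lemma pop_pop {s t : Letter V} (h : Γ.Adj s.1 t.1) (σ : Pile V) :
    pop Γ s (pop Γ t σ) = pop Γ t (pop Γ s σ) := by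
  funext x y
  by_cases hs : Touches Γ s x y
  · simp [pop, hs, hs.not_touches h]
  · by_cases ht : Touches Γ t x y <;> simp [pop, hs, ht]

lemma Cancels.adj {s t : Letter V} {σ : Pile V} (hs : Cancels Γ s σ) (ht : Cancels Γ t σ)
    (hst : s ≠ t) : Γ.Adj s.1 t.1 := by
  by_contra h
  have h1 := hs s.1 t.1 ⟨h, Or.inl rfl⟩
  rw [ht s.1 t.1 ⟨h, Or.inr rfl⟩, Option.some_inj] at h1
  exact hst (Letter.inv_injective h1).symm

/-- The piles of reduced words. -/
inductive Reduced (Γ : SimpleGraph V) : Pile V → Prop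
  | empty : Reduced Γ fun _ _ => []
  | add (s : Letter V) (σ : Pile V) : Reduced Γ σ → ¬ Cancels Γ s σ → Reduced Γ (add Γ s σ)

lemma not_cancels_empty (s : Letter V) : ¬ Cancels Γ s fun _ _ => [] := fun h => by
  simpa using h s.1 s.1 ⟨Γ.irrefl, Or.inl rfl⟩

lemma Reduced.pop {σ : Pile V} (hσ : Reduced Γ σ) : ∀ {s : Letter V}, Cancels Γ s σ →
    Reduced Γ (pop Γ s σ) ∧ ¬ Cancels Γ s.inv (pop Γ s σ) := by
  induction hσ with
  | empty => exact fun h => (not_cancels_empty _ h).elim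
  | add t σ hσ ht ih =>
    intro s hs
    by_cases hst : s = t.inv
    · subst hst
      rw [pop_inv_add, Letter.inv_inv]
      exact ⟨hσ, ht⟩
    · have h : Γ.Adj s.1 t.inv.1 := hs.adj (cancels_inv_add t σ) hst
      rw [Letter.inv_fst] at h
      obtain ⟨h1, h2⟩ := ih ((cancels_add h σ).1 hs)
      rw [pop_add h]
      exact ⟨.add t _ h1 ((cancels_pop h.symm σ).not.2 ht),
        (cancels_add (s := s.inv) h _).not.2 h2⟩

open Classical in
/-- Multiplication with a letter. -/
noncomputable def push (Γ : SimpleGraph V) (s : Letter V) (σ : Pile V) : Pile V :=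
  if Cancels Γ s σ then pop Γ s σ else add Γ s σ

lemma Reduced.push {σ : Pile V} (hσ : Reduced Γ σ) (s : Letter V) : Reduced Γ (push Γ s σ) := by
  unfold Pile.push
  split_ifs with h
  · exact (hσ.pop h).1
  · exact .add s σ hσ h

lemma Reduced.push_inv_push {σ : Pile V} (hσ : Reduced Γ σ) (s : Letter V) :
    Pile.push Γ s.inv (Pile.push Γ s σ) = σ := by
  by_cases h : Cancels Γ s σ
  · have h1 := (hσ.pop h).2
    simp [Pile.push, h, h1, add_inv_pop h]
  · simp [Pile.push, h, cancels_inv_add, pop_inv_add]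

lemma push_push {s t : Letter V} (h : Γ.Adj s.1 t.1) (σ : Pile V) :
    push Γ s (push Γ t σ) = push Γ t (push Γ s σ) := by
  by_cases hs : Cancels Γ s σ <;> by_cases ht : Cancels Γ t σ <;>
    simp [push, hs, ht, cancels_pop h, cancels_add h, cancels_pop h.symm, cancels_add h.symm,
      pop_pop h, pop_add h, pop_add h.symm, add_add h]

/-- Multiplication with a letter is a permutation of the reduced piles. -/
noncomputable def pushEquiv (Γ : SimpleGraph V) (s : Letter V) :
    Equiv.Perm {σ : Pile V // Reduced Γ σ} where
  toFun σ := ⟨push Γ s σ.1, σ.2.push s⟩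
  invFun σ := ⟨push Γ s.inv σ.1, σ.2.push s.inv⟩
  left_inv σ := Subtype.ext (σ.2.push_inv_push s)
  right_inv σ := Subtype.ext (by simpa using σ.2.push_inv_push s.inv)

lemma pushEquiv_inv (s : Letter V) : pushEquiv Γ s.inv = (pushEquiv Γ s)⁻¹ :=
  Equiv.ext fun _ => rfl

lemma pushEquiv_commute {s t : Letter V} (h : Γ.Adj s.1 t.1) :
    Commute (pushEquiv Γ s) (pushEquiv Γ t) :=
  Equiv.ext fun σ => Subtype.ext (push_push h σ.1)

end Pile

/-- The action on reduced piles. -/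
noncomputable def pileAction (Γ : SimpleGraph V) :
    RAAG Γ →* Equiv.Perm {σ : Pile V // Pile.Reduced Γ σ} :=
  PresentedGroup.toGroup (f := fun a => (Pile.pushEquiv Γ (a, false))⁻¹) (by
    rintro r ⟨a, b, h, rfl⟩
    have h1 : Commute (Pile.pushEquiv Γ (a, false)) (Pile.pushEquiv Γ (b, false)) :=
      Pile.pushEquiv_commute h
    simp only [map_mul, FreeGroup.lift_apply_of, map_inv]
    rw [h1.inv_inv.eq]
    simp)

lemma pileAction_toGroup (s : Letter V) :
    pileAction Γ (s.toGroup Γ) = (Pile.pushEquiv Γ s)⁻¹ := by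
  obtain ⟨a, x⟩ := s
  cases x
  · exact PresentedGroup.toGroup.of _
  · have h := Pile.pushEquiv_inv (Γ := Γ) (a, false)
    rw [show (a, true) = Letter.inv (a, false) from rfl, Letter.toGroup_inv, map_inv, h]
    congr 1

/-- The pile of a group element. -/
noncomputable def pile (g : RAAG Γ) : {σ : Pile V // Pile.Reduced Γ σ} :=
  pileAction Γ g⁻¹ ⟨_, .empty⟩

lemma pile_one : (pile (1 : RAAG Γ)).1 = fun _ _ => [] := by simp [pile]

lemma pile_mul (g : RAAG Γ) (s : Letter V) :
    (pile (g * s.toGroup Γ)).1 = Pile.push Γ s (pile g).1 := by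
  have h : pileAction Γ (s.toGroup Γ)⁻¹ = Pile.pushEquiv Γ s := by
    rw [map_inv, pileAction_toGroup, _root_.inv_inv]
  simp only [pile, mul_inv_rev, map_mul, h]
  rfl

/-- The letter `s` is a descent of `g` if multiplication with `s` makes reduced words shorter. -/
def IsDescent (g : RAAG Γ) (s : Letter V) : Prop := Pile.Cancels Γ s (pile g).1

lemma not_isDescent_one (s : Letter V) : ¬ IsDescent (1 : RAAG Γ) s := by
  rw [IsDescent, pile_one]
  exact Pile.not_cancels_empty s

lemma isDescent_mul_inv_iff {g : RAAG Γ} {s : Letter V} :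
    IsDescent (g * s.toGroup Γ) s.inv ↔ ¬ IsDescent g s := by
  rw [IsDescent, pile_mul]
  constructor
  · intro h h1
    rw [IsDescent] at h1
    rw [Pile.push, if_pos h1] at h
    exact ((pile g).2.pop h1).2 h
  · intro h
    rw [IsDescent] at h
    rw [Pile.push, if_neg h]
    exact Pile.cancels_inv_add s _

lemma isDescent_mul_iff {g : RAAG Γ} {s t : Letter V} (h : Γ.Adj s.1 t.1) :
    IsDescent (g * t.toGroup Γ) s ↔ IsDescent g s := by
  rw [IsDescent, pile_mul, Pile.push]
  split_ifs
  · exact Pile.cancels_pop h _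
  · exact Pile.cancels_add h _

lemma IsDescent.adj {g : RAAG Γ} {s t : Letter V} (hs : IsDescent g s) (ht : IsDescent g t)
    (hst : s ≠ t) : Γ.Adj s.1 t.1 :=
  Pile.Cancels.adj hs ht hst

lemma IsDescent.not_inv {g : RAAG Γ} {s : Letter V} (hs : IsDescent g s) :
    ¬ IsDescent g s.inv :=
  fun h => (hs.adj h (Letter.inv_ne s).symm).ne rfl

section Fold

variable {Z : Type*} (z₀ : Z) (u : Letter V → Z → Z)

/-- The element `g` has a reduced word of length `n`, and `z` is obtained from it by applying the
operations of its letters one after the other. -/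
inductive ReducedFold : ℕ → RAAG Γ → Z → Prop
  | one : ReducedFold 0 1 z₀
  | mul (n : ℕ) (g : RAAG Γ) (z : Z) (s : Letter V) : ReducedFold n g z → ¬ IsDescent g s →
      ReducedFold (n + 1) (g * s.toGroup Γ) (u s z)

variable {z₀ u} (hu : ∀ s t z, Γ.Adj s.1 t.1 → u s (u t z) = u t (u s z))
include hu

lemma ReducedFold.descent {n : ℕ} {g : RAAG Γ} {z : Z} (h : ReducedFold z₀ u n g z) :
    ∀ {s : Letter V}, IsDescent g s → ∃ m z', n = m + 1 ∧
      ReducedFold z₀ u m (g * s.toGroup Γ) z' ∧ z = u s.inv z' := by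
  induction h with
  | one => exact fun h => (not_isDescent_one _ h).elim
  | mul n g z t h ht ih =>
    intro s hs
    by_cases hst : s = t.inv
    · subst hst
      exact ⟨n, z, rfl, by simpa using h, by simp⟩
    · have hadj : Γ.Adj s.1 t.inv.1 := hs.adj (isDescent_mul_inv_iff.2 ht) hst
      rw [Letter.inv_fst] at hadj
      obtain ⟨m, z', rfl, h1, rfl⟩ := ih ((isDescent_mul_iff hadj).1 hs)
      refine ⟨m + 1, u t z', rfl, ?_, (hu s.inv t z' hadj).symm⟩
      rw [mul_mul_comm hadj.symm]
      exact .mul m _ z' t h1 ((isDescent_mul_iff hadj.symm).not.2 ht)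

lemma ReducedFold.unique {n : ℕ} {g : RAAG Γ} {z : Z} (h : ReducedFold z₀ u n g z) :
    ∀ {m : ℕ} {z' : Z}, ReducedFold z₀ u m g z' → n = m ∧ z = z' := by
  induction h with
  | one =>
    intro m z' h'
    generalize hg : (1 : RAAG Γ) = g at h'
    cases h' with
    | one => exact ⟨rfl, rfl⟩
    | mul n g z s h hs =>
      have := isDescent_mul_inv_iff.2 hs
      rw [← hg] at this
      exact (not_isDescent_one _ this).elim
  | mul n g z s h hs ih =>
    intro m z' h'
    obtain ⟨m', z'', rfl, h1, rfl⟩ := h'.descent hu (isDescent_mul_inv_iff.2 hs)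
    rw [Letter.mul_toGroup_inv] at h1
    obtain ⟨rfl, rfl⟩ := ih h1
    simp

lemma exists_reducedFold (g : RAAG Γ) : ∃ n z, ReducedFold z₀ u n g z := by
  induction g using induction_mul with
  | one => exact ⟨0, z₀, .one⟩
  | mul g s ih =>
    obtain ⟨n, z, h⟩ := ih
    by_cases hs : IsDescent g s
    · obtain ⟨m, z', -, h1, -⟩ := h.descent hu hs
      exact ⟨m, z', h1⟩
    · exact ⟨n + 1, u s z, .mul n g z s h hs⟩

theorem exists_fold (z₀ : Z) : ∃ Φ : RAAG Γ → Z, Φ 1 = z₀ ∧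
    ∀ g s, ¬ IsDescent g s → Φ (g * s.toGroup Γ) = u s (Φ g) := by
  choose n Φ h using exists_reducedFold (z₀ := z₀) hu
  exact ⟨Φ, ((h 1).unique hu .one).2, fun g s hs =>
    ((h _).unique hu (.mul _ _ _ _ (h g) hs)).2⟩

end Fold

theorem induction_ascent {P : RAAG Γ → Prop} (one : P 1)
    (mul : ∀ g (s : Letter V), ¬ IsDescent g s → P g → P (g * s.toGroup Γ)) (g : RAAG Γ) :
    P g := by
  obtain ⟨n, z, h⟩ := exists_reducedFold (Z := Unit) (z₀ := ()) (u := fun _ _ => ())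
    (fun _ _ _ _ => rfl) g
  induction h with
  | one => exact one
  | mul n g z s h hs ih => exact mul g s hs ih

/-! ### Word length -/

lemma exists_length (Γ : SimpleGraph V) : ∃ Φ : RAAG Γ → ℕ, Φ 1 = 0 ∧
    ∀ g s, ¬ IsDescent g s → Φ (g * s.toGroup Γ) = Φ g + 1 :=
  exists_fold (u := fun _ n => n + 1) (fun _ _ _ _ => rfl) 0

/-- The length of reduced words. -/
noncomputable def length (g : RAAG Γ) : ℕ := (exists_length Γ).choose g

@[simp] lemma length_one : length (1 : RAAG Γ) = 0 := (exists_length Γ).choose_spec.1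

lemma length_ascent {g : RAAG Γ} {s : Letter V} (h : ¬ IsDescent g s) :
    length (g * s.toGroup Γ) = length g + 1 := (exists_length Γ).choose_spec.2 g s h

lemma length_descent {g : RAAG Γ} {s : Letter V} (h : IsDescent g s) :
    length (g * s.toGroup Γ) + 1 = length g := by
  have h1 : ¬ IsDescent (g * s.toGroup Γ) s.inv := fun h' => isDescent_mul_inv_iff.1 h' h
  simpa using (length_ascent h1).symm

lemma length_mul_toGroup_le (g : RAAG Γ) (s : Letter V) :
    length (g * s.toGroup Γ) ≤ length g + 1 := by
  by_cases h : IsDescent g s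
  · have := length_descent h
    omega
  · exact (length_ascent h).le

lemma exists_descent {g : RAAG Γ} (h : g ≠ 1) : ∃ s, IsDescent g s := by
  induction g using induction_ascent with
  | one => exact (h rfl).elim
  | mul g s hs _ => exact ⟨s.inv, isDescent_mul_inv_iff.2 hs⟩

@[simp] lemma length_eq_zero {g : RAAG Γ} : length g = 0 ↔ g = 1 := by
  refine ⟨fun h => ?_, by rintro rfl; simp⟩
  by_contra h1
  obtain ⟨s, hs⟩ := exists_descent h1
  have := length_descent hs
  omega

lemma length_mul_le (g h : RAAG Γ) : length (g * h) ≤ length g + length h := by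
  induction h using induction_ascent with
  | one => simp
  | mul h s hs ih =>
    rw [← mul_assoc, length_ascent hs]
    have := length_mul_toGroup_le (g * h) s
    omega

lemma length_toGroup (s : Letter V) : length (s.toGroup Γ) = 1 := by
  simpa using length_ascent (not_isDescent_one (Γ := Γ) s)

lemma length_inv_le (g : RAAG Γ) : length g⁻¹ ≤ length g := by
  induction g using induction_ascent with
  | one => simp
  | mul g s hs ih =>
    rw [length_ascent hs, mul_inv_rev, ← Letter.toGroup_inv]
    have := length_mul_le (s.inv.toGroup Γ) g⁻¹
    rw [length_toGroup] at this
    omega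

@[simp] lemma length_inv (g : RAAG Γ) : length g⁻¹ = length g :=
  le_antisymm (length_inv_le g) (by simpa using length_inv_le g⁻¹)

lemma finite_length_le [Finite V] (n : ℕ) : {g : RAAG Γ | length g ≤ n}.Finite := by
  induction n with
  | zero => simp
  | succ n ih =>
    refine ((ih.prod (Set.finite_univ (α := Letter V))).image
      fun p => p.1 * p.2.toGroup Γ).union (Set.finite_singleton 1) |>.subset fun g hg => ?_
    by_cases h : g = 1
    · exact Or.inr h
    · obtain ⟨s, hs⟩ := exists_descent h
      have := length_descent hs
      simp only [Set.mem_ofPred_eq] at hg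
      exact Or.inl ⟨(g * s.toGroup Γ, s.inv), ⟨by simp; omega, trivial⟩, by simp⟩

end RAAG

end

section

namespace RAAG

variable {V : Type*} {Γ : SimpleGraph V}

/-! ### Depth and height -/

open Classical in
/-- The heights of the top pieces of a heap after a piece has been added. -/
noncomputable def stack (Γ : SimpleGraph V) (s : Letter V) (D : V → ℕ) : V → ℕ :=
  fun a => if Γ.Adj s.1 a then D a else max (D a) (D s.1 + 1)

lemma stack_comm (s t : Letter V) (D : V → ℕ) (h : Γ.Adj s.1 t.1) :
    stack Γ s (stack Γ t D) = stack Γ t (stack Γ s D) := by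
  funext a
  by_cases hs : Γ.Adj s.1 a <;> by_cases ht : Γ.Adj t.1 a <;>
    simp [stack, hs, ht, h, h.symm, max_right_comm]

lemma exists_depth (Γ : SimpleGraph V) : ∃ Φ : RAAG Γ → V → ℕ, (Φ 1 = fun _ => 0) ∧
    ∀ g s, ¬ IsDescent g s → Φ (g * s.toGroup Γ) = stack Γ s (Φ g) :=
  exists_fold stack_comm _

/-- The height of the highest piece in the heap of `g` that does not commute with `a`. -/
noncomputable def depth (g : RAAG Γ) (a : V) : ℕ := (exists_depth Γ).choose g a

@[simp] lemma depth_one (a : V) : depth (1 : RAAG Γ) a = 0 :=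
  congrFun (exists_depth Γ).choose_spec.1 a

lemma depth_ascent {g : RAAG Γ} {s : Letter V} (h : ¬ IsDescent g s) :
    depth (g * s.toGroup Γ) = stack Γ s (depth g) := (exists_depth Γ).choose_spec.2 g s h

lemma depth_ascent_self {g : RAAG Γ} {s : Letter V} (h : ¬ IsDescent g s) :
    depth (g * s.toGroup Γ) s.1 = depth g s.1 + 1 := by
  simp [depth_ascent h, stack]

lemma depth_ascent_of_adj {g : RAAG Γ} {s : Letter V} (h : ¬ IsDescent g s) {a : V}
    (ha : Γ.Adj s.1 a) : depth (g * s.toGroup Γ) a = depth g a := by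
  simp [depth_ascent h, stack, ha]

lemma depth_ascent_of_not_adj {g : RAAG Γ} {s : Letter V} (h : ¬ IsDescent g s) {a : V}
    (ha : ¬ Γ.Adj s.1 a) :
    depth (g * s.toGroup Γ) a = max (depth g a) (depth g s.1 + 1) := by
  simp [depth_ascent h, stack, ha]

lemma depth_descent {g : RAAG Γ} {s : Letter V} (h : IsDescent g s) :
    depth g = stack Γ s.inv (depth (g * s.toGroup Γ)) := by
  have h1 : ¬ IsDescent (g * s.toGroup Γ) s.inv := fun h' => isDescent_mul_inv_iff.1 h' h
  simpa using depth_ascent h1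

lemma depth_descent_le {g : RAAG Γ} {s : Letter V} (h : IsDescent g s) (a : V) :
    depth (g * s.toGroup Γ) a ≤ depth g a := by
  rw [depth_descent h, stack]
  split_ifs
  · exact le_rfl
  · exact le_max_left _ _

lemma depth_mul_of_adj {g : RAAG Γ} {s : Letter V} {a : V} (ha : Γ.Adj s.1 a) :
    depth (g * s.toGroup Γ) a = depth g a := by
  by_cases h : IsDescent g s
  · rw [depth_descent h, stack, if_pos (by simpa using ha)]
  · exact depth_ascent_of_adj h ha

lemma depth_le_of_descent {g : RAAG Γ} {s : Letter V} (h : IsDescent g s) {a : V}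
    (ha : ¬ Γ.Adj s.1 a) : depth g s.1 ≤ depth g a := by
  rw [depth_descent h]
  simp [stack, ha]

lemma depth_pos_of_descent {g : RAAG Γ} {s : Letter V} (h : IsDescent g s) :
    0 < depth g s.1 := by
  rw [depth_descent h]
  simp [stack]

/-! ### Cliques -/

/-- A list of letters whose generators are distinct and commute pairwise. -/
def IsClique (Γ : SimpleGraph V) (l : List (Letter V)) : Prop :=
  l.Pairwise fun s t => Γ.Adj s.1 t.1

/-- The product of a word. -/
def wordProd (Γ : SimpleGraph V) (l : List (Letter V)) : RAAG Γ :=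
  (l.map (Letter.toGroup Γ)).prod

@[simp] lemma wordProd_nil : wordProd Γ [] = 1 := rfl

@[simp] lemma wordProd_cons (s : Letter V) (l : List (Letter V)) :
    wordProd Γ (s :: l) = s.toGroup Γ * wordProd Γ l := by simp [wordProd]

lemma length_wordProd_le (l : List (Letter V)) : length (wordProd Γ l) ≤ l.length := by
  induction l with
  | nil => simp
  | cons s l ih =>
    rw [wordProd_cons, List.length_cons]
    have := length_mul_le (s.toGroup Γ) (wordProd Γ l)
    rw [length_toGroup] at this
    omega

lemma isClique_nil : IsClique Γ [] := List.Pairwise.nil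

lemma isClique_singleton (s : Letter V) : IsClique Γ [s] := List.pairwise_singleton _ _

lemma isClique_cons {s : Letter V} {l : List (Letter V)} :
    IsClique Γ (s :: l) ↔ (∀ t ∈ l, Γ.Adj s.1 t.1) ∧ IsClique Γ l := List.pairwise_cons

lemma isClique_pair {s t : Letter V} (h : Γ.Adj s.1 t.1) : IsClique Γ [s, t] :=
  isClique_cons.2 ⟨by simpa using h, isClique_singleton t⟩

lemma IsClique.nodup_map {l : List (Letter V)} (h : IsClique Γ l) : (l.map Prod.fst).Nodup :=
  List.pairwise_map.2 (h.imp fun h => h.ne)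

lemma IsClique.nodup {l : List (Letter V)} (h : IsClique Γ l) : l.Nodup :=
  h.nodup_map.of_map

lemma IsClique.adj {l : List (Letter V)} (h : IsClique Γ l) {s t : Letter V} (hs : s ∈ l)
    (ht : t ∈ l) (hst : s ≠ t) : Γ.Adj s.1 t.1 :=
  haveI : Std.Symm fun s t : Letter V => Γ.Adj s.1 t.1 := ⟨fun _ _ h => h.symm⟩
  List.Pairwise.forall h hs ht hst

lemma IsClique.length_le [Fintype V] {l : List (Letter V)} (h : IsClique Γ l) :
    l.length ≤ Fintype.card V := by
  simpa using h.nodup_map.length_le_card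

lemma IsClique.perm {l l' : List (Letter V)} (h : IsClique Γ l) (hl : l.Perm l') :
    wordProd Γ l = wordProd Γ l' := by
  refine (hl.map _).prod_eq' ?_
  exact List.pairwise_map.2 (h.imp fun h => toGroup_commute h)

lemma IsClique.of_perm {l l' : List (Letter V)} (h : IsClique Γ l) (hl : l.Perm l') :
    IsClique Γ l' := (hl.pairwise_iff fun h => h.symm).1 h

lemma commute_wordProd {s : Letter V} {l : List (Letter V)} (h : ∀ t ∈ l, Γ.Adj s.1 t.1) :
    Commute (s.toGroup Γ) (wordProd Γ l) := by
  refine Commute.list_prod_right _ _ fun x hx => ?_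
  obtain ⟨t, ht, rfl⟩ := List.mem_map.1 hx
  exact toGroup_commute (h t ht)

lemma IsClique.inv {l : List (Letter V)} (h : IsClique Γ l) : IsClique Γ (l.map Letter.inv) :=
  List.pairwise_map.2 h

lemma IsClique.wordProd_inv {l : List (Letter V)} (h : IsClique Γ l) :
    wordProd Γ (l.map Letter.inv) = (wordProd Γ l)⁻¹ := by
  induction l with
  | nil => simp
  | cons s l ih =>
    obtain ⟨h1, h2⟩ := isClique_cons.1 h
    simp only [List.map_cons, wordProd_cons, ih h2, Letter.toGroup_inv, mul_inv_rev]
    exact (commute_wordProd h1).inv_inv.eq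

lemma isDescent_mul_wordProd_iff {g : RAAG Γ} {s : Letter V} {l : List (Letter V)}
    (h : ∀ t ∈ l, Γ.Adj s.1 t.1) : IsDescent (g * wordProd Γ l) s ↔ IsDescent g s := by
  induction l generalizing g with
  | nil => simp
  | cons t l ih =>
    rw [wordProd_cons, ← mul_assoc, ih fun t ht => h t (List.mem_cons_of_mem _ ht),
      isDescent_mul_iff (h t List.mem_cons_self)]

/-! ### Height -/

variable [Fintype V]

/-- The height of the heap of `g`: the number of layers. -/
noncomputable def height (g : RAAG Γ) : ℕ := Finset.univ.sup (depth g)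

lemma depth_le_height (g : RAAG Γ) (a : V) : depth g a ≤ height g :=
  Finset.le_sup (Finset.mem_univ a)

lemma height_le {g : RAAG Γ} {n : ℕ} : height g ≤ n ↔ ∀ a, depth g a ≤ n := by
  simp [height]

@[simp] lemma height_one : height (1 : RAAG Γ) = 0 := by
  simpa using (height_le (g := (1 : RAAG Γ)) (n := 0)).2

lemma height_ascent {g : RAAG Γ} {s : Letter V} (h : ¬ IsDescent g s) :
    height (g * s.toGroup Γ) = max (height g) (depth g s.1 + 1) := by
  apply le_antisymm
  · refine height_le.2 fun a => ?_
    by_cases ha : Γ.Adj s.1 a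
    · rw [depth_ascent_of_adj h ha]
      exact (depth_le_height g a).trans (le_max_left _ _)
    · rw [depth_ascent_of_not_adj h ha]
      exact max_le_max_right _ (depth_le_height g a)
  · refine max_le (height_le.2 fun a => ?_) ?_
    · refine le_trans ?_ (depth_le_height _ a)
      by_cases ha : Γ.Adj s.1 a
      · rw [depth_ascent_of_adj h ha]
      · rw [depth_ascent_of_not_adj h ha]
        exact le_max_left _ _
    · rw [← depth_ascent_self h]
      exact depth_le_height _ _

lemma height_ascent_le {g : RAAG Γ} {s : Letter V} (h : ¬ IsDescent g s) :
    height g ≤ height (g * s.toGroup Γ) := by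
  rw [height_ascent h]
  exact le_max_left _ _

lemma height_descent_le {g : RAAG Γ} {s : Letter V} (h : IsDescent g s) :
    height (g * s.toGroup Γ) ≤ height g :=
  height_le.2 fun a => (depth_descent_le h a).trans (depth_le_height g a)

lemma not_isDescent_of_height_lt {g : RAAG Γ} {s : Letter V}
    (h : height g < height (g * s.toGroup Γ)) : ¬ IsDescent g s :=
  fun h1 => (height_descent_le h1).not_gt h

lemma height_mul_wordProd_le {n : ℕ} {l : List (Letter V)} (hl : IsClique Γ l) :
    ∀ {g : RAAG Γ}, height g ≤ n + 1 → (∀ s ∈ l, depth g s.1 ≤ n) →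
      height (g * wordProd Γ l) ≤ n + 1 := by
  induction l with
  | nil => simp
  | cons s l ih =>
    intro g hg hd
    obtain ⟨h1, h2⟩ := isClique_cons.1 hl
    rw [wordProd_cons, ← mul_assoc]
    refine ih h2 ?_ fun t ht => ?_
    · by_cases h : IsDescent g s
      · exact (height_descent_le h).trans hg
      · rw [height_ascent h]
        exact max_le hg (Nat.succ_le_succ (hd s List.mem_cons_self))
    · rw [depth_mul_of_adj (h1 t ht)]
      exact hd t (List.mem_cons_of_mem _ ht)

lemma height_mul_clique_le {l : List (Letter V)} (hl : IsClique Γ l) (g : RAAG Γ) :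
    height (g * wordProd Γ l) ≤ height g + 1 :=
  height_mul_wordProd_le hl (Nat.le_succ _) fun _ _ => depth_le_height _ _

lemma height_le_mul_clique {l : List (Letter V)} (hl : IsClique Γ l) (g : RAAG Γ) :
    height g ≤ height (g * wordProd Γ l) + 1 := by
  have := height_mul_clique_le hl.inv (g * wordProd Γ l)
  rwa [hl.wordProd_inv, mul_inv_cancel_right] at this

lemma height_mul_toGroup_le (g : RAAG Γ) (s : Letter V) :
    height (g * s.toGroup Γ) ≤ height g + 1 := by
  simpa using height_mul_clique_le (isClique_singleton s) g

lemma height_le_mul_toGroup (g : RAAG Γ) (s : Letter V) :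
    height g ≤ height (g * s.toGroup Γ) + 1 := by
  simpa using height_le_mul_clique (isClique_singleton s) g

/-- If three vertices of a square are in a ball, so is the fourth. -/
lemma height_square {s t : Letter V} (h : Γ.Adj s.1 t.1) {g : RAAG Γ} {n : ℕ}
    (hs : height (g * s.toGroup Γ) ≤ n) (ht : height (g * t.toGroup Γ) ≤ n) :
    height (g * s.toGroup Γ * t.toGroup Γ) ≤ n := by
  by_cases h1 : IsDescent g s
  · rw [mul_mul_comm h]
    exact (height_descent_le ((isDescent_mul_iff h).2 h1)).trans ht
  by_cases h2 : IsDescent g t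
  · exact (height_descent_le ((isDescent_mul_iff h.symm).2 h2)).trans hs
  rw [height_ascent ((isDescent_mul_iff h.symm).not.2 h2), depth_mul_of_adj h]
  rw [height_ascent h2] at ht
  exact max_le hs ((le_max_right _ _).trans ht)

/-- The letter `b` is a piece of the top layer of `g`. -/
structure IsTop (g : RAAG Γ) (b : Letter V) : Prop where
  isDescent : IsDescent g b.inv
  depth_eq : depth g b.1 = height g

lemma exists_isTop {g : RAAG Γ} (hg : g ≠ 1) : ∃ b, IsTop g b := by
  induction g using induction_ascent with
  | one => exact (hg rfl).elim
  | mul g s hs ih =>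
    by_cases h : depth (g * s.toGroup Γ) s.1 = height (g * s.toGroup Γ)
    · exact ⟨s, isDescent_mul_inv_iff.2 hs, h⟩
    · have h1 := (depth_le_height (g * s.toGroup Γ) s.1).lt_of_ne h
      rw [depth_ascent_self hs] at h1
      have h2 := height_ascent hs
      have h3 : height (g * s.toGroup Γ) = height g := by omega
      obtain ⟨b, hb1, hb2⟩ := ih (by rintro rfl; rw [height_one] at h3; omega)
      have hadj : Γ.Adj b.inv.1 s.1 := by
        by_contra hadj
        have := depth_le_of_descent hb1 hadj
        simp only [Letter.inv_fst] at this
        omega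
      refine ⟨b, (isDescent_mul_iff hadj).2 hb1, ?_⟩
      rw [h3, ← hb2]
      exact depth_mul_of_adj hadj.symm

lemma exists_isTop_of_height {n : ℕ} {g : RAAG Γ} (hg : height g = n + 1) : ∃ b, IsTop g b :=
  exists_isTop (by rintro rfl; simp at hg)

lemma IsTop.not_isDescent {g : RAAG Γ} {b : Letter V} (h : IsTop g b) : ¬ IsDescent g b := by
  simpa using h.isDescent.not_inv

lemma IsTop.height_mul {g : RAAG Γ} {b : Letter V} (h : IsTop g b) :
    height (g * b.toGroup Γ) = height g + 1 := by
  rw [height_ascent h.not_isDescent, h.depth_eq]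
  simp

@[simp] lemma height_eq_zero {g : RAAG Γ} : height g = 0 ↔ g = 1 := by
  refine ⟨fun h => ?_, by rintro rfl; simp⟩
  by_contra hg
  obtain ⟨b, hb⟩ := exists_isTop hg
  have h1 := depth_pos_of_descent hb.isDescent
  have h2 := hb.depth_eq
  simp only [Letter.inv_fst] at h1
  omega

/-- The inverses of the letters of the top layer form a clique, and multiplication with it
removes the top layer. -/
lemma exists_top_clique {g : RAAG Γ} {n : ℕ} (hg : height g = n + 1) :
    ∃ l, IsClique Γ l ∧ (∀ s ∈ l, IsDescent g s ∧ depth g s.1 = n + 1) ∧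
      height (g * wordProd Γ l) = n := by
  induction hk : length g using Nat.strong_induction_on generalizing g with
  | _ k ih =>
  obtain ⟨b, hb1, hb2⟩ := exists_isTop (g := g) (by rintro rfl; simp at hg)
  rw [← Letter.inv_fst] at hb2
  generalize b.inv = s at hb1 hb2
  have h1 := length_descent hb1
  have h2 := height_descent_le hb1
  have h3 := height_le_mul_toGroup g s
  rcases (by omega : height (g * s.toGroup Γ) = n ∨ height (g * s.toGroup Γ) = n + 1) with h | h
  · exact ⟨[s], isClique_singleton s, by simp [hb1, hb2, hg], by simpa using h⟩
  · obtain ⟨l, hl1, hl2, hl3⟩ := ih _ (by omega) h rfl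
    have h4 := congrFun (depth_descent hb1) s.1
    simp only [stack, Letter.inv_fst, SimpleGraph.irrefl, if_false] at h4
    have h5 : ∀ t ∈ l, Γ.Adj s.1 t.1 := by
      intro t ht
      by_contra hadj
      have := depth_le_of_descent (hl2 t ht).1 fun h => hadj h.symm
      rw [(hl2 t ht).2] at this
      omega
    refine ⟨s :: l, isClique_cons.2 ⟨h5, hl1⟩, ?_, by rwa [wordProd_cons, ← mul_assoc]⟩
    intro t ht
    rcases List.mem_cons.1 ht with rfl | ht
    · exact ⟨hb1, hb2.trans hg⟩
    · obtain ⟨h6, h7⟩ := hl2 t ht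
      rw [depth_mul_of_adj (h5 t ht)] at h7
      exact ⟨(isDescent_mul_iff (h5 t ht).symm).1 h6, h7⟩

/-- A clique that makes `g` lower contains the inverses of all letters of the top layer. -/
lemma mem_of_height_mul_lt {n : ℕ} {s : Letter V} {l : List (Letter V)} (hl : IsClique Γ l) :
    ∀ {g : RAAG Γ}, IsDescent g s → n < depth g s.1 → height (g * wordProd Γ l) ≤ n →
      s ∈ l := by
  induction l with
  | nil =>
    intro g _ h h'
    have := depth_le_height g s.1
    simp only [wordProd_nil, mul_one] at h'
    omega
  | cons t l ih =>
    intro g hs h h'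
    obtain ⟨h1, h2⟩ := isClique_cons.1 hl
    by_cases hst : s = t
    · simp [hst]
    refine List.mem_cons_of_mem _ ?_
    by_cases ht : IsDescent g t
    · have hadj := hs.adj ht hst
      rw [wordProd_cons, ← mul_assoc] at h'
      exact ih h2 ((isDescent_mul_iff hadj).2 hs) (by rwa [depth_mul_of_adj hadj.symm]) h'
    · refine ih h2 hs h (le_trans ?_ h')
      rw [wordProd_cons, (commute_wordProd h1).eq, ← mul_assoc]
      exact height_ascent_le ((isDescent_mul_wordProd_iff h1).not.2 ht)

end RAAG

end

section

variable {V : Type*} {Γ : SimpleGraph V}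

namespace DomainFace

lemma sides_adj (p : DomainFace Γ) {s t : Letter V} (hs : DomainFacet.side s ∈ p.face)
    (ht : DomainFacet.side t ∈ p.face) (hst : s ≠ t) : Γ.Adj s.1 t.1 :=
  p.adjacent hs ht (by simpa using hst)

/-- The face of the domain `g` on the sides of a clique. -/
def ofClique (g : RAAG Γ) {l : List (Letter V)} (hl : RAAG.IsClique Γ l) : DomainFace Γ where
  dom := g
  face := DomainFacet.side '' {s | s ∈ l}
  valid := by
    rintro _ ⟨s, _, rfl⟩
    trivial
  adjacent := by
    rintro _ ⟨s, hs, rfl⟩ _ ⟨t, ht, rfl⟩ hst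
    exact hl.adj hs ht fun h => hst (h ▸ rfl)

@[simp] lemma side_mem_ofClique {g : RAAG Γ} {l : List (Letter V)} {hl : RAAG.IsClique Γ l}
    {s : Letter V} : DomainFacet.side s ∈ (ofClique g hl).face ↔ s ∈ l := by
  simp [ofClique]

end DomainFace

variable [DecidableEq V]

namespace Letter

@[simp] lemma flip_fst (a : V) (t : Letter V) : (t.flip a).1 = t.1 := by
  unfold Letter.flip
  split_ifs <;> rfl

lemma flip_self (t : Letter V) : t.flip t.1 = t.inv := if_pos rfl

lemma flip_of_ne {a : V} {t : Letter V} (h : t.1 ≠ a) : t.flip a = t := if_neg h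

@[simp] lemma flip_flip (a : V) (t : Letter V) : (t.flip a).flip a = t := by
  by_cases h : t.1 = a
  · subst h
    rw [flip_self, ← inv_fst, flip_self, inv_inv]
  · rw [flip_of_ne h, flip_of_ne h]

lemma flip_involutive (a : V) : Function.Involutive (Letter.flip a) := flip_flip a

lemma flip_comm (a b : V) (t : Letter V) : (t.flip a).flip b = (t.flip b).flip a := by
  by_cases h : t.1 = a
  · by_cases h' : t.1 = b
    · rw [← h, ← h']
    · rw [flip_of_ne h', flip_of_ne (by simpa using h')]
  · rw [flip_of_ne h, flip_of_ne (t := t.flip b) (by simpa using h)]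

end Letter

namespace DomainFacet

@[simp] lemma flip_side (a : V) (s : Letter V) : flip a (side s) = side (s.flip a) := rfl

@[simp] lemma flip_ideal (a : V) (F : Set (Letter V)) :
    flip a (ideal F) = ideal (Letter.flip a '' F) := rfl

@[simp] lemma flip_flip (a : V) (f : DomainFacet V) : flip a (flip a f) = f := by
  cases f with
  | side s => simp
  | ideal F => simp [Set.image_image]

lemma flip_involutive (a : V) : Function.Involutive (flip a) := flip_flip a

lemma flip_comm (a b : V) (f : DomainFacet V) : flip a (flip b f) = flip b (flip a f) := by
  cases f with
  | side s => simp [Letter.flip_comm]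
  | ideal F => simp [Set.image_image, Letter.flip_comm]

lemma Valid.flip {f : DomainFacet V} (h : f.Valid Γ) (a : V) : (f.flip a).Valid Γ := by
  cases f with
  | side s => trivial
  | ideal F =>
    have hinj := ((Letter.flip_involutive a).injective).injOn (s := F)
    refine ⟨(hinj.pairwise_image).2 ?_, fun h' => h.2 ?_⟩
    · exact h.1.imp fun s t hst => by simpa [Function.onFun] using hst
    · exact ((hinj.pairwise_image).1 h').imp fun s t hst => by simpa [Function.onFun] using hst

lemma Adjacent.flip {f f' : DomainFacet V} (h : f.Adjacent Γ f') (a : V) :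
    (f.flip a).Adjacent Γ (f'.flip a) := by
  have hinj := (Letter.flip_involutive a).injective
  cases f <;> cases f'
  · simpa [Adjacent] using h
  · exact Set.mem_image_of_mem _ h
  · exact Set.mem_image_of_mem _ h
  · exact h.imp (fun h => Function.Injective.image_strictMono hinj h) fun h => Function.Injective.image_strictMono hinj h

/-- The flips generate an action of the right-angled Artin group on the facets. -/
def action (Γ : SimpleGraph V) : RAAG Γ →* Equiv.Perm (DomainFacet V) :=
  PresentedGroup.toGroup (f := fun a => (flip_involutive a).toPerm) (by
    rintro r ⟨a, b, h, rfl⟩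
    have h1 : Commute (flip_involutive a).toPerm (flip_involutive b).toPerm :=
      Equiv.ext fun f => flip_comm a b f
    simp only [map_mul, FreeGroup.lift_apply_of, map_inv]
    rw [h1.eq]
    simp)

lemma action_toGroup (s : Letter V) (f : DomainFacet V) :
    action Γ (s.toGroup Γ) f = f.flip s.1 := by
  have h : action Γ (PresentedGroup.of s.1) = (flip_involutive s.1).toPerm :=
    PresentedGroup.toGroup.of _
  unfold Letter.toGroup
  split_ifs
  · rw [map_inv, h]
    rfl
  · rw [h]
    rfl

end DomainFacet

namespace DomainFace

/-- The same face, seen from the other side of the side `s`. -/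
def reflect (p : DomainFace Γ) (s : Letter V) : DomainFace Γ where
  dom := p.dom * s.toGroup Γ
  face := DomainFacet.flip s.1 '' p.face
  valid := by
    rintro _ ⟨f, hf, rfl⟩
    exact (p.valid f hf).flip _
  adjacent := ((DomainFacet.flip_involutive s.1).injective.injOn.pairwise_image).2
    (p.adjacent.imp fun _ _ h => h.flip _)

lemma glued_reflect {p : DomainFace Γ} {s : Letter V} (h : DomainFacet.side s ∈ p.face) :
    p.Glued (p.reflect s) := ⟨s, h, rfl, rfl⟩

lemma Glued.symm {p q : DomainFace Γ} (h : p.Glued q) : q.Glued p := by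
  obtain ⟨s, h1, h2, h3⟩ := h
  refine ⟨s.inv, ?_, by simp [h2], ?_⟩
  · rw [h3]
    exact ⟨_, h1, by simp [Letter.flip_self]⟩
  · rw [h3, Letter.inv_fst, Set.image_image]
    simp

lemma ncard_ofClique (g : RAAG Γ) {l : List (Letter V)} (hl : RAAG.IsClique Γ l) :
    (ofClique g hl).face.ncard = l.length := by
  have h : {s | s ∈ l} = (l.toFinset : Set (Letter V)) := by ext; simp
  rw [ofClique, Set.ncard_image_of_injective _ (fun s t h => by simpa using h), h,
    Set.ncard_coe_finset, List.toFinset_card_of_nodup hl.nodup]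

end DomainFace

namespace Cell

lemma mk_eq_iff {p q : DomainFace Γ} :
    mk p = mk q ↔ Relation.ReflTransGen DomainFace.Glued p q := by
  constructor
  · intro h
    have : Std.Symm (DomainFace.Glued (Γ := Γ)) := ⟨fun _ _ h => h.symm⟩
    have h1 := Quot.eqvGen_exact h
    clear h
    induction h1 with
    | rel _ _ h => exact .single h
    | refl _ => exact .refl
    | symm _ _ _ ih => exact Std.Symm.symm _ _ ih
    | trans _ _ _ _ _ ih1 ih2 => exact ih1.trans ih2
  · intro h
    induction h with
    | refl => rfl
    | tail _ h ih => exact ih.trans (Quot.sound h)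

lemma mk_reflect {p : DomainFace Γ} {s : Letter V} (h : DomainFacet.side s ∈ p.face) :
    mk (p.reflect s) = mk p := (Quot.sound (DomainFace.glued_reflect h)).symm

/-- The facets of a cell, moved to the domain `1`. -/
lemma action_image_eq {p q : DomainFace Γ} (h : mk p = mk q) :
    DomainFacet.action Γ p.dom '' p.face = DomainFacet.action Γ q.dom '' q.face := by
  induction mk_eq_iff.1 h with
  | refl => rfl
  | tail h1 h2 ih =>
    rw [ih (mk_eq_iff.2 h1)]
    obtain ⟨s, -, h3, h4⟩ := h2
    simp [h3, h4, Set.image_image, DomainFacet.action_toGroup]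

lemma ncard_eq {p q : DomainFace Γ} (h : mk p = mk q) : p.face.ncard = q.face.ncard := by
  have h1 := congrArg Set.ncard (action_image_eq h)
  rwa [Set.ncard_image_of_injective _ (Equiv.injective _),
    Set.ncard_image_of_injective _ (Equiv.injective _)] at h1

lemma exists_ideal_mem {p q : DomainFace Γ} (h : mk p = mk q)
    (hp : ∃ F, DomainFacet.ideal F ∈ p.face) : ∃ F, DomainFacet.ideal F ∈ q.face := by
  induction mk_eq_iff.1 h with
  | refl => exact hp
  | tail h1 h2 ih =>
    obtain ⟨F, hF⟩ := ih (mk_eq_iff.2 h1)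
    obtain ⟨s, -, h3, h4⟩ := h2
    rw [h4]
    exact ⟨_, _, hF, rfl⟩

lemma isIdeal_mk {p : DomainFace Γ} :
    (mk p).IsIdeal ↔ ∃ F, DomainFacet.ideal F ∈ p.face :=
  ⟨fun ⟨_, h, h1⟩ => exists_ideal_mem h h1, fun h => ⟨p, rfl, h⟩⟩

lemma hasCodim_mk {p : DomainFace Γ} {k : ℕ} : (mk p).HasCodim k ↔ p.face.ncard = k :=
  ⟨fun ⟨_, h, h1⟩ => ncard_eq h ▸ h1, fun h => ⟨p, rfl, h⟩⟩

lemma dom_mem_domains (p : DomainFace Γ) : p.dom ∈ (mk p).domains := ⟨p, rfl, rfl⟩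

lemma mem_domains_of_clique {l : List (Letter V)} (hl : RAAG.IsClique Γ l) :
    ∀ {p : DomainFace Γ}, (∀ s ∈ l, DomainFacet.side s ∈ p.face) →
      p.dom * RAAG.wordProd Γ l ∈ (mk p).domains := by
  induction l with
  | nil => intro p _; simpa using dom_mem_domains p
  | cons s l ih =>
    intro p h
    obtain ⟨h1, h2⟩ := RAAG.isClique_cons.1 hl
    have hs := h s List.mem_cons_self
    rw [RAAG.wordProd_cons, ← mul_assoc, ← mk_reflect hs]
    refine ih h2 fun t ht => ⟨_, h t (List.mem_cons_of_mem _ ht), ?_⟩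
    rw [DomainFacet.flip_side, Letter.flip_of_ne (h1 t ht).ne']

lemma exists_clique {p q : DomainFace Γ} (h : Relation.ReflTransGen DomainFace.Glued p q) :
    ∃ l, RAAG.IsClique Γ l ∧ (∀ s ∈ l, DomainFacet.side s ∈ p.face) ∧
      q.dom = p.dom * RAAG.wordProd Γ l := by
  induction h using Relation.ReflTransGen.head_induction_on with
  | refl => exact ⟨[], RAAG.isClique_nil, by simp, by simp⟩
  | @head p p' h1 h2 ih =>
    obtain ⟨l, hl, hm, hq⟩ := ih
    obtain ⟨s, hs, hd, hf⟩ := h1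
    have hm' : ∀ t ∈ l, DomainFacet.side (t.flip s.1) ∈ p.face := by
      intro t ht
      have h3 := hm t ht
      rw [hf] at h3
      obtain ⟨f, hf1, hf2⟩ := h3
      rwa [← DomainFacet.flip_side, ← hf2, DomainFacet.flip_flip]
    by_cases hsl : s.inv ∈ l
    · have hp := List.perm_cons_erase hsl
      have hl' := hl.of_perm hp
      refine ⟨l.erase s.inv, (RAAG.isClique_cons.1 hl').2, fun t ht => ?_, ?_⟩
      · have h3 := (RAAG.isClique_cons.1 hl').1 t ht
        have h4 := hm' t (List.mem_of_mem_erase ht)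
        rwa [Letter.flip_of_ne (by simpa using h3.ne')] at h4
      · rw [hq, hd, hl.perm hp]
        simp [mul_assoc]
    · have h3 : ∀ t ∈ l, DomainFacet.side t ∈ p.face ∧ Γ.Adj s.1 t.1 := by
        intro t ht
        have h4 := hm' t ht
        have h5 : t.1 ≠ s.1 := by
          intro h5
          rw [← h5, Letter.flip_self] at h4
          have h6 : s ≠ t.inv := fun h6 => hsl (by rwa [h6, Letter.inv_inv])
          exact (p.sides_adj hs h4 h6).ne h5.symm
        rw [Letter.flip_of_ne h5] at h4
        exact ⟨h4, p.sides_adj hs h4 fun h6 => h5 (h6 ▸ rfl)⟩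
      refine ⟨s :: l, RAAG.isClique_cons.2 ⟨fun t ht => (h3 t ht).2, hl⟩, ?_, ?_⟩
      · intro t ht
        rcases List.mem_cons.1 ht with rfl | ht
        · exact hs
        · exact (h3 t ht).1
      · rw [hq, hd, RAAG.wordProd_cons, mul_assoc]

lemma mem_domains_mk {p : DomainFace Γ} {g : RAAG Γ} : g ∈ (mk p).domains ↔
    ∃ l, RAAG.IsClique Γ l ∧ (∀ s ∈ l, DomainFacet.side s ∈ p.face) ∧
      g = p.dom * RAAG.wordProd Γ l := by
  constructor
  · rintro ⟨q, hq, rfl⟩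
    exact exists_clique (mk_eq_iff.1 hq.symm)
  · rintro ⟨l, hl, h, rfl⟩
    exact mem_domains_of_clique hl h

lemma exists_clique_of_mem_domains {c : Cell Γ} {g h : RAAG Γ} (hg : g ∈ c.domains)
    (hh : h ∈ c.domains) : ∃ l, RAAG.IsClique Γ l ∧ h = g * RAAG.wordProd Γ l := by
  obtain ⟨p, rfl, rfl⟩ := hg
  obtain ⟨l, hl, -, h⟩ := mem_domains_mk.1 hh
  exact ⟨l, hl, h⟩

lemma isFaceOf_mk {p p' : DomainFace Γ} (hd : p.dom = p'.dom) (hf : p'.face ⊆ p.face) :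
    (mk p).IsFaceOf (mk p') := ⟨p, p', rfl, rfl, hd, hf⟩

lemma IsFaceOf.domains_subset {c c' : Cell Γ} (h : c.IsFaceOf c') : c'.domains ⊆ c.domains := by
  obtain ⟨p, p', rfl, rfl, hd, hf⟩ := h
  intro g hg
  obtain ⟨l, hl, h, rfl⟩ := mem_domains_mk.1 hg
  exact mem_domains_mk.2 ⟨l, hl, fun s hs => hf (h s hs), by rw [hd]⟩

lemma IsFaceOf.not_isIdeal {c c' : Cell Γ} (h : c.IsFaceOf c') (hc : ¬ c.IsIdeal) :
    ¬ c'.IsIdeal := by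
  obtain ⟨p, p', rfl, rfl, hd, hf⟩ := h
  rw [isIdeal_mk] at hc ⊢
  exact fun ⟨F, hF⟩ => hc ⟨F, hf hF⟩

lemma domains_ofClique {g : RAAG Γ} {l : List (Letter V)} (hl : RAAG.IsClique Γ l) {h : RAAG Γ} :
    h ∈ (mk (DomainFace.ofClique g hl)).domains ↔
      ∃ l', RAAG.IsClique Γ l' ∧ (∀ s ∈ l', s ∈ l) ∧ h = g * RAAG.wordProd Γ l' := by
  simp only [mem_domains_mk, DomainFace.side_mem_ofClique]
  rfl

lemma not_isIdeal_ofClique {g : RAAG Γ} {l : List (Letter V)} (hl : RAAG.IsClique Γ l) :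
    ¬ (mk (DomainFace.ofClique g hl)).IsIdeal := by
  rw [isIdeal_mk]
  rintro ⟨F, s, -, h⟩
  cases h

end Cell

/-! ### Balls -/

lemma mem_growBall {B : Set (RAAG Γ)} {j : ℕ} {g : RAAG Γ} : g ∈ growBall Γ B j ↔
    g ∈ B ∨ ∃ k c, 1 ≤ k ∧ k ≤ j ∧ Cell.HasCodim c k ∧ g ∈ c.domains ∧
      (c.domains ∩ B).Nonempty := by
  induction j with
  | zero =>
    refine ⟨Or.inl, ?_⟩
    rintro (h | ⟨k, c, h1, h2, -⟩)
    · exact h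
    · omega
  | succ j ih =>
    simp only [growBall, Set.mem_union, ih, Set.mem_ofPred_eq]
    constructor
    · rintro ((h | ⟨k, c, h1, h2, h⟩) | ⟨c, h⟩)
      · exact Or.inl h
      · exact Or.inr ⟨k, c, h1, by omega, h⟩
      · exact Or.inr ⟨j + 1, c, by omega, le_rfl, h⟩
    · rintro (h | ⟨k, c, h1, h2, h⟩)
      · exact Or.inl (Or.inl h)
      · rcases h2.eq_or_lt with rfl | h2
        · exact Or.inr ⟨c, h⟩
        · exact Or.inl (Or.inr ⟨k, c, h1, by omega, h⟩)

theorem mem_ball [Fintype V] {n : ℕ} {g : RAAG Γ} : g ∈ ball Γ n ↔ RAAG.height g ≤ n := by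
  induction n generalizing g with
  | zero => simp [ball]
  | succ n ih =>
    rw [ball, mem_growBall, ih]
    constructor
    · rintro (h | ⟨k, c, -, -, -, h1, h, h2, h3⟩)
      · omega
      · obtain ⟨l, hl, rfl⟩ := Cell.exists_clique_of_mem_domains h2 h1
        have := RAAG.height_mul_clique_le hl h
        rw [ih] at h3
        omega
    · intro h
      rcases h.lt_or_eq with h | h
      · exact Or.inl (by omega)
      · obtain ⟨l, hl, -, hg⟩ := RAAG.exists_top_clique h
        refine Or.inr ⟨l.length, Cell.mk (DomainFace.ofClique g hl), ?_, hl.length_le, ?_,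
          Cell.dom_mem_domains _, _, Cell.mem_domains_of_clique hl (by simp), ?_⟩
        · rcases l with _ | _
          · simp at hg
            omega
          · simp
        · exact Cell.hasCodim_mk.2 (DomainFace.ncard_ofClique g hl)
        · rw [ih]
          exact hg.le

end

section

variable {V : Type*} {Γ : SimpleGraph V}

namespace RAAG

lemma IsClique.wordProd_eq_of_subset_singleton {l : List (Letter V)} (hl : IsClique Γ l)
    {s : Letter V} (h : ∀ t ∈ l, t = s) : wordProd Γ l = 1 ∨ wordProd Γ l = s.toGroup Γ := by
  rcases l with _ | ⟨x, _ | ⟨y, l⟩⟩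
  · simp
  · simp [h x]
  · have h1 := (isClique_cons.1 hl).1 y (by simp)
    rw [h x (by simp), h y (by simp)] at h1
    exact (h1.ne rfl).elim

lemma IsClique.wordProd_eq_of_subset_pair {l : List (Letter V)} (hl : IsClique Γ l)
    {s t : Letter V} (hst : Γ.Adj s.1 t.1) (h : ∀ x ∈ l, x = s ∨ x = t) :
    wordProd Γ l = 1 ∨ wordProd Γ l = s.toGroup Γ ∨ wordProd Γ l = t.toGroup Γ ∨
      wordProd Γ l = s.toGroup Γ * t.toGroup Γ := by
  rcases l with _ | ⟨x, _ | ⟨y, _ | ⟨z, l⟩⟩⟩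
  · simp
  · rcases h x (by simp) with rfl | rfl <;> simp
  · have h1 := hl.nodup
    rcases h x (by simp) with rfl | rfl <;> rcases h y (by simp) with rfl | rfl <;>
      simp_all [(toGroup_commute hst).eq]
  · have h1 := hl.nodup
    rcases h x (by simp) with rfl | rfl <;> rcases h y (by simp) with rfl | rfl <;>
      rcases h z (by simp) with rfl | rfl <;> simp at h1

end RAAG

open RAAG

lemma DomainFace.eq_of_dom_of_face {p q : DomainFace Γ} (hd : p.dom = q.dom)
    (hf : p.face = q.face) : p = q := by
  cases p
  cases q
  simp only at hd hf
  subst hd hf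
  rfl

lemma DomainFace.eq_ofClique_singleton {p : DomainFace Γ} {s : Letter V}
    (h : p.face = {DomainFacet.side s}) : p = ofClique p.dom (isClique_singleton s) :=
  eq_of_dom_of_face rfl (by simp [h, ofClique])

variable [DecidableEq V]

namespace Cell

lemma mem_domains_side {p : DomainFace Γ} {s : Letter V}
    (hs : ∀ t, DomainFacet.side t ∈ p.face → t = s) {g : RAAG Γ} (hg : g ∈ (mk p).domains) :
    g = p.dom ∨ g = p.dom * s.toGroup Γ := by
  obtain ⟨l, hl, h, rfl⟩ := mem_domains_mk.1 hg
  rcases hl.wordProd_eq_of_subset_singleton fun t ht => hs t (h t ht) with h | h <;> simp [h]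

lemma mem_domains_pair {p : DomainFace Γ} {s t : Letter V} (hst : Γ.Adj s.1 t.1)
    (hs : ∀ x, DomainFacet.side x ∈ p.face → x = s ∨ x = t) {g : RAAG Γ}
    (hg : g ∈ (mk p).domains) :
    g = p.dom ∨ g = p.dom * s.toGroup Γ ∨ g = p.dom * t.toGroup Γ ∨
      g = p.dom * s.toGroup Γ * t.toGroup Γ := by
  obtain ⟨l, hl, h, rfl⟩ := mem_domains_mk.1 hg
  rcases hl.wordProd_eq_of_subset_pair hst fun t ht => hs t (h t ht) with h | h | h | h <;>
    simp [h, mul_assoc]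

lemma IsBoundaryFacet.cases {B : Set (RAAG Γ)} {c : Cell Γ} (hc : c.IsBoundaryFacet B) :
    ∃ p, mk p = c ∧ p.dom ∈ B ∧
      ((∃ s, p.face = {DomainFacet.side s} ∧ p.dom * s.toGroup Γ ∉ B) ∨
        ∃ F, p.face = {DomainFacet.ideal F}) := by
  obtain ⟨h1, ⟨g, ⟨p, rfl, rfl⟩, hg⟩, h2⟩ := hc
  rw [hasCodim_mk, Set.ncard_eq_one] at h1
  obtain ⟨f, hf⟩ := h1
  refine ⟨p, rfl, hg, ?_⟩
  cases f with
  | ideal F => exact Or.inr ⟨F, hf⟩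
  | side s =>
    refine Or.inl ⟨s, hf, ?_⟩
    rcases h2 with h2 | ⟨h, h2, h3⟩
    · rw [isIdeal_mk] at h2
      simp [hf] at h2
    · rcases mem_domains_side (s := s) (by simp [hf]) h2 with rfl | rfl
      · exact (h3 hg).elim
      · exact h3

lemma IsBoundaryFacet.exists_domain {B : Set (RAAG Γ)} {c : Cell Γ}
    (hc : c.IsBoundaryFacet B) : ∃ g, c.domains ∩ B = {g} := by
  obtain ⟨p, rfl, h1, h2⟩ := hc.cases
  refine ⟨p.dom, Set.Subset.antisymm ?_ (by simpa using ⟨dom_mem_domains p, h1⟩)⟩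
  rintro g ⟨hg, hB⟩
  rcases h2 with ⟨s, hs, hsB⟩ | ⟨F, hF⟩
  · rcases mem_domains_side (s := s) (by simp [hs]) hg with rfl | rfl
    · rfl
    · exact (hsB hB).elim
  · obtain ⟨l, hl, h, rfl⟩ := mem_domains_mk.1 hg
    rcases l with _ | ⟨s, l⟩
    · simp
    · simpa [hF] using h s

/-- The domain of a boundary facet. -/
noncomputable def IsBoundaryFacet.domain {B : Set (RAAG Γ)} {c : Cell Γ}
    (hc : c.IsBoundaryFacet B) : RAAG Γ := hc.exists_domain.choose

lemma IsBoundaryFacet.domain_spec {B : Set (RAAG Γ)} {c : Cell Γ}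
    (hc : c.IsBoundaryFacet B) : c.domains ∩ B = {hc.domain} := hc.exists_domain.choose_spec

lemma IsBoundaryFacet.domain_mem {B : Set (RAAG Γ)} {c : Cell Γ}
    (hc : c.IsBoundaryFacet B) : hc.domain ∈ c.domains ∧ hc.domain ∈ B := by
  have h : hc.domain ∈ c.domains ∩ B := by rw [hc.domain_spec]; rfl
  exact h

lemma IsBoundaryFacet.eq_domain {B : Set (RAAG Γ)} {c : Cell Γ}
    (hc : c.IsBoundaryFacet B) {g : RAAG Γ} (hg : g ∈ c.domains) (hB : g ∈ B) :
    g = hc.domain := by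
  have h : g ∈ c.domains ∩ B := ⟨hg, hB⟩
  rw [hc.domain_spec] at h
  exact h

lemma square_mem_ball [Fintype V] {n : ℕ} {s t : Letter V} (h : Γ.Adj s.1 t.1) {g : RAAG Γ}
    (hs : g * s.toGroup Γ ∈ ball Γ n) (ht : g * t.toGroup Γ ∈ ball Γ n) :
    g * s.toGroup Γ * t.toGroup Γ ∈ ball Γ n := by
  rw [mem_ball] at *
  exact height_square h hs ht

lemma IsBoundaryFacet.domain_eq_of_ridge [Fintype V] {n : ℕ} {c c' r : Cell Γ}
    (hc : c.IsBoundaryFacet (ball Γ n)) (hc' : c'.IsBoundaryFacet (ball Γ n))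
    (hr : r.HasCodim 2) (hrc : r.IsFaceOf c) (hrc' : r.IsFaceOf c')
    (hflat : ¬ r.IsFlat (ball Γ n)) : hc.domain = hc'.domain := by
  by_contra hne
  have hg := hrc.domains_subset hc.domain_mem.1
  have hg' := hrc'.domains_subset hc'.domain_mem.1
  have hgB := hc.domain_mem.2
  have hgB' := hc'.domain_mem.2
  have hideal := hrc.not_isIdeal
  have hsub := hrc.domains_subset
  have hout := hc.2.2
  generalize hc.domain = g at *
  generalize hc'.domain = g' at *
  have hflat' : ¬ ∀ x ∈ r.domains, x ∈ ball Γ n → x = g ∨ x = g' := by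
    intro h
    apply hflat
    have h1 : r.domains ∩ ball Γ n = {g, g'} := by
      apply Set.Subset.antisymm
      · exact fun x hx => h x hx.1 hx.2
      · rintro x (rfl | rfl)
        · exact ⟨hg, hgB⟩
        · exact ⟨hg', hgB'⟩
    rw [IsFlat, h1, Set.ncard_pair hne]
  obtain ⟨q, rfl, rfl⟩ := hg
  by_cases hq : ∃ s, ∀ t, DomainFacet.side t ∈ q.face → t = s
  · obtain ⟨s, hs⟩ := hq
    apply hflat'
    intro x hx _
    rcases mem_domains_side hs hx with h | h
    · exact Or.inl h
    · rcases mem_domains_side hs hg' with h' | h'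
      · exact (hne h'.symm).elim
      · exact Or.inr (h.trans h'.symm)
  rw [hasCodim_mk, Set.ncard_eq_two] at hr
  obtain ⟨f₁, f₂, hf, hface⟩ := hr
  have hsides : ∃ s t, q.face = {DomainFacet.side s, DomainFacet.side t} ∧ s ≠ t := by
    rcases f₁ with s | F
    · rcases f₂ with t | F
      · exact ⟨s, t, hface, fun h => hf (h ▸ rfl)⟩
      · exact (hq ⟨s, by simp [hface]⟩).elim
    · rcases f₂ with t | F'
      · exact (hq ⟨t, by simp [hface]⟩).elim
      · obtain ⟨l, hl, h, rfl⟩ := mem_domains_mk.1 hg'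
        rcases l with _ | ⟨s, l⟩
        · simp at hne
        · simpa [hface] using h s
  obtain ⟨s, t, hst, hne'⟩ := hsides
  have hadj : Γ.Adj s.1 t.1 := q.sides_adj (by simp [hst]) (by simp [hst]) hne'
  have hdom : ∀ x ∈ (mk q).domains, _ := fun x hx =>
    mem_domains_pair (s := s) (t := t) hadj (by simp [hst]) hx
  have hnon : ¬ (mk q).IsIdeal := by simp [isIdeal_mk, hst]
  obtain ⟨m, hm1, hm2⟩ := hout.resolve_left (hideal hnon)
  replace hm1 := hdom m (hsub hm1)
  have h1 := square_mem_ball (n := n) hadj (g := q.dom)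
  have h2 := square_mem_ball (n := n) (s := s.inv) hadj (g := q.dom * s.toGroup Γ)
  have h3 := square_mem_ball (n := n) (s := t.inv) hadj.symm (g := q.dom * t.toGroup Γ)
  rw [Letter.mul_toGroup_inv] at h2 h3
  rw [mul_mul_comm hadj.symm] at h3
  replace h2 := h2 hgB
  replace h3 := h3 hgB
  apply hflat'
  intro x hx hxB
  rcases hdom x hx with rfl | rfl | rfl | rfl
  · exact Or.inl rfl
  all_goals
    right
    rcases hdom g' hg' with rfl | rfl | rfl | rfl
    · exact (hne rfl).elim
    all_goals first | rfl | (rcases hm1 with rfl | rfl | rfl | rfl <;> tauto)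

end Cell

section Tiles

variable [Fintype V] {n : ℕ}

/-- All facets of a tile belong to the same domain. -/
noncomputable def Tile.domain (T : Tile Γ n) : RAAG Γ :=
  Quot.lift (fun c : SphereFacet Γ n => c.2.domain)
    (fun _ _ ⟨_, h1, h2, h3, h4⟩ => Cell.IsBoundaryFacet.domain_eq_of_ridge _ _ h1 h2 h3 h4) T

lemma Tile.HasFacet.domain_eq {T : Tile Γ n} {c : SphereFacet Γ n} (h : T.HasFacet c) :
    c.2.domain = T.domain := by
  rw [← h]
  rfl

/-- The facet on the side `s` of a domain `g` of height `n+1`. -/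
def sideFacet {g : RAAG Γ} {s : Letter V} (hg : height g = n + 1)
    (hs : height (g * s.toGroup Γ) = n + 2) : SphereFacet Γ n :=
  ⟨Cell.mk (DomainFace.ofClique g (isClique_singleton s)),
    Cell.hasCodim_mk.2 (DomainFace.ncard_ofClique _ _),
    ⟨g, Cell.dom_mem_domains _, mem_ball.2 hg.le⟩,
    Or.inr ⟨g * s.toGroup Γ, Cell.domains_ofClique _ |>.2 ⟨[s], isClique_singleton s, by simp,
      by simp⟩, by rw [mem_ball]; omega⟩⟩

lemma mem_domains_sideFacet {g : RAAG Γ} {s : Letter V} (hg : height g = n + 1)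
    (hs : height (g * s.toGroup Γ) = n + 2) : g ∈ (sideFacet hg hs).1.domains :=
  Cell.dom_mem_domains _

lemma not_isIdeal_sideFacet {g : RAAG Γ} {s : Letter V} (hg : height g = n + 1)
    (hs : height (g * s.toGroup Γ) = n + 2) : ¬ (sideFacet hg hs).1.IsIdeal :=
  Cell.not_isIdeal_ofClique _

lemma domain_sideFacet {g : RAAG Γ} {s : Letter V} (hg : height g = n + 1)
    (hs : height (g * s.toGroup Γ) = n + 2) : (sideFacet hg hs).2.domain = g :=
  ((sideFacet hg hs).2.eq_domain (mem_domains_sideFacet hg hs) (mem_ball.2 hg.le)).symm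

lemma exists_eq_sideFacet {c : SphereFacet Γ n} (hc : ¬ c.1.IsIdeal) :
    ∃ (g : RAAG Γ) (s : Letter V) (hg : height g = n + 1)
      (hs : height (g * s.toGroup Γ) = n + 2), c = sideFacet hg hs := by
  obtain ⟨p, h1, h2, h3⟩ := c.2.cases
  rcases h3 with ⟨s, h3, h4⟩ | ⟨F, hF⟩
  · rw [mem_ball] at h2 h4
    have h5 := height_mul_toGroup_le p.dom s
    refine ⟨p.dom, s, by omega, by omega, Subtype.ext ?_⟩
    exact h1.symm.trans (congrArg Cell.mk (DomainFace.eq_ofClique_singleton h3))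
  · rw [← h1, Cell.isIdeal_mk] at hc
    simp [hF] at hc

lemma sideFacet_eq_of_adj {g : RAAG Γ} {s t : Letter V} (hg : height g = n + 1)
    (hs : height (g * s.toGroup Γ) = n + 2) (ht : height (g * t.toGroup Γ) = n + 2)
    (hst : Γ.Adj s.1 t.1) :
    (Quot.mk _ (sideFacet hg hs) : Tile Γ n) = Quot.mk _ (sideFacet hg ht) := by
  refine Quot.sound ⟨Cell.mk (DomainFace.ofClique g (isClique_pair hst)),
    Cell.hasCodim_mk.2 (DomainFace.ncard_ofClique _ _), Cell.isFaceOf_mk rfl ?_,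
    Cell.isFaceOf_mk rfl ?_, ?_⟩
  · simp [DomainFace.ofClique]
  · simp [DomainFace.ofClique]
  · have h1 : (Cell.mk (DomainFace.ofClique g (isClique_pair hst))).domains ∩ ball Γ (n + 1) =
        {g} := by
      apply Set.Subset.antisymm
      · rintro x ⟨hx, hxB⟩
        rw [mem_ball] at hxB
        have hst' := height_ascent_le (g := g * s.toGroup Γ) (s := t)
          ((isDescent_mul_iff hst.symm).not.2 (not_isDescent_of_height_lt (by omega)))
        rcases Cell.mem_domains_pair hst (by simp) hx with rfl | rfl | rfl | rfl
        · rfl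
        all_goals simp only [DomainFace.ofClique] at hxB; omega
      · rintro x rfl
        exact ⟨Cell.dom_mem_domains _, mem_ball.2 hg.le⟩
    simp [Cell.IsFlat, h1]

/-- The ideal facet of a domain, for a pair of generators that do not commute. -/
def idealFace (g : RAAG Γ) {s t : Letter V} (hne : s.1 ≠ t.1) (hst : ¬ Γ.Adj s.1 t.1) :
    DomainFace Γ where
  dom := g
  face := {DomainFacet.ideal {s, t}}
  valid := by
    rintro _ rfl
    refine ⟨?_, fun h => hst (h (by simp) (by simp) fun h => hne (h ▸ rfl))⟩
    rintro x (rfl | rfl) y (rfl | rfl) h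
    exacts [(h rfl).elim, hne, hne.symm, (h rfl).elim]
  adjacent := Set.pairwise_singleton _ _

/-- The ridge of a domain between a side and an ideal facet. -/
def idealRidge (g : RAAG Γ) {s t : Letter V} (hne : s.1 ≠ t.1) (hst : ¬ Γ.Adj s.1 t.1)
    {x : Letter V} (hx : x = s ∨ x = t) : DomainFace Γ where
  dom := g
  face := {DomainFacet.side x, DomainFacet.ideal {s, t}}
  valid := by
    rintro _ (rfl | h)
    · trivial
    · exact (idealFace g hne hst).valid _ h
  adjacent := by
    rintro _ (rfl | rfl) _ (rfl | rfl) h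
    exacts [(h rfl).elim, hx, hx, (h rfl).elim]

lemma domains_idealRidge {g : RAAG Γ} {s t : Letter V} (hne : s.1 ≠ t.1)
    (hst : ¬ Γ.Adj s.1 t.1) {x : Letter V} (hx : x = s ∨ x = t) (hg : height g = n + 1)
    (hgx : height (g * x.toGroup Γ) = n + 2) :
    (Cell.mk (idealRidge g hne hst hx)).domains ∩ ball Γ (n + 1) = {g} := by
  apply Set.Subset.antisymm
  · rintro y ⟨hy, hyB⟩
    rw [mem_ball] at hyB
    rcases Cell.mem_domains_side (s := x) (by simp [idealRidge]) hy with rfl | rfl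
    · rfl
    · simp only [idealRidge] at hyB
      omega
  · rintro y rfl
    exact ⟨Cell.dom_mem_domains _, mem_ball.2 hg.le⟩

lemma sideFacet_eq_of_not_adj {g : RAAG Γ} {s t : Letter V} (hg : height g = n + 1)
    (hs : height (g * s.toGroup Γ) = n + 2) (ht : height (g * t.toGroup Γ) = n + 2)
    (hne : s.1 ≠ t.1) (hst : ¬ Γ.Adj s.1 t.1) :
    (Quot.mk _ (sideFacet hg hs) : Tile Γ n) = Quot.mk _ (sideFacet hg ht) := by
  have hI : (Cell.mk (idealFace g hne hst)).IsBoundaryFacet (ball Γ (n + 1)) :=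
    ⟨Cell.hasCodim_mk.2 (Set.ncard_singleton _), ⟨g, Cell.dom_mem_domains _, mem_ball.2 hg.le⟩,
      Or.inl (Cell.isIdeal_mk.2 ⟨_, rfl⟩)⟩
  have key : ∀ (x : Letter V) (hx : x = s ∨ x = t) (hgx : height (g * x.toGroup Γ) = n + 2),
      (Quot.mk _ (sideFacet hg hgx) : Tile Γ n) = Quot.mk _ ⟨_, hI⟩ := by
    intro x hx hgx
    refine Quot.sound ⟨Cell.mk (idealRidge g hne hst hx), Cell.hasCodim_mk.2 ?_,
      Cell.isFaceOf_mk rfl ?_, Cell.isFaceOf_mk rfl ?_, ?_⟩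
    · exact Set.ncard_pair (by simp)
    · simp [DomainFace.ofClique, idealRidge]
    · simp [idealFace, idealRidge]
    · simp [Cell.IsFlat, domains_idealRidge hne hst hx hg hgx]
  exact (key s (Or.inl rfl) hs).trans (key t (Or.inr rfl) ht).symm

lemma sideFacet_eq_of_ne {g : RAAG Γ} {s t : Letter V} (hg : height g = n + 1)
    (hs : height (g * s.toGroup Γ) = n + 2) (ht : height (g * t.toGroup Γ) = n + 2)
    (hne : s.1 ≠ t.1) :
    (Quot.mk _ (sideFacet hg hs) : Tile Γ n) = Quot.mk _ (sideFacet hg ht) := by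
  by_cases hst : Γ.Adj s.1 t.1
  · exact sideFacet_eq_of_adj hg hs ht hst
  · exact sideFacet_eq_of_not_adj hg hs ht hne hst

/-- All sides of a domain that are not covered belong to the same tile. -/
lemma sideFacet_eq {g : RAAG Γ} {s t : Letter V} (hg : height g = n + 1)
    (hs : height (g * s.toGroup Γ) = n + 2) (ht : height (g * t.toGroup Γ) = n + 2) :
    (Quot.mk _ (sideFacet hg hs) : Tile Γ n) = Quot.mk _ (sideFacet hg ht) := by
  by_cases hne : s.1 = t.1
  · rcases Letter.eq_or_eq_inv_of_fst_eq hne with rfl | rfl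
    · rfl
    · obtain ⟨b, hb⟩ := exists_isTop_of_height hg
      have h1 : height (g * b.toGroup Γ) = n + 2 := by rw [hb.height_mul, hg]
      have h2 := height_descent_le hb.isDescent
      have h3 : b.1 ≠ t.1 := by
        intro h
        rcases Letter.eq_or_eq_inv_of_fst_eq h with rfl | rfl
        · omega
        · rw [Letter.inv_inv] at h2
          omega
      exact (sideFacet_eq_of_ne hg hs h1 h3.symm).trans (sideFacet_eq_of_ne hg h1 ht h3)
  · exact sideFacet_eq_of_ne hg hs ht hne

variable {H : Set (RAAG Γ)}

lemma NonIdealTile.height_domain (T : NonIdealTile Γ H n) : height T.1.domain = n + 1 := by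
  obtain ⟨T, c, h1, h2, -⟩ := T
  obtain ⟨g, s, hg, hs, rfl⟩ := exists_eq_sideFacet h2
  rw [← h1.domain_eq, domain_sideFacet, hg]

lemma NonIdealTile.domain_mem (T : NonIdealTile Γ H n) : T.1.domain ∈ H := by
  obtain ⟨T, c, h1, -, g, hg1, hg2, hg3⟩ := T
  rw [← h1.domain_eq, ← c.2.eq_domain hg1 hg2]
  exact hg3

lemma NonIdealTile.domain_injective :
    Function.Injective fun T : NonIdealTile Γ H n => T.1.domain := by
  rintro ⟨T, c, h1, h2, h3⟩ ⟨T', c', h1', h2', h3'⟩ h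
  obtain ⟨g, s, hg, hs, rfl⟩ := exists_eq_sideFacet h2
  obtain ⟨g', s', hg', hs', rfl⟩ := exists_eq_sideFacet h2'
  simp only at h
  rw [← h1.domain_eq, ← h1'.domain_eq, domain_sideFacet, domain_sideFacet] at h
  subst h
  apply Subtype.ext
  simp only
  rw [← h1, ← h1']
  exact sideFacet_eq hg hs hs'

/-- The non-ideal tile of a domain, with a facet on a given side. -/
lemma exists_nonIdealTile {g : RAAG Γ} (hH : g ∈ H) (hg : height g = n + 1) :
    ∃ T : NonIdealTile Γ H n, T.1.domain = g ∧
      ∀ (s : Letter V) (hs : height (g * s.toGroup Γ) = n + 2), T.1.HasFacet (sideFacet hg hs) := by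
  obtain ⟨b, hb⟩ := exists_isTop_of_height hg
  have h1 : height (g * b.toGroup Γ) = n + 2 := by rw [hb.height_mul, hg]
  refine ⟨⟨Quot.mk _ (sideFacet hg h1), _, rfl, not_isIdeal_sideFacet _ _, g,
    mem_domains_sideFacet _ _, mem_ball.2 hg.le, hH⟩, domain_sideFacet hg h1, fun s hs => ?_⟩
  exact sideFacet_eq hg hs h1

/-- The non-ideal tiles correspond to the domains in `H` in the outermost layer. -/
noncomputable def nonIdealTileEquiv (H : Set (RAAG Γ)) (n : ℕ) :
    NonIdealTile Γ H n ≃ {g : RAAG Γ // g ∈ H ∧ height g = n + 1} :=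
  Equiv.ofBijective (fun T => ⟨T.1.domain, T.domain_mem, T.height_domain⟩)
    ⟨fun _ _ h => NonIdealTile.domain_injective (congrArg Subtype.val h), fun ⟨g, hH, hg⟩ => by
      obtain ⟨T, hT, -⟩ := exists_nonIdealTile hH hg
      exact ⟨T, Subtype.ext hT⟩⟩

end Tiles

end

section

open RAAG

variable {V : Type*} {Γ : SimpleGraph V}

namespace RAAG

/-- The set `H` contains `1` and is convex in the Cayley graph: it contains all geodesics between
its elements. -/
structure IsConvex (H : Set (RAAG Γ)) : Prop where
  one_mem : 1 ∈ H
  mul_mem : ∀ ⦃g⦄, g ∈ H → ∀ ⦃h⦄, h ∈ H → ∀ ⦃s : Letter V⦄, IsDescent (g⁻¹ * h) s →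
    h * s.toGroup Γ ∈ H

lemma isConvex_univ : IsConvex (Set.univ : Set (RAAG Γ)) := ⟨trivial, fun _ _ _ _ _ _ => trivial⟩

lemma IsConvex.mul_wordProd_mem {H : Set (RAAG Γ)} (hH : IsConvex H) {l : List (Letter V)}
    (hl : IsClique Γ l) : ∀ {h : RAAG Γ}, h ∈ H → (∀ s ∈ l, IsDescent h s) →
      h * wordProd Γ l ∈ H := by
  induction l with
  | nil => simp
  | cons s l ih =>
    intro h hh hd
    obtain ⟨h1, h2⟩ := isClique_cons.1 hl
    rw [wordProd_cons, ← mul_assoc]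
    refine ih h2 (hH.mul_mem hH.one_mem hh ?_) fun t ht => ?_
    · simpa using hd s List.mem_cons_self
    · exact (isDescent_mul_iff (h1 t ht).symm).2 (hd t (List.mem_cons_of_mem _ ht))

end RAAG

variable [DecidableEq V]

namespace DomainFacet

lemma action_wordProd_side_of_forall_ne {t : Letter V} {l : List (Letter V)}
    (h : ∀ x ∈ l, t.1 ≠ x.1) : action Γ (wordProd Γ l) (side t) = side t := by
  induction l with
  | nil => simp
  | cons x l ih =>
    rw [wordProd_cons, map_mul, Equiv.Perm.mul_apply,
      ih fun y hy => h y (List.mem_cons_of_mem _ hy), action_toGroup, flip_side,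
      Letter.flip_of_ne (h x List.mem_cons_self)]

lemma action_wordProd_side {t : Letter V} {l : List (Letter V)} (hl : IsClique Γ l)
    (h : t ∈ l) : action Γ (wordProd Γ l) (side t.inv) = side t := by
  have hp := List.perm_cons_erase h
  have hl' := (isClique_cons.1 (hl.of_perm hp)).1
  rw [hl.perm hp, wordProd_cons, map_mul, Equiv.Perm.mul_apply,
    action_wordProd_side_of_forall_ne (t := t.inv) fun x hx => (hl' x hx).ne, action_toGroup, flip_side,
    ← Letter.inv_fst t, Letter.flip_self, Letter.inv_inv]

end DomainFacet

lemma Cell.side_inv_mem {p q : DomainFace Γ} (h : mk p = mk q) {l : List (Letter V)}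
    (hl : IsClique Γ l) (hq : q.dom = p.dom * wordProd Γ l) {t : Letter V} (ht : t ∈ l)
    (hp : DomainFacet.side t ∈ p.face) : DomainFacet.side t.inv ∈ q.face := by
  have h1 := Set.mem_image_of_mem (DomainFacet.action Γ p.dom) hp
  rw [action_image_eq h] at h1
  obtain ⟨f, hf, hf1⟩ := h1
  rw [hq, map_mul, Equiv.Perm.mul_apply, EmbeddingLike.apply_eq_iff_eq,
    ← DomainFacet.action_wordProd_side hl ht, EmbeddingLike.apply_eq_iff_eq] at hf1
  exact hf1 ▸ hf

variable [Fintype V] {H : Set (RAAG Γ)}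

lemma NonIdealTile.hasFacet {n : ℕ} (T : NonIdealTile Γ H n) {g : RAAG Γ} (hT : T.1.domain = g)
    {s : Letter V} (hg : height g = n + 1) (hs : height (g * s.toGroup Γ) = n + 2) :
    T.1.HasFacet (sideFacet hg hs) := by
  obtain ⟨T', h1, h2⟩ := exists_nonIdealTile (hT ▸ T.domain_mem) hg
  rw [← NonIdealTile.domain_injective (h1.trans hT.symm)]
  exact h2 s hs

/-! ### Edges of the history graph -/

lemma subdivides_of_clique {n : ℕ} {h : RAAG Γ} {l : List (Letter V)} (hl : IsClique Γ l)
    (hd : ∀ s ∈ l, IsDescent h s ∧ depth h s.1 = n + 2)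
    (hg : height (h * wordProd Γ l) = n + 1) (hh : height h = n + 2)
    {T : NonIdealTile Γ H n} (hT : T.1.domain = h * wordProd Γ l)
    {T' : NonIdealTile Γ H (n + 1)} (hT' : T'.1.domain = h) : Subdivides T.1 T'.1 := by
  have key : ∀ {l' : List (Letter V)}, IsClique Γ l' → height (h * wordProd Γ l') ≤ n + 1 →
      ∀ s ∈ l, s ∈ l' := fun hl' h1 s hs =>
    mem_of_height_mul_lt hl' (hd s hs).1 (by rw [(hd s hs).2]; omega) h1
  have hgc : h * wordProd Γ l ∈ (Cell.mk (DomainFace.ofClique h hl)).domains :=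
    Cell.mem_domains_of_clique hl (by simp)
  refine ⟨Cell.mk (DomainFace.ofClique h hl), h, Cell.not_isIdeal_ofClique hl, ?_,
    ⟨by rw [mem_ball]; omega, Cell.dom_mem_domains _, ⟨_, hgc, mem_ball.2 hg.le⟩, ?_⟩, ?_, ?_⟩
  · have h1 : (Cell.mk (DomainFace.ofClique h hl)).domains ∩ ball Γ (n + 1) =
        {h * wordProd Γ l} := by
      apply Set.Subset.antisymm
      · rintro x ⟨hx, hxB⟩
        rw [mem_ball] at hxB
        obtain ⟨l', hl', hsub, rfl⟩ := (Cell.domains_ofClique hl).1 hx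
        have hp : l'.Perm l := (List.perm_ext_iff_of_nodup hl'.nodup hl.nodup).2 fun s =>
          ⟨hsub s, key hl' hxB s⟩
        rw [hl'.perm hp]
        rfl
      · rintro x rfl
        exact ⟨hgc, mem_ball.2 hg.le⟩
    rw [Cell.IsConvex, h1, Set.ncard_singleton]
  · rintro c' ⟨p, rfl, rfl⟩ ⟨x, hx, hxB⟩
    rw [mem_ball] at hxB
    obtain ⟨l', hl', hsub, rfl⟩ := Cell.mem_domains_mk.1 hx
    refine Cell.isFaceOf_mk rfl ?_
    rintro _ ⟨s, hs, rfl⟩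
    exact hsub s (key hl' hxB s hs)
  · obtain ⟨t, l₀, hl0⟩ : ∃ t l₀, l = t :: l₀ :=
      List.exists_cons_of_ne_nil (by rintro rfl; simp at hg; omega)
    have ht : t ∈ l := by simp [hl0]
    have h1 : height (h * wordProd Γ l * t.inv.toGroup Γ) = n + 2 := by
      have h2 : h * wordProd Γ l * t.inv.toGroup Γ = h * wordProd Γ l₀ := by
        subst hl0
        rw [wordProd_cons, (commute_wordProd (isClique_cons.1 hl).1).eq, ← mul_assoc]
        simp
      have h3 := height_mul_toGroup_le (h * wordProd Γ l) t.inv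
      have h4 : ¬ height (h * wordProd Γ l₀) ≤ n + 1 := fun h5 => by
        subst hl0
        have h6 := key (isClique_cons.1 hl).2 h5 t ht
        exact ((isClique_cons.1 hl).1 t h6).ne rfl
      rw [h2] at h3 ⊢
      omega
    refine ⟨sideFacet hg h1, T.hasFacet hT hg h1, ?_⟩
    obtain ⟨p, hp1, hp2⟩ := hgc
    rw [← hp1]
    refine Cell.isFaceOf_mk hp2 ?_
    rintro _ ⟨s, hs, rfl⟩
    obtain rfl : s = t.inv := by simpa using hs
    exact Cell.side_inv_mem hp1.symm hl hp2 ht (by simpa using ht)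
  · obtain ⟨c, hc, -⟩ := T'.2
    refine ⟨c, hc, ?_⟩
    rw [← hT', ← hc.domain_eq]
    exact c.2.domain_mem.1

lemma shareRidge_of_ascent {n : ℕ} {g : RAAG Γ} {s : Letter V} (hs : ¬ IsDescent g s)
    (hg : height g = n + 1) (hgs : height (g * s.toGroup Γ) = n + 1)
    {T T' : NonIdealTile Γ H n} (hT : T.1.domain = g) (hT' : T'.1.domain = g * s.toGroup Γ) :
    ShareRidge T.1 T'.1 := by
  obtain ⟨b, hb⟩ := exists_isTop_of_height hg
  have hadj : Γ.Adj b.1 s.1 := by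
    by_contra hadj
    have h1 := depth_le_of_descent hb.isDescent (by simpa using hadj)
    have h2 := height_ascent hs
    have h3 := hb.depth_eq
    rw [Letter.inv_fst] at h1
    omega
  have hb' : IsTop (g * s.toGroup Γ) b :=
    ⟨(isDescent_mul_iff (s := b.inv) hadj).2 hb.isDescent, by
      rw [depth_mul_of_adj hadj.symm, hb.depth_eq, hg, hgs]⟩
  have h1 : height (g * b.toGroup Γ) = n + 2 := by rw [hb.height_mul, hg]
  have h2 : height (g * s.toGroup Γ * b.toGroup Γ) = n + 2 := by rw [hb'.height_mul, hgs]
  refine ⟨sideFacet hg h1, sideFacet hgs h2, T.hasFacet hT _ _, T'.hasFacet hT' _ _,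
    Cell.mk (DomainFace.ofClique g (isClique_pair hadj)),
    Cell.hasCodim_mk.2 (DomainFace.ncard_ofClique _ _), Cell.isFaceOf_mk rfl ?_, ?_⟩
  · simp [DomainFace.ofClique]
  · rw [← Cell.mk_reflect (s := s) (by simp)]
    refine Cell.isFaceOf_mk rfl ?_
    rintro _ ⟨t, ht, rfl⟩
    obtain rfl : t = b := by simpa using ht
    exact ⟨DomainFacet.side t, by simp, by rw [DomainFacet.flip_side, Letter.flip_of_ne hadj.ne]⟩

namespace HistoryVertex

/-- The level of a vertex of the history graph. -/
def level : HistoryVertex Γ H → ℕ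
  | none => 0
  | some ⟨n, _⟩ => n + 1

/-- The domain of a vertex of the history graph. -/
noncomputable def domain : HistoryVertex Γ H → RAAG Γ
  | none => 1
  | some ⟨_, T⟩ => T.1.domain

lemma height_domain (v : HistoryVertex Γ H) : height (domain v) = level v := by
  rcases v with _ | ⟨n, T⟩
  · simp [domain, level]
  · exact T.height_domain

lemma domain_mem (hH : 1 ∈ H) (v : HistoryVertex Γ H) : domain v ∈ H := by
  rcases v with _ | ⟨n, T⟩
  · exact hH
  · exact T.domain_mem

lemma domain_injective : Function.Injective (domain : HistoryVertex Γ H → RAAG Γ) := by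
  intro u v h
  have h1 : level u = level v := by rw [← height_domain, h, height_domain]
  rcases u with _ | ⟨n, T⟩ <;> rcases v with _ | ⟨m, T'⟩
  · rfl
  · simp [level] at h1
  · simp [level] at h1
  · obtain rfl : n = m := by simpa [level] using h1
    rw [NonIdealTile.domain_injective h]

lemma exists_domain_eq {g : RAAG Γ} (hg : g ∈ H) : ∃ v : HistoryVertex Γ H, domain v = g := by
  rcases hn : height g with _ | n
  · exact ⟨none, (height_eq_zero.1 hn).symm⟩
  · obtain ⟨T, hT, -⟩ := exists_nonIdealTile hg hn
    exact ⟨some ⟨n, T⟩, hT⟩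

end HistoryVertex

open HistoryVertex

lemma HistoryEdge.exists_clique {u v : HistoryVertex Γ H} (h : HistoryEdge Γ H u v) :
    ∃ l, IsClique Γ l ∧ domain v = domain u * wordProd Γ l := by
  cases h with
  | root T =>
    obtain ⟨l, h1, -, h2⟩ := exists_top_clique T.height_domain
    refine ⟨l.map Letter.inv, h1.inv, ?_⟩
    rw [height_eq_zero, mul_eq_one_iff_eq_inv] at h2
    simp only [domain, h1.wordProd_inv, one_mul]
    exact h2
  | dual T T' h =>
    obtain ⟨c, c', hc, hc', r, -, hr, hr'⟩ := h
    refine Cell.exists_clique_of_mem_domains (c := r) ?_ ?_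
    · simp only [domain, ← hc.domain_eq]
      exact hr.domains_subset c.2.domain_mem.1
    · simp only [domain, ← hc'.domain_eq]
      exact hr'.domains_subset c'.2.domain_mem.1
  | @vertical n T T' h =>
    obtain ⟨c, h, hc, -, ⟨hh, hhc, -⟩, ⟨f, hf, hcf⟩, ⟨f', hf', hhf⟩⟩ := h
    have h1 := hcf.domains_subset f.2.domain_mem.1
    rw [hf.domain_eq] at h1
    obtain ⟨l, hl, h2⟩ := Cell.exists_clique_of_mem_domains h1 hhc
    have h3 : h ∈ ball Γ (n + 1 + 1) := by
      have := height_mul_clique_le hl T.1.domain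
      rw [← h2, T.height_domain] at this
      exact mem_ball.2 this
    have h4 := f'.2.eq_domain hhf h3
    rw [hf'.domain_eq] at h4
    exact ⟨l, hl, h4.symm.trans h2⟩

lemma HistoryEdge.level_le {u v : HistoryVertex Γ H} (h : HistoryEdge Γ H u v) :
    level v ≤ level u + 1 ∧ level u ≤ level v + 1 := by
  cases h <;> simp [level]

lemma historyGraph_length_le {u v : HistoryVertex Γ H} (h : (historyGraph Γ H).Adj u v) :
    RAAG.length ((domain u)⁻¹ * domain v) ≤ Fintype.card V := by
  rcases h.2 with h | h
  · obtain ⟨l, hl, h⟩ := h.exists_clique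
    rw [h, inv_mul_cancel_left]
    exact (length_wordProd_le l).trans hl.length_le
  · obtain ⟨l, hl, h⟩ := h.exists_clique
    rw [h, mul_inv_rev, inv_mul_cancel_right, length_inv]
    exact (length_wordProd_le l).trans hl.length_le

lemma historyGraph_level_le {u v : HistoryVertex Γ H} (h : (historyGraph Γ H).Adj u v) :
    level v ≤ level u + 1 := by
  rcases h.2 with h | h
  · exact h.level_le.1
  · exact h.level_le.2

lemma historyGraph_adj_of_ascent {u v : HistoryVertex Γ H} {s : Letter V}
    (hs : ¬ IsDescent (domain u) s) (h : domain v = domain u * s.toGroup Γ) :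
    (historyGraph Γ H).Adj u v := by
  have hne : u ≠ v := by
    rintro rfl
    have h1 := length_toGroup (Γ := Γ) s
    rw [left_eq_mul] at h
    rw [h, length_one] at h1
    omega
  refine ⟨hne, Or.inl ?_⟩
  have h1 := height_ascent hs
  have h2 := depth_ascent_self hs
  have h3 := height_mul_toGroup_le (domain u) s
  have hu := height_domain u
  have hv := height_domain v
  rw [h] at hv
  have h4 := isDescent_mul_inv_iff.2 hs
  rcases u with _ | ⟨n, T⟩ <;> rcases v with _ | ⟨m, T'⟩
  · exact (hne rfl).elim
  · simp only [level] at hu hv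
    obtain rfl : m = 0 := by omega
    exact .root T'
  · simp only [level] at hu hv
    omega
  · simp only [level] at hu hv
    rcases (by omega : m = n ∨ m = n + 1) with rfl | rfl
    · exact .dual T T' (shareRidge_of_ascent hs hu hv rfl h)
    · refine .vertical T T' (subdivides_of_clique (h := domain (some ⟨n, T⟩) * s.toGroup Γ)
        (isClique_singleton s.inv) ?_ ?_ hv ?_ h)
      · intro t ht
        obtain rfl : t = s.inv := by simpa using ht
        exact ⟨h4, by rw [Letter.inv_fst]; omega⟩
      · simpa using hu
      · simp [domain]

lemma historyGraph_adj_of_mul {u v : HistoryVertex Γ H} {s : Letter V}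
    (h : domain v = domain u * s.toGroup Γ) : (historyGraph Γ H).Adj u v := by
  by_cases hs : IsDescent (domain u) s
  · refine (historyGraph_adj_of_ascent (s := s.inv) ?_ ?_).symm
    · rw [h, isDescent_mul_inv_iff, not_not]
      exact hs
    · rw [h, Letter.mul_toGroup_inv]
  · exact historyGraph_adj_of_ascent hs h

/-! ### Distances in the history graph -/

variable (hH : IsConvex H)
include hH

lemma exists_walk_length_le (u v : HistoryVertex Γ H) :
    ∃ p : (historyGraph Γ H).Walk u v, p.length ≤ RAAG.length ((domain u)⁻¹ * domain v) := by
  induction hn : RAAG.length ((domain u)⁻¹ * domain v) generalizing v with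
  | zero =>
    rw [length_eq_zero, inv_mul_eq_one] at hn
    obtain rfl := domain_injective hn
    exact ⟨.nil, le_rfl⟩
  | succ n ih =>
    obtain ⟨s, hs⟩ := exists_descent (g := (domain u)⁻¹ * domain v) (by
      intro h
      rw [h, length_one] at hn
      omega)
    have h1 := length_descent hs
    obtain ⟨w, hw⟩ := exists_domain_eq (hH.mul_mem (domain_mem hH.one_mem u)
      (domain_mem hH.one_mem v) hs)
    obtain ⟨p, hp⟩ := ih w (by rw [hw, ← mul_assoc]; omega)
    have h2 : (historyGraph Γ H).Adj w v :=
      historyGraph_adj_of_mul (s := s.inv) (by rw [hw, Letter.mul_toGroup_inv])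
    refine ⟨p.concat h2, ?_⟩
    rw [SimpleGraph.Walk.length_concat]
    omega

lemma historyGraph_connected : (historyGraph Γ H).Connected :=
  have : Nonempty (HistoryVertex Γ H) := ⟨none⟩
  ⟨fun u v => (exists_walk_length_le hH u v).choose.reachable⟩

lemma historyGraph_dist_le (u v : HistoryVertex Γ H) :
    (historyGraph Γ H).dist u v ≤ RAAG.length ((domain u)⁻¹ * domain v) := by
  obtain ⟨p, hp⟩ := exists_walk_length_le hH u v
  exact (SimpleGraph.dist_le p).trans hp

lemma length_le_historyGraph_dist (u v : HistoryVertex Γ H) :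
    RAAG.length ((domain u)⁻¹ * domain v) ≤ Fintype.card V * (historyGraph Γ H).dist u v := by
  obtain ⟨p, hp⟩ := (historyGraph_connected hH).exists_walk_length_eq_dist u v
  rw [← hp]
  clear hp
  induction p with
  | nil => simp
  | @cons u w v h p ih =>
    have h1 := historyGraph_length_le h
    have h2 := length_mul_le ((domain u)⁻¹ * domain w) ((domain w)⁻¹ * domain v)
    rw [mul_assoc, mul_inv_cancel_left] at h2
    rw [SimpleGraph.Walk.length_cons, mul_add]
    omega

/-- Removal of the top layer gives a parent. -/
lemma exists_parent {v : HistoryVertex Γ H} {n : ℕ} (hv : level v = n + 1) :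
    ∃ u, level u = n ∧ (historyGraph Γ H).Adj u v := by
  rcases v with _ | ⟨m, T'⟩
  · simp [level] at hv
  obtain rfl : m = n := by simpa [level] using hv
  rcases m with _ | m
  · exact ⟨none, rfl, by simp, Or.inl (.root T')⟩
  · obtain ⟨l, h1, h2, h3⟩ := exists_top_clique T'.height_domain
    obtain ⟨T, hT, -⟩ := exists_nonIdealTile
      (hH.mul_wordProd_mem h1 T'.domain_mem fun s hs => (h2 s hs).1) h3
    exact ⟨some ⟨m, T⟩, rfl, by simp, Or.inl (.vertical T T' (subdivides_of_clique h1 h2 h3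
      T'.height_domain hT rfl))⟩

lemma historyGraph_dist_none (v : HistoryVertex Γ H) :
    (historyGraph Γ H).dist none v = level v := by
  apply le_antisymm
  · induction hn : level v generalizing v with
    | zero =>
      rcases v with _ | ⟨m, T⟩
      · simp
      · simp [level] at hn
    | succ n ih =>
      obtain ⟨u, hu, huv⟩ := exists_parent hH hn
      have h1 := (historyGraph_connected hH).dist_triangle (u := none) (v := u) (w := v)
      rw [SimpleGraph.dist_eq_one_iff_adj.2 huv] at h1
      have h2 := ih u hu
      omega
  · obtain ⟨p, hp⟩ := (historyGraph_connected hH).exists_walk_length_eq_dist none v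
    rw [← hp]
    have h1 : ∀ {u v : HistoryVertex Γ H} (p : (historyGraph Γ H).Walk u v),
        level v ≤ level u + p.length := by
      intro u v p
      induction p with
      | nil => simp
      | cons h p ih =>
        have := historyGraph_level_le h
        rw [SimpleGraph.Walk.length_cons]
        omega
    simpa [level] using h1 p

lemma setOf_historyGraph_dist (n : ℕ) : {v | (historyGraph Γ H).dist none v = n + 1} =
    Set.range fun T : NonIdealTile Γ H n => (some ⟨n, T⟩ : HistoryVertex Γ H) := by
  ext v
  rw [Set.mem_ofPred_eq, historyGraph_dist_none hH]
  rcases v with _ | ⟨m, T⟩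
  · simp [level]
  · constructor
    · intro h
      obtain rfl : m = n := by simpa [level] using h
      exact ⟨T, rfl⟩
    · rintro ⟨T', h⟩
      rw [← h]
      rfl

end

section

/-- The properties of the word norm of a finite generating set. -/
structure IsWordNorm {G : Type*} [Group G] (N : G → ℕ) : Prop where
  one : N 1 = 0
  inv : ∀ g, N g⁻¹ = N g
  mul_le : ∀ g h, N (g * h) ≤ N g + N h
  finite_le : ∀ n, {g | N g ≤ n}.Finite
  pred : ∀ {n g}, N g = n + 1 → ∃ h, N h = n ∧ N (h⁻¹ * g) = 1
  eq_one : ∀ {g}, N g = 0 → g = 1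

/-- A locally finite directed graph with relation `E` and a base point, with distance `lam` from
the base point, on which a group acts freely with finitely many orbits. -/
structure IsGrowthSpace (G : Type*) {X : Type*} [Group G] [MulAction G X] (E : X → X → Prop)
    (lam : X → ℕ) (x₀ : X) : Prop where
  smul : ∀ (g : G) {x y : X}, E x y → E (g • x) (g • y)
  le : ∀ {x y : X}, E x y → lam y ≤ lam x + 1
  pred : ∀ {n y}, lam y = n + 1 → ∃ x, lam x = n ∧ E x y
  eq_base : ∀ {x}, lam x = 0 → x = x₀
  lam_base : lam x₀ = 0
  degree : ∃ K, ∀ x, {y | E x y}.Finite ∧ {y | E x y}.ncard ≤ K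
  free : ∀ x : X, Function.Injective fun g : G => g • x
  cocompact : ∃ F : Finset X, ∀ x : X, ∃ g : G, ∃ f ∈ F, x = g • f

namespace IsWordNorm

variable {G : Type*} [Group G] {N : G → ℕ} (hN : IsWordNorm N)
include hN

lemma isGrowthSpace : IsGrowthSpace G (fun x y : G => N (x⁻¹ * y) = 1) N 1 where
  smul g x y h := by simpa [mul_assoc] using h
  le {x y} h := by
    have := hN.mul_le x (x⁻¹ * y)
    rw [mul_inv_cancel_left] at this
    omega
  pred := hN.pred
  eq_base := hN.eq_one
  lam_base := hN.one
  degree := by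
    have hf : {g | N g = 1}.Finite := (hN.finite_le 1).subset fun g hg => le_of_eq hg
    have h : ∀ x, {y | N (x⁻¹ * y) = 1} = (x * ·) '' {g | N g = 1} := by
      intro x
      ext y
      simp
    refine ⟨{g | N g = 1}.ncard, fun x => ?_⟩
    rw [h]
    exact ⟨hf.image _, Set.ncard_image_le hf⟩
  free x := mul_left_injective x
  cocompact := ⟨{1}, fun x => ⟨x, 1, by simp, by simp⟩⟩

lemma exists_eq_of_le {n : ℕ} : ∀ {m : ℕ} {g : G}, N g = m → n ≤ m → ∃ h, N h = n := by
  intro m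
  induction m with
  | zero => intro g hg h; exact ⟨g, by omega⟩
  | succ m ih =>
    intro g hg h
    rcases h.eq_or_lt with rfl | h
    · exact ⟨g, hg⟩
    · obtain ⟨g', hg', -⟩ := hN.pred hg
      exact ih hg' (by omega)

lemma exists_eq [Infinite G] (n : ℕ) : ∃ g, N g = n := by
  obtain ⟨g, hg⟩ := (hN.finite_le n).exists_notMem
  simp only [Set.mem_ofPred_eq, not_le] at hg
  exact hN.exists_eq_of_le rfl hg.le

lemma ncard_mono {m n : ℕ} (h : m ≤ n) : {g | N g ≤ m}.ncard ≤ {g | N g ≤ n}.ncard :=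
  Set.ncard_le_ncard (fun _ hg => le_trans hg h) (hN.finite_le n)

/-- Disjoint translates of a ball along a geodesic. -/
lemma ncard_packing [Infinite G] {k m : ℕ} (h : k ≤ m) :
    (m + 1) * {g | N g ≤ k}.ncard ≤ 3 * (k + 1) * {g | N g ≤ m}.ncard := by
  choose x hx using hN.exists_eq
  set J := (m - k) / (2 * k + 1) with hJ
  have hJ1 : J * (2 * k + 1) ≤ m - k := Nat.div_mul_le_self _ _
  have hJ2 : m - k < (J + 1) * (2 * k + 1) := by
    rw [add_mul, one_mul]
    exact Nat.lt_div_mul_add (by omega)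
  have h1 : ((Set.Iic J) ×ˢ {g | N g ≤ k}).ncard ≤ {g | N g ≤ m}.ncard := by
    refine Set.ncard_le_ncard_of_injOn (fun p => x (p.1 * (2 * k + 1)) * p.2) ?_ ?_
      (hN.finite_le m)
    · rintro ⟨i, g⟩ ⟨hi, hg⟩
      simp only [Set.mem_Iic, Set.mem_ofPred_eq] at hi hg ⊢
      have h2 := hN.mul_le (x (i * (2 * k + 1))) g
      rw [hx] at h2
      have h3 := Nat.mul_le_mul_right (2 * k + 1) hi
      omega
    · rintro ⟨i, g⟩ ⟨hi, hg⟩ ⟨j, g'⟩ ⟨hj, hg'⟩ hij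
      simp only [Set.mem_Iic, Set.mem_ofPred_eq] at hi hg hj hg' hij
      have key : ∀ {i j : ℕ} {g g' : G}, N g ≤ k → N g' ≤ k →
          x (i * (2 * k + 1)) * g = x (j * (2 * k + 1)) * g' → i ≤ j := by
        intro i j g g' hg hg' h
        rw [← eq_mul_inv_iff_mul_eq, mul_assoc] at h
        have h2 := hN.mul_le (x (j * (2 * k + 1))) (g' * g⁻¹)
        have h3 := hN.mul_le g' g⁻¹
        rw [hN.inv] at h3
        rw [← h, hx, hx] at h2
        have h4 : i * (2 * k + 1) < (j + 1) * (2 * k + 1) := by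
          rw [add_mul j]
          omega
        have := lt_of_mul_lt_mul_right h4 (Nat.zero_le _)
        omega
      obtain rfl := le_antisymm (key hg hg' hij) (key hg' hg hij.symm)
      simpa using hij
  rw [Set.ncard_prod, show Set.Iic J = (Finset.Iic J : Set ℕ) by simp, Set.ncard_coe_finset,
    Nat.card_Iic] at h1
  have h2 : m + 1 ≤ (J + 1) * (3 * k + 1) := by
    have h3 : m + 1 ≤ k + (J + 1) * (2 * k + 1) := by omega
    nlinarith [Nat.zero_le (J * k)]
  calc (m + 1) * {g | N g ≤ k}.ncard
      ≤ (J + 1) * (3 * k + 1) * {g | N g ≤ k}.ncard := Nat.mul_le_mul_right _ h2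
    _ = (3 * k + 1) * ((J + 1) * {g | N g ≤ k}.ncard) := by ring
    _ ≤ (3 * (k + 1)) * {g | N g ≤ m}.ncard := Nat.mul_le_mul (by omega) h1

/-- The number of elements that are moved out of `U` by `w` is controlled by the boundary. -/
lemma ncard_moved_le {U : Set G} (hU : U.Finite) (n : ℕ) : ∀ w, N w = n →
    {g | g ∈ U ∧ g * w ∉ U}.ncard ≤ n * {u | u ∈ U ∧ ∃ s, N s = 1 ∧ u * s ∉ U}.ncard := by
  have hsub : ∀ P : G → Prop, {g | g ∈ U ∧ P g}.Finite := fun P => hU.subset fun _ h => h.1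
  induction n with
  | zero =>
    intro w hw
    rw [hN.eq_one hw]
    simp
  | succ n ih =>
    intro w hw
    obtain ⟨w', h1, h2⟩ := hN.pred hw
    have h3 : {g | g ∈ U ∧ g * w ∉ U} ⊆ {g | g ∈ U ∧ g * w' ∉ U} ∪
        {g | g * w' ∈ {u | u ∈ U ∧ ∃ s, N s = 1 ∧ u * s ∉ U}} := by
      rintro g ⟨hg, hgw⟩
      by_cases h : g * w' ∈ U
      · exact Or.inr ⟨h, w'⁻¹ * w, h2, by simpa [mul_assoc] using hgw⟩
      · exact Or.inl ⟨hg, h⟩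
    have hinj : Set.InjOn (· * w') {g | g * w' ∈ {u | u ∈ U ∧ ∃ s, N s = 1 ∧ u * s ∉ U}} :=
      (mul_left_injective w').injOn
    have h4 : {g | g * w' ∈ {u | u ∈ U ∧ ∃ s, N s = 1 ∧ u * s ∉ U}}.ncard ≤
        {u | u ∈ U ∧ ∃ s, N s = 1 ∧ u * s ∉ U}.ncard :=
      Set.ncard_le_ncard_of_injOn (· * w') (fun g hg => hg) hinj (hsub _)
    have h5 : {g | g * w' ∈ {u | u ∈ U ∧ ∃ s, N s = 1 ∧ u * s ∉ U}}.Finite :=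
      (hsub _).preimage hinj
    have h6 := (Set.ncard_le_ncard h3 ((hsub _).union h5)).trans (Set.ncard_union_le _ _)
    have h7 := ih w' h1
    rw [add_mul, one_mul]
    omega

/-- The isoperimetric inequality of Coulhon and Saloff-Coste. -/
lemma ncard_le_boundary {U : Set G} (hU : U.Finite) {r : ℕ}
    (hr : 2 * U.ncard ≤ {g | N g ≤ r}.ncard) :
    U.ncard ≤ 2 * r * {u | u ∈ U ∧ ∃ s, N s = 1 ∧ u * s ∉ U}.ncard := by
  classical
  rcases Nat.eq_zero_or_pos U.ncard with h0 | hpos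
  · rw [h0]; exact Nat.zero_le _
  obtain ⟨U, rfl⟩ := hU.exists_finset_coe
  obtain ⟨W, hW⟩ := (hN.finite_le r).exists_finset_coe
  rw [← hW, Set.ncard_coe_finset, Set.ncard_coe_finset] at hr
  rw [Set.ncard_coe_finset] at hpos
  have h1 : ∑ w ∈ W, (U.filter fun g => g * w ∈ U).card ≤ U.card * U.card := by
    have h2 : ∑ w ∈ W, (U.filter fun g => g * w ∈ U).card =
        ∑ g ∈ U, (W.filter fun w => g * w ∈ U).card :=
      Finset.sum_card_bipartiteAbove_eq_sum_card_bipartiteBelow (fun w g => g * w ∈ U)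
    rw [h2, ← smul_eq_mul]
    refine Finset.sum_le_card_nsmul _ _ _ fun g _ => ?_
    exact Finset.card_le_card_of_injOn (g * ·) (fun w hw => (Finset.mem_filter.1 hw).2)
      (mul_right_injective g).injOn
  obtain ⟨w, hw, h3⟩ : ∃ w ∈ W, 2 * (U.filter fun g => g * w ∈ U).card ≤ U.card := by
    by_contra! h
    have h4 : W.card • (U.card + 1) ≤ ∑ w ∈ W, 2 * (U.filter fun g => g * w ∈ U).card :=
      Finset.card_nsmul_le_sum _ _ _ h
    rw [← Finset.mul_sum, smul_eq_mul] at h4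
    nlinarith
  have h5 : {g | g ∈ (U : Set G) ∧ g * w ∉ (U : Set G)} =
      ((U.filter fun g => ¬ g * w ∈ U : Finset G) : Set G) := by ext; simp
  have h6 := hN.ncard_moved_le (U := (U : Set G)) U.finite_toSet _ w rfl
  rw [h5, Set.ncard_coe_finset] at h6
  have h7 := Finset.card_filter_add_card_filter_not (s := U) fun g => g * w ∈ U
  have h8 : N w ≤ r := by
    have : w ∈ (W : Set G) := hw
    rw [hW] at this
    exact this
  have h9 := Nat.mul_le_mul_right
    {u | u ∈ (U : Set G) ∧ ∃ s, N s = 1 ∧ u * s ∉ (U : Set G)}.ncard h8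
  rw [Set.ncard_coe_finset, mul_assoc]
  omega

end IsWordNorm

lemma exists_nat_bound {α : Type*} {s : Set α} (hs : s.Finite) (f : α → ℕ) :
    ∃ L, ∀ x ∈ s, f x ≤ L := by
  obtain ⟨L, hL⟩ := (hs.image f).bddAbove
  exact ⟨L, fun x hx => hL ⟨x, hx, rfl⟩⟩

namespace IsGrowthSpace

variable {G X : Type*} [Group G] [MulAction G X] {E : X → X → Prop} {lam : X → ℕ} {x₀ : X}
  (hX : IsGrowthSpace G E lam x₀)
include hX

lemma finite_eq_and_ncard_le : ∃ K, 1 ≤ K ∧ ∀ n, {x | lam x = n}.Finite ∧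
    {x | lam x = n + 1}.ncard ≤ K * {x | lam x = n}.ncard := by
  classical
  obtain ⟨K, hK⟩ := hX.degree
  have hsub : ∀ n, {x | lam x = n + 1} ⊆ ⋃ x ∈ {x | lam x = n}, {y | E x y} := by
    intro n y hy
    obtain ⟨x, h1, h2⟩ := hX.pred hy
    exact Set.mem_biUnion h1 h2
  have hfin : ∀ n, {x | lam x = n}.Finite := by
    intro n
    induction n with
    | zero => exact (Set.finite_singleton x₀).subset fun x hx => hX.eq_base hx
    | succ n ih => exact (ih.biUnion fun x _ => (hK x).1).subset (hsub n)
  refine ⟨K + 1, by omega, fun n => ⟨hfin n, ?_⟩⟩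
  have h1 := Set.ncard_le_ncard (hsub n) ((hfin n).biUnion fun x _ => (hK x).1)
  refine h1.trans ?_
  obtain ⟨A, hA⟩ := (hfin n).exists_finset_coe
  rw [← hA, Set.ncard_coe_finset]
  clear h1 hA
  induction A using Finset.induction_on with
  | empty => simp
  | insert a A ha ih =>
    rw [Finset.set_biUnion_coe, Finset.set_biUnion_insert, Finset.card_insert_of_notMem ha]
    refine (Set.ncard_union_le _ _).trans ?_
    have := (hK a).2
    rw [Finset.set_biUnion_coe] at ih
    rw [mul_add]
    omega

lemma finite_le (n : ℕ) : {x | lam x ≤ n}.Finite := by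
  obtain ⟨K, -, h⟩ := hX.finite_eq_and_ncard_le
  refine ((Set.finite_Iic n).biUnion fun m _ => (h m).1).subset fun x hx => ?_
  exact Set.mem_biUnion (x := lam x) hx rfl

lemma finite_smul_mem {A B : Set X} (hA : A.Finite) (hB : B.Finite) :
    {g : G | ∃ a ∈ A, g • a ∈ B}.Finite := by
  refine (hA.biUnion fun a _ => hB.preimage (f := fun g : G => g • a)
    (hX.free a).injOn).subset ?_
  rintro g ⟨a, ha, hg⟩
  exact Set.mem_biUnion ha hg

lemma lam_smul_le (g : G) (x : X) : lam (g • x) ≤ lam (g • x₀) + lam x := by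
  induction hn : lam x generalizing x with
  | zero => rw [hX.eq_base hn]; omega
  | succ n ih =>
    obtain ⟨y, h1, h2⟩ := hX.pred hn
    have h3 := ih y h1
    have h4 := hX.le (hX.smul g h2)
    omega

variable {N : G → ℕ} (hN : IsWordNorm N)
include hN

lemma exists_lam_le : ∃ L, 1 ≤ L ∧
    (∀ (g s : G), N s = 1 → lam ((g * s) • x₀) ≤ lam (g • x₀) + L) ∧
    ∀ g : G, lam (g • x₀) ≤ L * N g := by
  obtain ⟨L, hL⟩ := exists_nat_bound (hN.finite_le 1) fun s => lam (s • x₀)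
  have h1 : ∀ (g s : G), N s = 1 → lam ((g * s) • x₀) ≤ lam (g • x₀) + (L + 1) := by
    intro g s hs
    have h2 := hX.lam_smul_le g (s • x₀)
    rw [← mul_smul] at h2
    have h3 := hL s (le_of_eq hs)
    omega
  refine ⟨L + 1, by omega, h1, fun g => ?_⟩
  induction hn : N g generalizing g with
  | zero => rw [hN.eq_one hn, one_smul, hX.lam_base]; omega
  | succ n ih =>
    obtain ⟨h, h3, h4⟩ := hN.pred hn
    have h5 := h1 h _ h4
    rw [mul_inv_cancel_left] at h5
    have h6 := ih h h3
    rw [mul_add]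
    omega

lemma exists_norm_le (F : Finset X) (hF : ∀ x, ∃ g : G, ∃ f ∈ F, x = g • f) :
    ∃ L, 1 ≤ L ∧ ∀ (g : G), ∀ f ∈ F, N g ≤ L * (lam (g • f) + 1) := by
  have hdeg := hX.degree
  obtain ⟨K, hK⟩ := hdeg
  obtain ⟨L₁, hL₁⟩ := exists_nat_bound
    (hX.finite_smul_mem F.finite_toSet (Set.finite_singleton x₀)) N
  obtain ⟨L₂, hL₂⟩ := exists_nat_bound
    (hX.finite_smul_mem F.finite_toSet (F.finite_toSet.biUnion fun x _ => (hK x).1)) N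
  refine ⟨L₁ + L₂ + 1, by omega, fun g f hf => ?_⟩
  induction hn : lam (g • f) generalizing g f with
  | zero =>
    have := hL₁ g ⟨f, hf, hX.eq_base hn⟩
    omega
  | succ n ih =>
    obtain ⟨x, h1, h2⟩ := hX.pred hn
    obtain ⟨g', f', hf', rfl⟩ := hF x
    have h3 := ih g' f' hf' h1
    have h4 := hX.smul g'⁻¹ h2
    rw [inv_smul_smul, ← mul_smul] at h4
    have h5 := hL₂ _ ⟨f, hf, Set.mem_biUnion (x := f') hf' h4⟩
    have h6 := hN.mul_le g' (g'⁻¹ * g)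
    rw [mul_inv_cancel_left] at h6
    rw [mul_add (L₁ + L₂ + 1) (n + 1)]
    omega

/-- Spheres are not much smaller than balls divided by their radius. -/
theorem exists_lower_bound [Infinite G] : ∃ D, 1 ≤ D ∧ ∀ k m, D * k ≤ m →
    {g | N g ≤ k}.ncard ≤ D * (k + 1) * {x | lam x = m}.ncard := by
  classical
  obtain ⟨K, hK1, hK⟩ := hX.finite_eq_and_ncard_le
  obtain ⟨L, hL1, hL2, hL3⟩ := hX.exists_lam_le hN
  obtain ⟨F, hF⟩ := hX.cocompact
  obtain ⟨M, hM1, hM⟩ := hX.exists_norm_le hN (insert x₀ F)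
    (fun x => by
      obtain ⟨g, f, hf, h⟩ := hF x
      exact ⟨g, f, Finset.mem_insert_of_mem hf, h⟩) |>.imp fun M h => And.imp_right
        (fun h (g : G) => h g x₀ (Finset.mem_insert_self _ _)) h
  set c := 36 * (2 * M * L + 1) * (L * K ^ L) with hc
  refine ⟨L + c, by omega, fun k m hkm => ?_⟩
  set U : Set G := {g | lam (g • x₀) ≤ m + L - 1} with hU
  have hsub : U ⊆ {g | N g ≤ M * (m + L)} := by
    intro g hg
    simp only [hU, Set.mem_ofPred_eq] at hg ⊢
    exact (hM g).trans (Nat.mul_le_mul_left _ (by omega))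
  have hUfin : U.Finite := (hN.finite_le _).subset hsub
  have hUcard : U.ncard ≤ {g | N g ≤ M * (m + L)}.ncard :=
    Set.ncard_le_ncard hsub (hN.finite_le _)
  set r := 6 * (M * (m + L) + 1) with hr
  have hpack := hN.ncard_packing (k := M * (m + L)) (m := r) (by omega)
  have hr2 : 2 * U.ncard ≤ {g | N g ≤ r}.ncard := by
    have h1 : 3 * (M * (m + L) + 1) * (2 * {g | N g ≤ M * (m + L)}.ncard) ≤
        3 * (M * (m + L) + 1) * {g | N g ≤ r}.ncard := by
      refine le_trans ?_ hpack
      rw [hr]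
      nlinarith
    have h2 := Nat.le_of_mul_le_mul_left h1 (by omega)
    omega
  have hiso := hN.ncard_le_boundary hUfin hr2
  have hbd : {u | u ∈ U ∧ ∃ s, N s = 1 ∧ u * s ∉ U}.ncard ≤
      L * K ^ L * {x | lam x = m}.ncard := by
    have hs : ∀ i, {x | lam x = m + i}.ncard ≤ K ^ i * {x | lam x = m}.ncard := by
      intro i
      induction i with
      | zero => simp
      | succ i ih =>
        refine ((hK (m + i)).2).trans ?_
        rw [pow_succ', mul_assoc]
        exact Nat.mul_le_mul_left _ ih
    have h1 : {u | u ∈ U ∧ ∃ s, N s = 1 ∧ u * s ∉ U}.ncard ≤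
        (⋃ i ∈ Finset.range L, {x | lam x = m + i}).ncard := by
      refine Set.ncard_le_ncard_of_injOn (fun g => g • x₀) ?_ (hX.free x₀).injOn
        ((Finset.range L).finite_toSet.biUnion fun i _ => (hK _).1)
      rintro g ⟨hg, s, hs1, hs2⟩
      have h2 := hL2 g s hs1
      simp only [hU, Set.mem_ofPred_eq, not_le] at hg hs2
      exact Set.mem_biUnion (x := lam (g • x₀) - m) (by simp; omega)
        (show lam (g • x₀) = _ by omega)
    refine h1.trans ((Finset.set_ncard_biUnion_le _ _).trans ?_)
    calc ∑ i ∈ Finset.range L, {x | lam x = m + i}.ncard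
        ≤ ∑ i ∈ Finset.range L, K ^ L * {x | lam x = m}.ncard := by
          refine Finset.sum_le_sum fun i hi => (hs i).trans (Nat.mul_le_mul_right _ ?_)
          exact Nat.pow_le_pow_right hK1 (Finset.mem_range.1 hi).le
      _ = L * K ^ L * {x | lam x = m}.ncard := by simp [mul_assoc]
  set m' := m / L with hm'
  have hm1 : L * m' ≤ m := Nat.mul_div_le m L
  have hm2 : m < L * (m' + 1) := Nat.lt_mul_div_succ m hL1
  have hkm' : k ≤ m' := by
    rw [hm', Nat.le_div_iff_mul_le hL1]
    nlinarith
  have h1 : {g | N g ≤ m'}.ncard ≤ U.ncard := by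
    refine Set.ncard_le_ncard (fun g hg => ?_) hUfin
    have h2 := hL3 g
    have h3 := Nat.mul_le_mul_left L (show N g ≤ m' from hg)
    simp only [hU, Set.mem_ofPred_eq]
    omega
  have h2 := hN.ncard_packing hkm'
  have h3 : r ≤ 6 * (2 * M * L + 1) * (m' + 1) := by
    have h4 : m + L ≤ 2 * L * (m' + 1) := by nlinarith
    have h5 := Nat.mul_le_mul_left M h4
    rw [hr]
    nlinarith
  have h4 : (m' + 1) * {g | N g ≤ k}.ncard ≤
      (m' + 1) * (c * (k + 1) * {x | lam x = m}.ncard) := by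
    calc (m' + 1) * {g | N g ≤ k}.ncard ≤ 3 * (k + 1) * {g | N g ≤ m'}.ncard := h2
      _ ≤ 3 * (k + 1) * (2 * r * (L * K ^ L * {x | lam x = m}.ncard)) :=
        Nat.mul_le_mul_left _ (h1.trans (hiso.trans (Nat.mul_le_mul_left _ hbd)))
      _ ≤ 3 * (k + 1) * (2 * (6 * (2 * M * L + 1) * (m' + 1)) *
          (L * K ^ L * {x | lam x = m}.ncard)) := by gcongr
      _ = (m' + 1) * (c * (k + 1) * {x | lam x = m}.ncard) := by rw [hc]; ring
  refine (Nat.le_of_mul_le_mul_left h4 (by omega)).trans ?_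
  gcongr
  omega

lemma exists_ball_le : ∃ L, 1 ≤ L ∧
    ∀ n, {x | lam x ≤ n}.ncard ≤ L * {g | N g ≤ L * (n + 1)}.ncard := by
  classical
  obtain ⟨F, hF⟩ := hX.cocompact
  obtain ⟨L, hL1, hL⟩ := hX.exists_norm_le hN F hF
  refine ⟨L + F.card, by omega, fun n => ?_⟩
  have h1 : {x | lam x ≤ n} ⊆ (fun p : G × X => p.1 • p.2) ''
      ({g | N g ≤ (L + F.card) * (n + 1)} ×ˢ (F : Set X)) := by
    intro x hx
    obtain ⟨g, f, hf, rfl⟩ := hF x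
    refine ⟨(g, f), ⟨(hL g f hf).trans ?_, hf⟩, rfl⟩
    exact Nat.mul_le_mul (by omega) (Nat.succ_le_succ hx)
  have h2 := (hN.finite_le ((L + F.card) * (n + 1))).prod F.finite_toSet
  refine (Set.ncard_le_ncard h1 (h2.image _)).trans ((Set.ncard_image_le h2).trans ?_)
  rw [Set.ncard_prod, Set.ncard_coe_finset, mul_comm]
  gcongr
  omega

/-- Groups of exponential growth: spheres are much smaller than larger balls. -/
lemma exists_upper_bound_of_exponential {c : ℕ} (hc : ∀ n, 2 ^ n ≤ {g | N g ≤ c * n}.ncard) :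
    ∃ D, 1 ≤ D ∧ ∀ n, (n + 1) * {x | lam x = n}.ncard ≤
      D * {g | N g ≤ D * (n + 1)}.ncard := by
  obtain ⟨K, hK1, hK⟩ := hX.finite_eq_and_ncard_le
  have hs : ∀ n, {x | lam x = n}.ncard ≤ K ^ n := by
    intro n
    induction n with
    | zero =>
      simpa using Set.ncard_le_ncard (s := {x | lam x = 0}) (t := {x₀})
        (fun x hx => hX.eq_base hx)
    | succ n ih =>
      rw [pow_succ']
      exact (hK n).2.trans (Nat.mul_le_mul_left _ ih)
  refine ⟨c * (K + 1) + 1, by omega, fun n => ?_⟩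
  calc (n + 1) * {x | lam x = n}.ncard ≤ 2 ^ n * K ^ n :=
        Nat.mul_le_mul Nat.lt_two_pow_self (hs n)
    _ ≤ 2 ^ n * (2 ^ K) ^ n := by gcongr; exact Nat.lt_two_pow_self.le
    _ = 2 ^ ((K + 1) * n) := by rw [← pow_mul, ← pow_add]; ring_nf
    _ ≤ {g | N g ≤ c * ((K + 1) * n)}.ncard := hc _
    _ ≤ {g | N g ≤ (c * (K + 1) + 1) * (n + 1)}.ncard := hN.ncard_mono (by nlinarith)
    _ ≤ (c * (K + 1) + 1) * {g | N g ≤ (c * (K + 1) + 1) * (n + 1)}.ncard :=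
        Nat.le_mul_of_pos_left _ (by omega)

end IsGrowthSpace

end

section

namespace IsGrowthSpace

section Path

variable {G X : Type*} [Group G] [MulAction G X] {E : X → X → Prop} {lam : X → ℕ} {x₀ : X}
  (hX : IsGrowthSpace G E lam x₀)
include hX

lemma exists_path {n : ℕ} {x : X} (hx : lam x = n) : ∃ p : ℕ → X, p n = x ∧
    (∀ i ≤ n, lam (p i) = i) ∧
    ∀ (g : G) (i j : ℕ), i ≤ j → j ≤ n → lam (g • p j) ≤ lam (g • p i) + (j - i) := by
  have key : ∃ p : ℕ → X, p n = x ∧ (∀ i ≤ n, lam (p i) = i) ∧ ∀ i < n, E (p i) (p (i + 1)) := by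
    induction n generalizing x with
    | zero => exact ⟨fun _ => x, rfl, by simp [hx], by simp⟩
    | succ n ih =>
      obtain ⟨y, h1, h2⟩ := hX.pred hx
      obtain ⟨p, h3, h4, h5⟩ := ih h1
      refine ⟨fun i => if i ≤ n then p i else x, by simp, fun i hi => ?_, fun i hi => ?_⟩
      · by_cases h : i ≤ n
        · simpa [h] using h4 i h
        · simp only [h, if_false]
          omega
      · rcases (Nat.lt_succ_iff.1 hi).eq_or_lt with rfl | h
        · simpa [h3] using h2
        · simpa [h.le, Nat.succ_le_of_lt h] using h5 i h
  obtain ⟨p, h1, h2, h3⟩ := key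
  refine ⟨p, h1, h2, fun g i j hij => ?_⟩
  induction j, hij using Nat.le_induction with
  | base => intro _; omega
  | succ j hij ih =>
    intro hj
    have h4 := ih (by omega)
    have h5 := hX.le (hX.smul g (h3 j (by omega)))
    omega

/-- In an abelian group, many parallel loops can be removed from a long geodesic. -/
lemma exists_loops (hcomm : ∀ a b : G, a * b = b * a) : ∃ (C : ℕ) (A : Finset G), 1 ≤ C ∧
    ∀ n x, lam x = n → ∃ γ ∈ A, ∀ k ≤ n / C, lam ((γ⁻¹) ^ k • x) + k ≤ n := by
  classical
  obtain ⟨F, hF⟩ := hX.cocompact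
  choose b f hfF hbf using hF
  set q := F.card with hq
  have hq1 : 1 ≤ q := Finset.card_pos.2 ⟨_, hfF x₀⟩
  obtain ⟨L, hL⟩ := exists_nat_bound F.finite_toSet lam
  obtain ⟨A, hA⟩ := (hX.finite_smul_mem F.finite_toSet (hX.finite_le (L + q))).exists_finset_coe
  have hA1 : (1 : G) ∈ A := by
    have : (1 : G) ∈ (A : Set G) := by
      rw [hA]
      refine ⟨f x₀, hfF x₀, ?_⟩
      rw [one_smul]
      exact (hL _ (hfF x₀)).trans (Nat.le_add_right _ _)
    exact this
  have hM1 : 1 ≤ A.card := Finset.card_pos.2 ⟨1, hA1⟩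
  refine ⟨q * A.card, A, Nat.mul_pos hq1 hM1, fun n x hx => ?_⟩
  obtain ⟨p, hp1, hp2, hp3⟩ := hX.exists_path hx
  have hwin : ∀ c, c < n / q → ∃ i j, c * q ≤ i ∧ i < j ∧ j ≤ (c + 1) * q ∧
      f (p i) = f (p j) := by
    intro c _
    obtain ⟨i, hi, j, hj, hij, h⟩ := Finset.exists_ne_map_eq_of_card_lt_of_maps_to
      (s := Finset.Icc (c * q) ((c + 1) * q)) (t := F) (f := fun i => f (p i))
      (by rw [Nat.card_Icc, add_mul]; omega) (fun i _ => hfF _)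
    rw [Finset.mem_Icc] at hi hj
    rcases lt_or_gt_of_ne hij with h' | h'
    · exact ⟨i, j, hi.1, h', hj.2, h⟩
    · exact ⟨j, i, hj.1, h', hi.2, h.symm⟩
  choose! i j hi hij hj hf using hwin
  set γ : ℕ → G := fun c => b (p (j c)) * (b (p (i c)))⁻¹ with hγ
  have hjn : ∀ c < n / q, j c ≤ n := fun c hc => (hj c hc).trans
    ((Nat.mul_le_mul_right q hc).trans (Nat.div_mul_le_self n q))
  have hγp : ∀ c < n / q, γ c • p (i c) = p (j c) := by
    intro c hc
    conv_lhs => rw [hbf (p (i c)), hf c hc, ← mul_smul]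
    simp only [hγ, inv_mul_cancel_right]
    exact (hbf _).symm
  have hγA : ∀ c ∈ Finset.range (n / q), γ c ∈ A := by
    intro c hc
    rw [Finset.mem_range] at hc
    have : γ c ∈ (A : Set G) := by
      rw [hA]
      refine ⟨f (p (i c)), hfF _, ?_⟩
      have h1 : f (p (i c)) = (b (p (i c)))⁻¹ • p (i c) := by
        rw [eq_inv_smul_iff]
        exact (hbf _).symm
      have h2 : γ c • f (p (i c)) = (b (p (i c)))⁻¹ • p (j c) := by
        rw [h1, ← mul_smul, hcomm, mul_smul, hγp c hc]
      have h3 := hp3 (b (p (i c)))⁻¹ (i c) (j c) (hij c hc).le (hjn c hc)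
      rw [← h1, ← h2] at h3
      have h4 := hL _ (hfF (p (i c)))
      have h5 := hi c hc
      have h6 := hj c hc
      rw [add_mul] at h6
      simp only [Set.mem_ofPred_eq]
      omega
    exact this
  obtain ⟨g, hg, hcount⟩ := Finset.exists_le_card_fiber_of_mul_le_card_of_maps_to
    (n := n / (q * A.card)) hγA ⟨1, hA1⟩ (by
      rw [Finset.card_range, ← Nat.div_div_eq_div_mul]
      exact Nat.mul_div_le _ _)
  have main : ∀ w ≤ n / q, ∀ k ≤ ((Finset.range w).filter fun c => γ c = g).card,
      lam ((g⁻¹) ^ k • p (w * q)) + k ≤ w * q := by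
    intro w
    induction w with
    | zero =>
      intro _ k hk
      obtain rfl : k = 0 := by simpa using hk
      simp [hp2 0 (Nat.zero_le _)]
    | succ w ih =>
      intro hw k hk
      have hw' : w < n / q := hw
      have hwn : (w + 1) * q ≤ n :=
        (Nat.mul_le_mul_right q hw).trans (Nat.div_mul_le_self n q)
      rw [add_mul, one_mul] at hwn ⊢
      rw [Finset.range_add_one, Finset.filter_insert] at hk
      by_cases hk' : k ≤ ((Finset.range w).filter fun c => γ c = g).card
      · have h1 := ih hw'.le k hk'
        have h2 := hp3 ((g⁻¹) ^ k) (w * q) (w * q + q) (by omega) hwn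
        omega
      · split_ifs at hk with hgw
        · rw [Finset.card_insert_of_notMem (by simp)] at hk
          obtain ⟨k, rfl⟩ : ∃ k', k = k' + 1 := ⟨k - 1, by omega⟩
          have h1 := ih hw'.le k (by omega)
          have h2 := hi w hw'
          have h3 := hij w hw'
          have h4 := hj w hw'
          rw [add_mul, one_mul] at h4
          have h5 := hp3 ((g⁻¹) ^ k) (w * q) (i w) h2 (by omega)
          have h6 := hp3 ((g⁻¹) ^ (k + 1)) (j w) (w * q + q) h4 hwn
          have h7 : (g⁻¹) ^ (k + 1) • p (j w) = (g⁻¹) ^ k • p (i w) := by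
            rw [← hγp w hw', hgw, pow_succ, mul_smul, inv_smul_smul]
          rw [h7] at h6
          omega
        · exact (hk' hk).elim
  refine ⟨g, hg, fun k hk => ?_⟩
  have h1 := main (n / q) le_rfl k (hk.trans hcount)
  have h2 := hp3 ((g⁻¹) ^ k) (n / q * q) n (Nat.div_mul_le_self n q) le_rfl
  have h3 := Nat.div_mul_le_self n q
  rw [hp1] at h2
  omega

lemma exists_upper_bound_of_comm (hcomm : ∀ a b : G, a * b = b * a) : ∃ D, 1 ≤ D ∧ ∀ n,
    (n + 1) * {x | lam x = n}.ncard ≤ D * {x | lam x ≤ n}.ncard := by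
  classical
  obtain ⟨C, A, hC, h⟩ := hX.exists_loops hcomm
  choose γ hγA hγ using h
  refine ⟨C * (A.card + 1), Nat.mul_pos hC (by omega), fun n => ?_⟩
  have h1 : ({x | lam x = n} ×ˢ Set.Iic (n / C)).ncard ≤
      ((A : Set G) ×ˢ {x | lam x ≤ n}).ncard := by
    refine Set.ncard_le_ncard_of_injOn
      (fun p => (if hp : lam p.1 = n then γ n p.1 hp else 1,
        if hp : lam p.1 = n then (γ n p.1 hp)⁻¹ ^ p.2 • p.1 else x₀)) ?_ ?_
      (A.finite_toSet.prod (hX.finite_le n))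
    · rintro ⟨x, k⟩ ⟨hx, hk⟩
      simp only [Set.mem_ofPred_eq, Set.mem_Iic] at hx hk
      simp only [hx, dif_pos, Set.mem_prod, Finset.mem_coe, Set.mem_ofPred_eq]
      exact ⟨hγA _ _ _, le_trans (Nat.le_add_right _ _) (hγ n x hx k hk)⟩
    · rintro ⟨x, k⟩ ⟨hx, hk⟩ ⟨x', k'⟩ ⟨hx', hk'⟩ heq
      simp only [Set.mem_ofPred_eq, Set.mem_Iic] at hx hk hx' hk'
      simp only [hx, hx', dif_pos, Prod.mk.injEq] at heq
      have key : ∀ {x x' : X} {k k' : ℕ} (hx : lam x = n) (hx' : lam x' = n), k ≤ n / C →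
          γ n x hx = γ n x' hx' → (γ n x hx)⁻¹ ^ k • x = (γ n x' hx')⁻¹ ^ k' • x' → k ≤ k' := by
        intro x x' k k' hx hx' hk hγγ heq
        by_contra hlt
        obtain ⟨e, rfl⟩ : ∃ e, k = k' + e := ⟨k - k', by omega⟩
        rw [← hγγ, pow_add, mul_smul] at heq
        have h2 := MulAction.injective _ heq
        have h3 := hγ n x hx e (by omega)
        rw [h2, hx'] at h3
        omega
      obtain rfl := le_antisymm (key hx hx' hk heq.1 heq.2)
        (key hx' hx hk' heq.1.symm heq.2.symm)
      have h2 := heq.2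
      rw [heq.1] at h2
      rw [MulAction.injective _ h2]
  rw [Set.ncard_prod, Set.ncard_prod, Set.ncard_coe_finset,
    show Set.Iic (n / C) = (Finset.Iic (n / C) : Set ℕ) by simp, Set.ncard_coe_finset,
    Nat.card_Iic] at h1
  have h2 : n + 1 ≤ C * (n / C + 1) := Nat.lt_mul_div_succ n hC
  calc (n + 1) * {x | lam x = n}.ncard ≤ C * (n / C + 1) * {x | lam x = n}.ncard :=
        Nat.mul_le_mul_right _ h2
    _ = C * ({x | lam x = n}.ncard * (n / C + 1)) := by ring
    _ ≤ C * (A.card * {x | lam x ≤ n}.ncard) := Nat.mul_le_mul_left _ h1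
    _ ≤ C * (A.card + 1) * {x | lam x ≤ n}.ncard := by
        rw [mul_assoc]
        gcongr
        omega

lemma subgroup (B : Subgroup G) [B.FiniteIndex] : IsGrowthSpace B E lam x₀ where
  smul g _ _ h := hX.smul (g : G) h
  le := hX.le
  pred := hX.pred
  eq_base := hX.eq_base
  lam_base := hX.lam_base
  degree := hX.degree
  free x g h hgh := Subtype.ext (hX.free x hgh)
  cocompact := by
    classical
    obtain ⟨F, hF⟩ := hX.cocompact
    have : Finite (G ⧸ B) := B.finite_quotient_of_finiteIndex
    have := Fintype.ofFinite (G ⧸ B)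
    refine ⟨(Finset.univ ×ˢ F).image fun p : (G ⧸ B) × X => (p.1.out)⁻¹ • p.2, fun x => ?_⟩
    obtain ⟨g, f, hf, rfl⟩ := hF x
    obtain ⟨h, hh⟩ := QuotientGroup.mk_out_eq_mul B g⁻¹
    refine ⟨h, _, Finset.mem_image.2 ⟨(↑g⁻¹, f), by simp [hf], rfl⟩, ?_⟩
    rw [hh, mul_inv_rev, inv_inv, mul_smul, Subgroup.smul_def, smul_inv_smul]

end Path

/-- The group has a free subgroup of rank two or an abelian subgroup of finite index. -/
def _root_.FreeOrVirtuallyAbelian (G : Type*) [Group G] : Prop :=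
  (∃ φ : FreeGroup Bool →* G, Function.Injective φ) ∨
    ∃ B : Subgroup G, B.FiniteIndex ∧ ∀ a ∈ B, ∀ b ∈ B, a * b = b * a

lemma _root_.IsWordNorm.exponential {G : Type*} [Group G] {N : G → ℕ} (hN : IsWordNorm N)
    {φ : FreeGroup Bool →* G} (hφ : Function.Injective φ) :
    ∃ c, ∀ n, 2 ^ n ≤ {g | N g ≤ c * n}.ncard := by
  set c := N (φ (.of false)) + N (φ (.of true)) with hc
  refine ⟨c, fun n => ?_⟩
  let w : List Bool → G := fun l => φ (FreeGroup.mk (l.map fun b => (b, true)))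
  have hw : Function.Injective w := by
    intro l l' h
    have h1 := congrArg FreeGroup.toWord (hφ h)
    have hred : ∀ l : List Bool, FreeGroup.IsReduced (l.map fun b => (b, true)) := by
      intro l
      refine (List.isChain_map _).2 ?_
      induction l with
      | nil => exact List.isChain_nil
      | cons a l ih => exact List.isChain_cons.2 ⟨by simp, ih⟩
    rw [FreeGroup.toWord_mk, FreeGroup.toWord_mk, (hred l).reduce_eq, (hred l').reduce_eq] at h1
    exact List.map_injective_iff.2 (fun a b h => congrArg Prod.fst h) h1
  have hwN : ∀ l, N (w l) ≤ c * l.length := by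
    intro l
    induction l with
    | nil => simp [w, ← FreeGroup.one_eq_mk, hN.one]
    | cons a l ih =>
      have h1 : w (a :: l) = φ (.of a) * w l := by
        simp only [w, ← map_mul, FreeGroup.of, FreeGroup.mul_mk, List.map_cons]
        rfl
      have h2 := hN.mul_le (φ (.of a)) (w l)
      rw [h1, List.length_cons, mul_add]
      have h3 : N (φ (.of a)) ≤ c := by cases a <;> omega
      omega
  have h1 : (Set.univ : Set (List.Vector Bool n)).ncard ≤ {g | N g ≤ c * n}.ncard := by
    refine Set.ncard_le_ncard_of_injOn (fun v => w v.1) (fun v _ => ?_) (fun v _ v' _ h => ?_)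
      (hN.finite_le _)
    · have := hwN v.1
      rwa [v.2] at this
    · exact Subtype.ext (hw h)
  rwa [Set.ncard_univ, Nat.card_eq_fintype_card, card_vector, Fintype.card_bool] at h1

theorem exists_upper_bound {G X : Type*} [Group G] [MulAction G X] {E : X → X → Prop}
    {lam : X → ℕ} {x₀ : X} (hX : IsGrowthSpace G E lam x₀) {N : G → ℕ} (hN : IsWordNorm N)
    (hG : FreeOrVirtuallyAbelian G) : ∃ D, 1 ≤ D ∧ ∀ n,
      (n + 1) * {x | lam x = n}.ncard ≤ D * {g | N g ≤ D * (n + 1)}.ncard := by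
  rcases hG with ⟨φ, hφ⟩ | ⟨B, hB, hcomm⟩
  · obtain ⟨c, hc⟩ := hN.exponential hφ
    exact hX.exists_upper_bound_of_exponential hN hc
  · obtain ⟨D, hD, h1⟩ := (hX.subgroup B).exists_upper_bound_of_comm
      fun a b => Subtype.ext (hcomm a a.2 b b.2)
    obtain ⟨L, hL, h2⟩ := hX.exists_ball_le hN
    refine ⟨D * L, Nat.mul_pos hD hL, fun n => ?_⟩
    calc (n + 1) * {x | lam x = n}.ncard ≤ D * {x | lam x ≤ n}.ncard := h1 n
      _ ≤ D * (L * {g | N g ≤ L * (n + 1)}.ncard) := Nat.mul_le_mul_left _ (h2 n)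
      _ ≤ D * L * {g | N g ≤ D * L * (n + 1)}.ncard := by
        rw [mul_assoc]
        refine Nat.mul_le_mul_left _ (Nat.mul_le_mul_left _ (hN.ncard_mono ?_))
        exact Nat.mul_le_mul_right _ (Nat.le_mul_of_pos_left _ hD)

/-- The spheres of two spaces with actions of the same group have the same growth. -/
theorem exists_sphere_le {G X X' : Type*} [Group G] [MulAction G X] [MulAction G X']
    {E : X → X → Prop} {lam : X → ℕ} {x₀ : X} (hX : IsGrowthSpace G E lam x₀)
    {E' : X' → X' → Prop} {lam' : X' → ℕ} {x₀' : X'} (hX' : IsGrowthSpace G E' lam' x₀')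
    {N : G → ℕ} (hN : IsWordNorm N) (hG : FreeOrVirtuallyAbelian G) :
    ∃ D, ∀ n m, D * (n + 1) ≤ m →
      {x | lam x = n}.ncard ≤ D * {x | lam' x = m}.ncard + D := by
  classical
  rcases finite_or_infinite G with hfin | hinf
  · obtain ⟨F, hF⟩ := hX.cocompact
    have hXfin : (Set.univ : Set X).Finite := by
      refine ((Set.finite_univ (α := G)).prod F.finite_toSet |>.image
        fun p : G × X => p.1 • p.2).subset fun x _ => ?_
      obtain ⟨g, f, hf, rfl⟩ := hF x
      exact ⟨(g, f), ⟨trivial, hf⟩, rfl⟩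
    refine ⟨(Set.univ : Set X).ncard, fun n m _ => ?_⟩
    exact (Set.ncard_le_ncard (Set.subset_univ _) hXfin).trans (Nat.le_add_left _ _)
  · obtain ⟨D₁, hD₁, h1⟩ := hX.exists_upper_bound hN hG
    obtain ⟨D₂, hD₂, h2⟩ := hX'.exists_lower_bound hN
    refine ⟨D₁ * D₂ * (D₁ + 1), fun n m hm => ?_⟩
    have h3 := h2 (D₁ * (n + 1)) m (le_trans (by nlinarith [Nat.zero_le (D₁ * D₂ * (n + 1) * D₁)]) hm)
    have h4 : (n + 1) * {x | lam x = n}.ncard ≤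
        (n + 1) * (D₁ * D₂ * (D₁ + 1) * {x | lam' x = m}.ncard) := by
      calc (n + 1) * {x | lam x = n}.ncard ≤ D₁ * {g | N g ≤ D₁ * (n + 1)}.ncard := h1 n
        _ ≤ D₁ * (D₂ * (D₁ * (n + 1) + 1) * {x | lam' x = m}.ncard) :=
          Nat.mul_le_mul_left _ h3
        _ ≤ D₁ * (D₂ * ((D₁ + 1) * (n + 1)) * {x | lam' x = m}.ncard) := by
          gcongr
          rw [add_mul]
          omega
        _ = _ := by ring
    exact (Nat.le_of_mul_le_mul_left h4 (by omega)).trans (Nat.le_add_right _ _)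

end IsGrowthSpace

end

section

/-! ### Subgroups of right-angled Artin groups -/

lemma Subgroup.finiteIndex_comap {G H : Type*} [Group G] [Group H] (f : G →* H) (B : Subgroup H)
    [B.FiniteIndex] : (B.comap f).FiniteIndex :=
  ⟨by rw [Subgroup.index_comap]; exact Subgroup.FiniteIndex.index_ne_zero (H := B.subgroupOf f.range)⟩

namespace FreeOrVirtuallyAbelian

variable {G H : Type*} [Group G] [Group H]

lemma of_mulEquiv (e : G ≃* H) (h : FreeOrVirtuallyAbelian G) : FreeOrVirtuallyAbelian H := by
  rcases h with ⟨φ, hφ⟩ | ⟨B, hB, hcomm⟩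
  · exact Or.inl ⟨e.toMonoidHom.comp φ, e.injective.comp hφ⟩
  · refine Or.inr ⟨B.comap e.symm.toMonoidHom, Subgroup.finiteIndex_comap _ _, fun a ha b hb => ?_⟩
    apply e.symm.injective
    rw [map_mul, map_mul]
    exact hcomm _ ha _ hb

end FreeOrVirtuallyAbelian

lemma FreeGroup.norm_map_le {α β : Type*} [DecidableEq α] [DecidableEq β] (f : α → β)
    (x : FreeGroup α) : (FreeGroup.map f x).norm ≤ x.norm := by
  conv_lhs => rw [← FreeGroup.mk_toWord (x := x), FreeGroup.map.mk]
  refine FreeGroup.norm_mk_le.trans ?_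
  rw [List.length_map]
  rfl

lemma FreeGroup.le_norm_pow {α : Type*} [DecidableEq α] {x : FreeGroup α} (hx : x ≠ 1) (n : ℕ) :
    n ≤ (x ^ n).norm := by
  rcases n with _ | n
  · simp
  have h1 : FreeGroup.reduceCyclically x.toWord ≠ [] := by
    intro h
    have h2 := FreeGroup.reduceCyclically.conj_conjugator_reduceCyclically x.toWord
    rw [h] at h2
    apply hx
    rw [← FreeGroup.mk_toWord (x := x), ← h2, List.append_nil, ← FreeGroup.mul_mk,
      ← FreeGroup.inv_mk, mul_inv_cancel]
  rw [FreeGroup.norm, FreeGroup.toWord_pow,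
    FreeGroup.reduceCyclically.reduce_flatten_replicate_succ FreeGroup.isReduced_toWord]
  have h2 := List.length_pos_iff.2 h1
  simp only [List.length_append, List.length_flatten, List.map_replicate, List.sum_replicate,
    smul_eq_mul]
  nlinarith

/-- A free group on at least two generators contains a free group of rank two, and the other free
groups are cyclic. -/
lemma IsFreeGroup.exists_injective_or_isCyclic (G : Type*) [Group G] [IsFreeGroup G] :
    (∃ φ : FreeGroup Bool →* G, Function.Injective φ) ∨ IsCyclic G := by
  rcases subsingleton_or_nontrivial (IsFreeGroup.Generators G) with h | ⟨a, b, hab⟩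
  · right
    rcases isEmpty_or_nonempty (IsFreeGroup.Generators G) with h' | ⟨⟨a⟩⟩
    · have : Subsingleton G := (IsFreeGroup.mulEquiv G).symm.injective.subsingleton
      infer_instance
    · refine ⟨IsFreeGroup.of a, fun x => ?_⟩
      obtain ⟨x, rfl⟩ := (IsFreeGroup.mulEquiv G).surjective x
      induction x using FreeGroup.induction_on with
      | C1 => exact ⟨0, by simp⟩
      | of c =>
        obtain rfl := Subsingleton.elim a c
        exact ⟨1, by simp [IsFreeGroup.of]⟩
      | inv_of c ih =>
        rw [map_inv]
        exact (Subgroup.zpowers (IsFreeGroup.of a)).inv_mem ih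
      | mul x y hx hy =>
        rw [map_mul]
        exact (Subgroup.zpowers (IsFreeGroup.of a)).mul_mem hx hy
  · left
    refine ⟨(IsFreeGroup.mulEquiv G).toMonoidHom.comp
      (FreeGroup.map fun x : Bool => if x then a else b),
      (IsFreeGroup.mulEquiv G).injective.comp (FreeGroup.map_injective ?_)⟩
    intro x y h
    cases x <;> cases y <;> simp_all

lemma finite_mulAut_of_isCyclic (G : Type*) [Group G] [IsCyclic G] [Infinite G] :
    Finite (MulAut G) := by
  have e := IsCyclic.mulAutMulEquiv G
  rw [Nat.card_eq_zero_of_infinite] at e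
  have : Finite (ZMod 0)ˣ := inferInstanceAs (Finite ℤˣ)
  exact Finite.of_equiv _ e.symm.toEquiv

section Semidirect

variable {A X : Type*} [Group A] [MulAction A X]

/-- The action on the free group induced by an action on its basis. -/
def freeGroupAut (A X : Type*) [Group A] [MulAction A X] : A →* MulAut (FreeGroup X) where
  toFun a := FreeGroup.freeGroupCongr (MulAction.toPerm a)
  map_one' := by
    rw [show MulAction.toPerm (1 : A) = Equiv.refl X by ext; simp]
    exact FreeGroup.freeGroupCongr_refl
  map_mul' a b := by
    rw [show MulAction.toPerm (a * b) = (MulAction.toPerm b).trans (MulAction.toPerm (α := A) (β := X) a) by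
      ext; simp [mul_smul], ← FreeGroup.freeGroupCongr_trans]
    rfl

@[simp] lemma freeGroupAut_apply_of (a : A) (x : X) :
    freeGroupAut A X a (.of x) = .of (a • x) := by
  simp [freeGroupAut]

lemma norm_freeGroupAut_le [DecidableEq X] (a : A) (f : FreeGroup X) :
    (freeGroupAut A X a f).norm ≤ f.norm := FreeGroup.norm_map_le _ f

lemma norm_left_mul_le [DecidableEq X] (p q : FreeGroup X ⋊[freeGroupAut A X] A) :
    (p * q).left.norm ≤ p.left.norm + q.left.norm :=
  (FreeGroup.norm_mul_le _ _).trans (Nat.add_le_add_left (norm_freeGroupAut_le _ _) _)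

lemma norm_left_pow_le [DecidableEq X] (p : FreeGroup X ⋊[freeGroupAut A X] A) (n : ℕ) :
    (p ^ n).left.norm ≤ n * p.left.norm := by
  induction n with
  | zero => simp
  | succ n ih =>
    rw [pow_succ, add_mul, one_mul]
    exact (norm_left_mul_le _ _).trans (Nat.add_le_add_right ih _)

lemma norm_left_inv_le [DecidableEq X] (p : FreeGroup X ⋊[freeGroupAut A X] A) :
    (p⁻¹).left.norm ≤ p.left.norm := by
  rw [SemidirectProduct.inv_left]
  refine (norm_freeGroupAut_le _ _).trans ?_
  rw [FreeGroup.norm_inv_eq]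

lemma left_pow_of_right_eq_one {c : FreeGroup X ⋊[freeGroupAut A X] A} (hc : c.right = 1) (n : ℕ) :
    (c ^ n).left = c.left ^ n := by
  obtain ⟨f, rfl⟩ : ∃ f, c = SemidirectProduct.inl f :=
    ⟨c.left, SemidirectProduct.ext rfl hc⟩
  rw [← map_pow]
  rfl

lemma pow_mul_pow_of_commutator {Q : Type*} [Group Q] {a b c : Q} (h : a * b = c * (b * a))
    (ha : Commute c a) (hb : Commute c b) (n m : ℕ) :
    a ^ n * b ^ m = c ^ (n * m) * (b ^ m * a ^ n) := by
  have h1 : ∀ m, a * b ^ m = c ^ m * (b ^ m * a) := by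
    intro m
    induction m with
    | zero => simp
    | succ m ih =>
      calc a * b ^ (m + 1) = (a * b ^ m) * b := by rw [pow_succ, mul_assoc]
        _ = c ^ m * b ^ m * (a * b) := by rw [ih]; simp only [mul_assoc]
        _ = c ^ m * (b ^ m * c) * (b * a) := by rw [h]; simp only [mul_assoc]
        _ = c ^ (m + 1) * (b ^ (m + 1) * a) := by
          rw [(hb.pow_right m).eq.symm, pow_succ, pow_succ]
          simp only [mul_assoc]
  induction n with
  | zero => simp
  | succ n ih =>
    calc a ^ (n + 1) * b ^ m = a ^ n * (a * b ^ m) := by rw [pow_succ, mul_assoc]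
      _ = (a ^ n * c ^ m) * b ^ m * a := by rw [h1]; simp only [mul_assoc]
      _ = c ^ m * (a ^ n * b ^ m) * a := by
        rw [(ha.pow_pow m n).eq.symm]; simp only [mul_assoc]
      _ = c ^ ((n + 1) * m) * (b ^ m * a ^ (n + 1)) := by
        rw [ih, add_mul, one_mul, add_comm, pow_add, pow_succ]
        simp only [mul_assoc]

/-- There are no Heisenberg groups. -/
lemma commutator_eq_one {a b c : FreeGroup X ⋊[freeGroupAut A X] A} (h : a * b = c * (b * a))
    (ha : Commute c a) (hb : Commute c b) (hc : c.right = 1) : c = 1 := by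
  classical
  by_contra hne
  have hleft : c.left ≠ 1 := fun h1 => hne (SemidirectProduct.ext h1 hc)
  set K := a.left.norm + b.left.norm with hK
  have h1 : ∀ n, n * n ≤ n * (2 * K) := by
    intro n
    have h2 : c ^ (n * n) = a ^ n * b ^ n * (a ^ n)⁻¹ * (b ^ n)⁻¹ := by
      rw [pow_mul_pow_of_commutator h ha hb]
      group
    have h3 := FreeGroup.le_norm_pow hleft (n * n)
    rw [← left_pow_of_right_eq_one hc, h2] at h3
    have h4 := norm_left_mul_le (a ^ n * b ^ n * (a ^ n)⁻¹) (b ^ n)⁻¹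
    have h5 := norm_left_mul_le (a ^ n * b ^ n) (a ^ n)⁻¹
    have h6 := norm_left_mul_le (a ^ n) (b ^ n)
    have h7 := norm_left_inv_le (a ^ n)
    have h8 := norm_left_inv_le (b ^ n)
    have h9 := norm_left_pow_le a n
    have h10 := norm_left_pow_le b n
    have h11 : n * (2 * K) = 2 * (n * a.left.norm + n * b.left.norm) := by rw [hK]; ring
    omega
  have h2 := h1 (2 * K + 1)
  nlinarith

theorem freeOrVirtuallyAbelian_semidirect (hA : ∀ B : Subgroup A, FreeOrVirtuallyAbelian B)
    (G : Subgroup (FreeGroup X ⋊[freeGroupAut A X] A)) : FreeOrVirtuallyAbelian G := by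
  let π : G →* A := SemidirectProduct.rightHom.comp G.subtype
  rcases hA π.range with ⟨φ, hφ⟩ | ⟨B, hB, hcomm⟩
  · left
    choose g hg using fun x : Bool => (φ (.of x)).2
    refine ⟨FreeGroup.lift g, ?_⟩
    have h1 : π.comp (FreeGroup.lift g) = π.range.subtype.comp φ := by
      ext x
      simp [hg]
    have h2 : Function.Injective (π.comp (FreeGroup.lift g)) := by
      rw [h1]
      exact Subtype.val_injective.comp hφ
    exact Function.Injective.of_comp (f := π)
      (show Function.Injective (π ∘ FreeGroup.lift g) from h2)
  let j : π.ker →* FreeGroup X :=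
    { toFun n := n.1.1.left
      map_one' := rfl
      map_mul' m n := by
        have h : m.1.1.right = 1 := m.2
        simp [h] }
  have hj : Function.Injective j := by
    intro m n h
    have h1 : m.1.1.right = 1 := m.2
    have h2 : n.1.1.right = 1 := n.2
    exact Subtype.ext (Subtype.ext (SemidirectProduct.ext h (h1.trans h2.symm)))
  have : IsFreeGroup π.ker := IsFreeGroup.ofMulEquiv (MonoidHom.ofInjective hj).symm
  rcases IsFreeGroup.exists_injective_or_isCyclic π.ker with ⟨φ, hφ⟩ | hcyc
  · exact Or.inl ⟨π.ker.subtype.comp φ, Subtype.val_injective.comp hφ⟩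
  right
  have hfin : Finite (MulAut π.ker) := by
    rcases finite_or_infinite π.ker with h | h
    · exact Finite.of_injective (fun e : MulAut π.ker => (e : π.ker → π.ker))
        DFunLike.coe_injective
    · exact finite_mulAut_of_isCyclic _
  let γ : G →* MulAut π.ker := MulAut.conjNormal
  have hγ : γ.ker.FiniteIndex := Subgroup.finiteIndex_ker γ
  have hB' : (B.comap π.rangeRestrict).FiniteIndex := Subgroup.finiteIndex_comap _ _
  refine ⟨γ.ker ⊓ B.comap π.rangeRestrict, inferInstance, ?_⟩
  rintro a ⟨ha1, ha2⟩ b ⟨hb1, hb2⟩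
  have hker : ∀ {x : G}, x ∈ γ.ker → ∀ n ∈ π.ker, Commute n x := by
    intro x hx n hn
    have h1 := congrArg (fun e : MulAut π.ker => (e ⟨n, hn⟩).1) (MonoidHom.mem_ker.1 hx)
    simp only [γ, MulAut.conjNormal_apply, MulAut.one_apply] at h1
    exact (mul_inv_eq_iff_eq_mul.1 h1).symm
  have hc : a * b * a⁻¹ * b⁻¹ ∈ π.ker := by
    have h1 := congrArg Subtype.val (hcomm _ ha2 _ hb2)
    change π a * π b = π b * π a at h1
    rw [MonoidHom.mem_ker, map_mul, map_mul, map_mul, map_inv, map_inv, h1]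
    group
  have h1 : (a * b * a⁻¹ * b⁻¹).1 = 1 := by
    refine commutator_eq_one (a := a.1) (b := b.1) ?_ ?_ ?_ hc
    · simp only [Subgroup.coe_mul, Subgroup.coe_inv]
      group
    · exact congrArg Subtype.val (hker ha1 _ hc)
    · exact congrArg Subtype.val (hker hb1 _ hc)
  have h2 : a * b * a⁻¹ * b⁻¹ = 1 := Subtype.ext h1
  rwa [mul_inv_eq_one, mul_inv_eq_iff_eq_mul] at h2

end Semidirect

namespace RAAG

variable {V : Type*} (Γ : SimpleGraph V) (v : V)

/-- The graph without the vertex `v`. -/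
abbrev deleteVertex : SimpleGraph {x : V // x ≠ v} := Γ.comap Subtype.val

/-- The subgroup generated by the neighbours of `v`. -/
def linkSubgroup : Subgroup (RAAG (deleteVertex Γ v)) :=
  Subgroup.closure {g | ∃ w : {x : V // x ≠ v}, Γ.Adj v w ∧ g = PresentedGroup.of w}

/-- The kernel of the retraction that kills `v` is a free group, on the cosets of the link. -/
abbrev Splitting : Type _ :=
  FreeGroup (RAAG (deleteVertex Γ v) ⧸ linkSubgroup Γ v) ⋊[freeGroupAut _ _]
    RAAG (deleteVertex Γ v)

open Classical in
/-- The images of the generators in the semidirect product. -/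
noncomputable def splitGen (x : V) : Splitting Γ v :=
  if h : x = v then SemidirectProduct.inl (.of ((1 : RAAG (deleteVertex Γ v)) :))
  else SemidirectProduct.inr (PresentedGroup.of ⟨x, h⟩)

variable {Γ v}

lemma splitGen_commute_self {b : V} (hb : Γ.Adj v b) :
    Commute (splitGen Γ v v) (splitGen Γ v b) := by
  have hbv : b ≠ v := hb.ne'
  have h1 : (PresentedGroup.of (⟨b, hbv⟩ : {x : V // x ≠ v}) : RAAG (deleteVertex Γ v)) •
      ((1 : RAAG (deleteVertex Γ v)) : RAAG (deleteVertex Γ v) ⧸ linkSubgroup Γ v) =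
        ((1 : RAAG (deleteVertex Γ v)) :) := by
    rw [MulAction.Quotient.smul_coe, smul_eq_mul, mul_one, QuotientGroup.eq, mul_one]
    exact inv_mem (Subgroup.subset_closure ⟨_, hb, rfl⟩)
  have h2 := SemidirectProduct.inl_aut (φ := freeGroupAut (RAAG (deleteVertex Γ v))
    (RAAG (deleteVertex Γ v) ⧸ linkSubgroup Γ v))
    (PresentedGroup.of (⟨b, hbv⟩ : {x : V // x ≠ v}))
    (.of ((1 : RAAG (deleteVertex Γ v)) :))
  rw [freeGroupAut_apply_of, h1, map_inv] at h2
  simp only [splitGen, dif_pos, dif_neg hbv]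
  exact (eq_mul_inv_iff_mul_eq.1 h2)

lemma splitGen_commute {a b : V} (h : Γ.Adj a b) :
    Commute (splitGen Γ v a) (splitGen Γ v b) := by
  by_cases ha : a = v
  · subst ha
    exact splitGen_commute_self h
  by_cases hb : b = v
  · subst hb
    exact (splitGen_commute_self h.symm).symm
  simp only [splitGen, dif_neg ha, dif_neg hb]
  have h1 : Commute (PresentedGroup.of (⟨a, ha⟩ : {x : V // x ≠ v}) : RAAG (deleteVertex Γ v))
      (PresentedGroup.of ⟨b, hb⟩) := of_mul_of (Γ := deleteVertex Γ v) h
  exact h1.map SemidirectProduct.inr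

variable (Γ v)

/-- The embedding into the semidirect product. -/
noncomputable def split : RAAG Γ →* Splitting Γ v :=
  PresentedGroup.toGroup (f := splitGen Γ v) (by
    rintro r ⟨a, b, h, rfl⟩
    simp only [map_mul, FreeGroup.lift_apply_of, map_inv]
    rw [(splitGen_commute h).eq]
    simp)

/-- The inclusion of the subgroup generated by the vertices other than `v`. -/
noncomputable def deleteIncl : RAAG (deleteVertex Γ v) →* RAAG Γ :=
  PresentedGroup.toGroup (f := fun x => PresentedGroup.of x.1) (by
    rintro r ⟨a, b, h, rfl⟩
    simp only [map_mul, FreeGroup.lift_apply_of, map_inv]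
    rw [of_mul_of (Γ := Γ) h]
    simp)

lemma deleteIncl_of (x : {x : V // x ≠ v}) :
    deleteIncl Γ v (PresentedGroup.of x) = PresentedGroup.of x.1 := PresentedGroup.toGroup.of _

lemma commute_of_mem_linkSubgroup {u : RAAG (deleteVertex Γ v)} (hu : u ∈ linkSubgroup Γ v) :
    Commute (deleteIncl Γ v u) (PresentedGroup.of v) := by
  induction hu using Subgroup.closure_induction with
  | mem x hx =>
    obtain ⟨w, hw, rfl⟩ := hx
    rw [deleteIncl_of]
    exact of_mul_of hw.symm
  | one => simp
  | mul x y _ _ hx hy =>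
    rw [map_mul]
    exact hx.mul_left hy
  | inv x _ hx =>
    rw [map_inv]
    exact hx.inv_left

/-- The conjugates of `v`. -/
noncomputable def conjGen : RAAG (deleteVertex Γ v) ⧸ linkSubgroup Γ v → RAAG Γ :=
  Quotient.lift (fun u => deleteIncl Γ v u * PresentedGroup.of v * (deleteIncl Γ v u)⁻¹) (by
    intro a b h
    have h1 := (commute_of_mem_linkSubgroup Γ v (QuotientGroup.leftRel_apply.1 ((QuotientGroup.leftRel _).symm h))).eq
    rw [map_mul, map_inv, mul_assoc, inv_mul_eq_iff_eq_mul] at h1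
    rw [mul_inv_eq_iff_eq_mul, h1]
    group)

/-- The inverse of the embedding. -/
noncomputable def unsplit : Splitting Γ v →* RAAG Γ :=
  SemidirectProduct.lift (FreeGroup.lift (conjGen Γ v)) (deleteIncl Γ v) (by
    intro g
    refine FreeGroup.ext_hom _ _ fun x => ?_
    induction x using QuotientGroup.induction_on with
    | H u =>
      simp only [MonoidHom.comp_apply, MulEquiv.coe_toMonoidHom, freeGroupAut_apply_of,
        FreeGroup.lift_apply_of, MulAut.conj_apply]
      change deleteIncl Γ v (g * u) * _ * (deleteIncl Γ v (g * u))⁻¹ = _ *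
        (deleteIncl Γ v u * _ * (deleteIncl Γ v u)⁻¹) * _
      rw [map_mul]
      group)

lemma split_injective : Function.Injective (split Γ v) := by
  have h : (unsplit Γ v).comp (split Γ v) = MonoidHom.id _ := by
    refine PresentedGroup.ext fun x => ?_
    simp only [MonoidHom.comp_apply, MonoidHom.id_apply]
    rw [split, PresentedGroup.toGroup.of, splitGen]
    split_ifs with hx
    · subst hx
      simp only [unsplit, SemidirectProduct.lift_inl, FreeGroup.lift_apply_of]
      change deleteIncl Γ x 1 * _ * (deleteIncl Γ x 1)⁻¹ = _
      simp
    · simp only [unsplit, SemidirectProduct.lift_inr, deleteIncl_of]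
  intro x y hxy
  have h1 := congrArg (unsplit Γ v) hxy
  rwa [← MonoidHom.comp_apply, ← MonoidHom.comp_apply, h] at h1

theorem freeOrVirtuallyAbelian_subgroup [Finite V] (G : Subgroup (RAAG Γ)) :
    FreeOrVirtuallyAbelian G := by
  induction hn : Nat.card V generalizing V with
  | zero =>
    have : IsEmpty V := (Nat.card_eq_zero.1 hn).resolve_right (fun h => h.not_finite ‹_›)
    have h1 : ∀ g : RAAG Γ, g = 1 := fun g => by
      induction g using induction_mul with
      | one => rfl
      | mul g s _ => exact isEmptyElim s.1
    exact Or.inr ⟨⊤, inferInstance, fun a _ b _ => Subtype.ext (by rw [h1 (a * b).1, h1 (b * a).1])⟩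
  | succ n ih =>
    have : Nonempty V := (Nat.card_pos_iff.1 (by omega)).1
    obtain ⟨v⟩ := this
    have hcard : Nat.card {x : V // x ≠ v} = n := by
      have := Fintype.ofFinite V
      classical
      rw [Nat.card_eq_fintype_card] at hn ⊢
      rw [Fintype.card_subtype_compl, Fintype.card_subtype_eq, hn]
      rfl
    have h1 := freeOrVirtuallyAbelian_semidirect (fun B => ih (deleteVertex Γ v) B hcard)
      (G.map (split Γ v))
    exact h1.of_mulEquiv (G.equivMapOfInjective _ (split_injective Γ v)).symm

theorem freeOrVirtuallyAbelian_of_injective [Finite V] {G : Type*} [Group G] (φ : G →* RAAG Γ)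
    (hφ : Function.Injective φ) : FreeOrVirtuallyAbelian G :=
  (freeOrVirtuallyAbelian_subgroup Γ φ.range).of_mulEquiv (MonoidHom.ofInjective hφ).symm

end RAAG

end

section

/-! ### Word norms of Cayley graphs -/

namespace SimpleGraph

variable {G : Type*} [Group G] {S : Set G}

lemma mulCayley_connected (hS : Subgroup.closure S = ⊤) : (mulCayley S).Connected := by
  have h : ∀ g x : G, (mulCayley S).Reachable x (x * g) := by
    intro g
    have hg : g ∈ Subgroup.closure S := hS ▸ Subgroup.mem_top g
    induction hg using Subgroup.closure_induction with
    | mem s hs =>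
      intro x
      by_cases h : x = x * s
      · rw [← h]
      · exact Adj.reachable ((mulCayley_adj' S _ _).2 ⟨h, s, hs, Or.inl rfl⟩)
    | one => intro x; rw [mul_one]
    | mul g h _ _ ihg ihh =>
      intro x
      rw [← mul_assoc]
      exact (ihg x).trans (ihh _)
    | inv g _ ih =>
      intro x
      simpa using (ih (x * g⁻¹)).symm
  exact ⟨fun u v => by simpa using h (u⁻¹ * v) u⟩

lemma dist_mulCayley_mul_le (hS : Subgroup.closure S = ⊤) (g u v : G) :
    (mulCayley S).dist (g * u) (g * v) ≤ (mulCayley S).dist u v := by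
  obtain ⟨p, hp⟩ := (mulCayley_connected hS).exists_walk_length_eq_dist u v
  let φ : mulCayley S →g mulCayley S := ⟨fun x => g * x, fun h => mulCayley_adj_mul_iff_right.2 h⟩
  rw [← hp, ← Walk.length_map φ p]
  exact dist_le _

lemma dist_mulCayley (hS : Subgroup.closure S = ⊤) (u v : G) :
    (mulCayley S).dist u v = (mulCayley S).dist 1 (u⁻¹ * v) := by
  apply le_antisymm
  · simpa using dist_mulCayley_mul_le hS u 1 (u⁻¹ * v)
  · simpa using dist_mulCayley_mul_le hS u⁻¹ u v

lemma isWordNorm_dist_mulCayley (hS : Subgroup.closure S = ⊤) (hfin : S.Finite) :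
    IsWordNorm ((mulCayley S).dist 1) := by
  have hpred : ∀ {n : ℕ} {g : G}, (mulCayley S).dist 1 g = n + 1 →
      ∃ h, (mulCayley S).dist 1 h = n ∧ (mulCayley S).Adj h g := by
    intro n g hg
    obtain ⟨p, hp⟩ := (mulCayley_connected hS).exists_walk_length_eq_dist g 1
    rw [dist_comm, hg] at hp
    rcases p with _ | ⟨hadj, p⟩
    · simp at hp
    · rename_i h
      refine ⟨h, ?_, hadj.symm⟩
      have h1 := dist_le p
      rw [Walk.length_cons] at hp
      rw [dist_comm] at h1
      have h2 := (mulCayley_connected hS).dist_triangle (u := 1) (v := h) (w := g)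
      rw [dist_eq_one_iff_adj.2 hadj.symm] at h2
      omega
  refine ⟨dist_self, fun g => ?_, fun g h => ?_, fun n => ?_, fun {n g} hg => ?_, fun {g} hg => ?_⟩
  · rw [dist_comm, dist_mulCayley hS, inv_inv, mul_one]
  · refine ((mulCayley_connected hS).dist_triangle (v := g)).trans ?_
    rw [dist_mulCayley hS g, inv_mul_cancel_left]
  · induction n with
    | zero =>
      refine (Set.finite_singleton 1).subset fun g hg => ?_
      exact ((mulCayley_connected hS).dist_eq_zero_iff.1 (Nat.le_zero.1 hg)).symm
    | succ n ih =>
      refine (ih.union (Set.Finite.image2 (fun a b => a * b) ih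
        (hfin.union hfin.inv))).subset fun g hg => ?_
      rcases (show _ ≤ n + 1 from hg).lt_or_eq with h | h
      · exact Or.inl (Nat.lt_succ_iff.1 h)
      · obtain ⟨k, hk, hadj⟩ := hpred h
        refine Or.inr ⟨k, hk.le, k⁻¹ * g, ?_, by simp⟩
        rcases ((mulCayley_adj S _ _).1 hadj).2 with h1 | h1
        · exact Or.inl h1
        · exact Or.inr (by simpa using h1)
  · obtain ⟨h, hh, hadj⟩ := hpred hg
    exact ⟨h, hh, by rw [← dist_mulCayley hS, dist_eq_one_iff_adj]; exact hadj⟩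
  · exact ((mulCayley_connected hS).dist_eq_zero_iff.1 hg).symm

end SimpleGraph

/-- Subadditive functions are bounded linearly by word norms. -/
lemma IsWordNorm.exists_le_mul {G : Type*} [Group G] {N : G → ℕ} (hN : IsWordNorm N) {M : G → ℕ}
    (h1 : M 1 = 0) (hM : ∀ g h, M (g * h) ≤ M g + M h) : ∃ L, ∀ g, M g ≤ L * N g := by
  obtain ⟨L, hL⟩ := ((hN.finite_le 1).image M).bddAbove
  refine ⟨L, fun g => ?_⟩
  induction hn : N g generalizing g with
  | zero => rw [hN.eq_one hn, h1]; exact Nat.zero_le _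
  | succ n ih =>
    obtain ⟨h, hh, hg⟩ := hN.pred hn
    have h2 := hM h (h⁻¹ * g)
    rw [mul_inv_cancel_left] at h2
    have h3 := hL ⟨_, hg.le, rfl⟩
    have h4 := ih h hh
    rw [mul_add]
    omega

lemma List.apply_prod_le {G : Type*} [Monoid G] {N : G → ℕ} (h1 : N 1 = 0)
    (hN : ∀ g h, N (g * h) ≤ N g + N h) {L : ℕ} {l : List G} (hl : ∀ x ∈ l, N x ≤ L) :
    N l.prod ≤ L * l.length := by
  induction l with
  | nil => simp [h1]
  | cons x l ih =>
    have h2 := hN x l.prod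
    have h3 := hl x (by simp)
    have h4 := ih fun y hy => hl y (by simp [hy])
    rw [List.prod_cons, List.length_cons, mul_add]
    omega

/-! ### Groups that act cocompactly on convex sets of vertices -/

namespace RAAG

variable {V : Type*} {Γ : SimpleGraph V}

/-- A group acts freely and cocompactly by translations on a convex set. -/
structure IsCocompact {G : Type*} [Group G] (φ : G →* RAAG Γ) (H : Set (RAAG Γ)) (r : ℕ) :
    Prop where
  injective : Function.Injective φ
  mul_mem : ∀ g, ∀ h ∈ H, φ g * h ∈ H
  exists_length_le : ∀ h ∈ H, ∃ g, length ((φ g)⁻¹ * h) ≤ r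

variable {G : Type*} [Group G] {φ : G →* RAAG Γ} {H : Set (RAAG Γ)} {r : ℕ}

lemma finite_isClique (Γ : SimpleGraph V) [Finite V] : {l | IsClique Γ l}.Finite := by
  have := Fintype.ofFinite V
  exact (List.finite_length_le (Letter V) (Fintype.card V)).subset fun l hl => IsClique.length_le hl

namespace IsCocompact

variable (hφ : IsCocompact φ H r) (hH : IsConvex H)
include hφ

lemma exists_prod_eq (hH : IsConvex H) {n : ℕ} : ∀ {h : RAAG Γ}, h ∈ H → length h = n → ∀ {g : G},
    length ((φ g)⁻¹ * h) ≤ r →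
      ∃ l : List G, l.length = n + 1 ∧ (∀ x ∈ l, length (φ x) ≤ 2 * r + 1) ∧ l.prod = g := by
  induction n with
  | zero =>
    intro h _ hn g hg
    rw [length_eq_zero] at hn
    subst hn
    rw [mul_one, length_inv] at hg
    exact ⟨[g], rfl, by simpa using (by omega), by simp⟩
  | succ n ih =>
    intro h hh hn g hg
    obtain ⟨s, hs⟩ := exists_descent (g := h) (by rintro rfl; simp at hn)
    have hs' := length_descent hs
    have hmem : h * s.toGroup Γ ∈ H := hH.mul_mem hH.one_mem hh (by simpa using hs)
    obtain ⟨g', hg'⟩ := hφ.exists_length_le _ hmem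
    obtain ⟨l, h1, h2, h3⟩ := ih hmem (by omega) hg'
    refine ⟨l ++ [g'⁻¹ * g], by simp [h1], ?_, by simp [h3]⟩
    intro x hx
    rcases List.mem_append.1 hx with hx | hx
    · exact h2 x hx
    obtain rfl := List.mem_singleton.1 hx
    have h4 : φ (g'⁻¹ * g) =
        (φ g')⁻¹ * (h * s.toGroup Γ) * ((s.toGroup Γ)⁻¹ * ((φ g)⁻¹ * h)⁻¹) := by
      rw [map_mul, map_inv]
      group
    have h5 := length_mul_le ((φ g')⁻¹ * (h * s.toGroup Γ)) ((s.toGroup Γ)⁻¹ * ((φ g)⁻¹ * h)⁻¹)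
    have h6 := length_mul_le (s.toGroup Γ)⁻¹ ((φ g)⁻¹ * h)⁻¹
    rw [length_inv, length_inv, length_toGroup] at h6
    rw [h4]
    omega

lemma exists_prod_eq' (hH : IsConvex H) (g : G) : ∃ l : List G, l.length = length (φ g) + 1 ∧
    (∀ x ∈ l, length (φ x) ≤ 2 * r + 1) ∧ l.prod = g :=
  hφ.exists_prod_eq hH (by simpa using hφ.mul_mem g 1 hH.one_mem) rfl (by simp)

variable [Finite V]

lemma finite_le (n : ℕ) : {g | length (φ g) ≤ n}.Finite :=
  (finite_length_le n).preimage hφ.injective.injOn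

lemma group_fg (hH : IsConvex H) : Group.FG G := by
  refine Group.fg_iff.2 ⟨_, ?_, hφ.finite_le (2 * r + 1)⟩
  refine eq_top_iff.2 fun g _ => ?_
  obtain ⟨l, -, h, rfl⟩ := hφ.exists_prod_eq' hH g
  exact list_prod_mem fun x hx => Subgroup.subset_closure (h x hx)

lemma exists_norm_le (hH : IsConvex H) {N : G → ℕ} (hN : IsWordNorm N) :
    ∃ L, ∀ g, N g ≤ L * (length (φ g) + 1) := by
  obtain ⟨L, hL⟩ := ((hφ.finite_le (2 * r + 1)).image N).bddAbove
  refine ⟨L, fun g => ?_⟩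
  obtain ⟨l, h1, h, rfl⟩ := hφ.exists_prod_eq' hH g
  rw [← h1]
  exact List.apply_prod_le hN.one hN.mul_le fun x hx => hL ⟨x, h x hx, rfl⟩

end IsCocompact

/-- The action by translations. -/
abbrev IsCocompact.mulAction (hφ : IsCocompact φ H r) : MulAction G H where
  smul g h := ⟨φ g * h, hφ.mul_mem g h h.2⟩
  one_smul h := Subtype.ext (by change φ 1 * h.1 = h.1; simp)
  mul_smul g g' h := Subtype.ext (by
    change φ (g * g') * h.1 = φ g * (φ g' * h.1)
    rw [map_mul, mul_assoc])

lemma IsCocompact.isGrowthSpace [Fintype V] (hφ : IsCocompact φ H r) (hH : IsConvex H) :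
    @IsGrowthSpace G H _ hφ.mulAction (fun x y => ∃ l, IsClique Γ l ∧ y.1 = x.1 * wordProd Γ l)
      (fun x => height x.1) ⟨1, hH.one_mem⟩ :=
  let _ := hφ.mulAction
  { smul := by
      rintro g x y ⟨l, hl, h⟩
      refine ⟨l, hl, ?_⟩
      change φ g * y.1 = φ g * x.1 * _
      rw [h, mul_assoc]
    le := by
      rintro x y ⟨l, hl, h⟩
      rw [h]
      exact height_mul_clique_le hl _
    pred := by
      intro n y hy
      obtain ⟨l, hl, h1, h2⟩ := exists_top_clique hy
      refine ⟨⟨_, hH.mul_wordProd_mem hl y.2 fun s hs => (h1 s hs).1⟩, h2, _, hl.inv, ?_⟩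
      rw [hl.wordProd_inv, mul_inv_cancel_right]
    eq_base := fun {x} hx => Subtype.ext (height_eq_zero.1 hx)
    lam_base := height_one
    degree := by
      have h : ∀ x : H, {y : H | ∃ l, IsClique Γ l ∧ y.1 = x.1 * wordProd Γ l} ⊆
          Subtype.val ⁻¹' ((fun l => x.1 * wordProd Γ l) '' {l | IsClique Γ l}) := by
        rintro x y ⟨l, hl, h⟩
        exact ⟨l, hl, h.symm⟩
      have hf : ∀ x : H, ((fun l => x.1 * wordProd Γ l) '' {l | IsClique Γ l}).Finite :=
        fun x => (finite_isClique Γ).image _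
      refine ⟨{l | IsClique Γ l}.ncard, fun x =>
        ⟨((hf x).preimage Subtype.val_injective.injOn).subset (h x), ?_⟩⟩
      refine le_trans ?_ (Set.ncard_image_le (f := fun l => x.1 * wordProd Γ l) (finite_isClique Γ))
      exact Set.ncard_le_ncard_of_injOn Subtype.val (fun y hy => h x hy)
        Subtype.val_injective.injOn (hf x)
    free := by
      intro x g g' h
      exact hφ.injective (mul_right_cancel (congrArg Subtype.val h))
    cocompact := by
      refine ⟨((finite_length_le r).preimage Subtype.val_injective.injOn).toFinset, fun x => ?_⟩
      obtain ⟨g, hg⟩ := hφ.exists_length_le x x.2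
      refine ⟨g, ⟨(φ g)⁻¹ * x, by simpa using hφ.mul_mem g⁻¹ x x.2⟩, by simpa using hg, ?_⟩
      exact Subtype.ext (mul_inv_cancel_left _ _).symm }

lemma isCocompact_id : IsCocompact (MonoidHom.id (RAAG Γ)) Set.univ 0 :=
  ⟨fun _ _ h => h, fun _ _ _ => trivial, fun h _ => ⟨h, by simp⟩⟩

section Tilings

variable [Fintype V] [DecidableEq V]

lemma card_nonIdealTile (n : ℕ) :
    Nat.card (NonIdealTile Γ H n) = {x : H | height x.1 = n + 1}.ncard := by
  rw [← Nat.card_coe_set_eq]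
  exact Nat.card_congr ((nonIdealTileEquiv H n).trans
    (Equiv.subtypeSubtypeEquivSubtypeInter (fun g => g ∈ H) fun g => height g = n + 1).symm)

lemma IsCocompact.finite_nonIdealTile (hφ : IsCocompact φ H r) (hH : IsConvex H) (n : ℕ) :
    Finite (NonIdealTile Γ H n) := by
  let _ := hφ.mulAction
  have h := (hφ.isGrowthSpace hH).finite_le (n + 1)
  have : Finite {x : H // height x.1 = n + 1} := h.subset fun x hx => le_of_eq hx
  exact Finite.of_equiv _ ((nonIdealTileEquiv H n).trans
    (Equiv.subtypeSubtypeEquivSubtypeInter (fun g => g ∈ H) fun g => height g = n + 1).symm).symm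

open HistoryVertex in
lemma IsCocompact.quasiIsometricGraphs (hφ : IsCocompact φ H r) (hH : IsConvex H) {S : Set G}
    (hS : Subgroup.closure S = ⊤) (hfin : S.Finite) :
    QuasiIsometricGraphs (historyGraph Γ H) (SimpleGraph.mulCayley S) := by
  have hN := SimpleGraph.isWordNorm_dist_mulCayley hS hfin
  obtain ⟨L, hL⟩ := hN.exists_le_mul (M := fun g => length (φ g)) (by simp) fun g h => by
    rw [map_mul]
    exact length_mul_le _ _
  obtain ⟨L', hL'⟩ := hφ.exists_norm_le hH hN
  choose! π hπ using hφ.exists_length_le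
  have key : ∀ {a b : RAAG Γ}, a ∈ H → b ∈ H →
      length (a⁻¹ * b) ≤ length (φ ((π a)⁻¹ * π b)) + 2 * r ∧
        length (φ ((π a)⁻¹ * π b)) ≤ length (a⁻¹ * b) + 2 * r := by
    intro a b ha hb
    have h1 : a⁻¹ * b = ((φ (π a))⁻¹ * a)⁻¹ * (φ ((π a)⁻¹ * π b) * ((φ (π b))⁻¹ * b)) := by
      rw [map_mul, map_inv]; group
    have h2 : φ ((π a)⁻¹ * π b) = ((φ (π a))⁻¹ * a) * (a⁻¹ * b * ((φ (π b))⁻¹ * b)⁻¹) := by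
      rw [map_mul, map_inv]; group
    have h3 := length_mul_le ((φ (π a))⁻¹ * a)⁻¹ (φ ((π a)⁻¹ * π b) * ((φ (π b))⁻¹ * b))
    have h4 := length_mul_le (φ ((π a)⁻¹ * π b)) ((φ (π b))⁻¹ * b)
    have h5 := length_mul_le ((φ (π a))⁻¹ * a) (a⁻¹ * b * ((φ (π b))⁻¹ * b)⁻¹)
    have h6 := length_mul_le (a⁻¹ * b) ((φ (π b))⁻¹ * b)⁻¹
    rw [length_inv] at h3 h6
    rw [← h1] at h3
    rw [← h2] at h5
    have := hπ a ha
    have := hπ b hb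
    omega
  set C : ℕ := 1 + L + 2 * r + L' * Fintype.card V + L' * (2 * r + 1) with hC
  have hle : ∀ u v : HistoryVertex Γ H,
      (SimpleGraph.mulCayley S).dist (π (domain u)) (π (domain v)) ≤
          C * (historyGraph Γ H).dist u v + C ∧ (historyGraph Γ H).dist u v ≤
        C * (SimpleGraph.mulCayley S).dist (π (domain u)) (π (domain v)) + C := by
    intro u v
    obtain ⟨h1, h2⟩ := key (domain_mem hH.one_mem u) (domain_mem hH.one_mem v)
    rw [SimpleGraph.dist_mulCayley hS]
    have h3 := hL ((π (domain u))⁻¹ * π (domain v))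
    have h4 := hL' ((π (domain u))⁻¹ * π (domain v))
    have h5 := historyGraph_dist_le hH u v
    have h6 := length_le_historyGraph_dist hH u v
    generalize (SimpleGraph.mulCayley S).dist 1 ((π (domain u))⁻¹ * π (domain v)) = x at *
    generalize (historyGraph Γ H).dist u v = y at *
    constructor
    · calc x ≤ L' * (Fintype.card V * y + 2 * r + 1) :=
            h4.trans (Nat.mul_le_mul_left _ (by omega))
        _ = L' * Fintype.card V * y + L' * (2 * r + 1) := by ring
        _ ≤ C * y + C := Nat.add_le_add (Nat.mul_le_mul_right _ (by omega)) (by omega)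
    · calc y ≤ L * x + 2 * r := by omega
        _ ≤ C * x + C := Nat.add_le_add (Nat.mul_le_mul_right _ (by omega)) (by omega)
  have hC0 : (1 : ℝ) ≤ C := by exact_mod_cast (by omega : 1 ≤ C)
  refine ⟨fun v => π (domain v), C, (L' * (r + 1) : ℕ), by linarith, fun u v => ⟨?_, ?_⟩,
    fun z => ?_⟩
  · have h1 := (hle u v).1
    have h2 : ((SimpleGraph.mulCayley S).dist (π (domain u)) (π (domain v)) : ℝ) ≤
        C * (historyGraph Γ H).dist u v + C := by exact_mod_cast h1
    rw [sub_le_iff_le_add, one_div, inv_mul_le_iff₀ (by linarith)]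
    nlinarith
  · exact_mod_cast (hle u v).2
  · have hz : φ z ∈ H := by simpa using hφ.mul_mem z 1 hH.one_mem
    obtain ⟨v, hv⟩ := exists_domain_eq hz
    refine ⟨v, ?_⟩
    beta_reduce
    rw [hv, Nat.cast_le, SimpleGraph.dist_mulCayley hS]
    refine (hL' _).trans (Nat.mul_le_mul_left _ ?_)
    have := hπ _ hz
    rw [map_mul, map_inv]
    omega

lemma IsCocompact.growthEquiv (hφ : IsCocompact φ H r) (hH : IsConvex H) {S : Finset G}
    (hS : Subgroup.closure (S : Set G) = ⊤) :
    GrowthEquiv (growthFunction S) fun n => Nat.card (NonIdealTile Γ H n) := by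
  have hN := SimpleGraph.isWordNorm_dist_mulCayley hS S.finite_toSet
  have hG := freeOrVirtuallyAbelian_of_injective Γ φ hφ.injective
  let _ := hφ.mulAction
  obtain ⟨D, hD⟩ := hN.isGrowthSpace.exists_sphere_le (hφ.isGrowthSpace hH) hN hG
  obtain ⟨D', hD'⟩ := (hφ.isGrowthSpace hH).exists_sphere_le hN.isGrowthSpace hN hG
  have h1 : ∀ n, growthFunction S n =
      {g : G | (SimpleGraph.mulCayley (S : Set G)).dist 1 g = n}.ncard := fun n => by
    rw [← Nat.card_coe_set_eq]
    rfl
  refine ⟨⟨D, fun n => ?_⟩, ⟨2 * D', fun n => ?_⟩⟩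
  · beta_reduce
    rw [card_nonIdealTile, h1]
    exact hD _ _ (by rw [mul_add]; omega)
  · beta_reduce
    rw [card_nonIdealTile, h1]
    refine (hD' (n + 1) (2 * D' * n + 2 * D') ?_).trans ?_
    · calc D' * (n + 1 + 1) = D' * n + 2 * D' := by ring
        _ ≤ _ := Nat.add_le_add_right (Nat.mul_le_mul_right _ (by omega)) _
    · exact Nat.add_le_add (Nat.mul_le_mul_right _ (by omega)) (by omega)

theorem IsCocompact.growthIsTileCount (hφ : IsCocompact φ H r) (hH : IsConvex H) :
    GrowthIsTileCount Γ H G :=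
  ⟨hφ.group_fg hH, hφ.finite_nonIdealTile hH, historyGraph_connected hH,
    setOf_historyGraph_dist hH, fun _ hS =>
      ⟨hφ.quasiIsometricGraphs hH hS (Finset.finite_toSet _), hφ.growthEquiv hH hS⟩⟩

end Tilings

/-- The height is the distance from `1` for the generating set of the products of commuting
letters. -/
theorem exists_dist_mulCayley_eq_height [Fintype V] (Γ : SimpleGraph V) : ∃ S : Finset (RAAG Γ),
    Subgroup.closure (S : Set (RAAG Γ)) = ⊤ ∧
      ∀ g, (SimpleGraph.mulCayley (S : Set (RAAG Γ))).dist 1 g = height g := by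
  have hmem : ∀ g, g ∈ ((finite_isClique Γ).image (wordProd Γ)).toFinset ↔
      ∃ l, IsClique Γ l ∧ wordProd Γ l = g := by simp
  have hS : Subgroup.closure
      (((finite_isClique Γ).image (wordProd Γ)).toFinset : Set (RAAG Γ)) = ⊤ := by
    refine eq_top_iff.2 fun g _ => ?_
    induction g using induction_mul with
    | one => exact one_mem _
    | mul g s ih =>
      refine mul_mem (ih trivial) (Subgroup.subset_closure ((hmem _).2 ⟨[s], ?_, ?_⟩))
      · exact isClique_singleton s
      · simp
  generalize ((finite_isClique Γ).image (wordProd Γ)).toFinset = S at hmem hS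
  have hN := SimpleGraph.isWordNorm_dist_mulCayley hS S.finite_toSet
  refine ⟨S, hS, fun g => le_antisymm ?_ ?_⟩
  · induction hn : height g generalizing g with
    | zero => rw [height_eq_zero.1 hn, hN.one]
    | succ n ih =>
      obtain ⟨l, hl, -, h⟩ := exists_top_clique hn
      refine ((SimpleGraph.mulCayley_connected hS).dist_triangle (v := g * wordProd Γ l)).trans
        (Nat.add_le_add (ih _ h) ?_)
      by_cases h1 : g * wordProd Γ l = g
      · rw [h1, SimpleGraph.dist_self]
        exact Nat.zero_le _
      · exact (SimpleGraph.dist_eq_one_iff_adj.2 ((SimpleGraph.mulCayley_adj' _ _ _).2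
          ⟨h1, _, (hmem _).2 ⟨l, hl, rfl⟩, Or.inr rfl⟩)).le
  · induction hn : (SimpleGraph.mulCayley (S : Set (RAAG Γ))).dist 1 g generalizing g with
    | zero => rw [hN.eq_one hn, height_one]
    | succ n ih =>
      obtain ⟨h, hh, hg⟩ := hN.pred hn
      have h1 := ih h hh
      rw [← SimpleGraph.dist_mulCayley hS, SimpleGraph.dist_eq_one_iff_adj,
        SimpleGraph.mulCayley_adj'] at hg
      obtain ⟨-, x, hx, h2⟩ := hg
      obtain ⟨l, hl, rfl⟩ := (hmem x).1 hx
      rcases h2 with rfl | rfl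
      · exact (height_mul_clique_le hl h).trans (by omega)
      · exact (height_le_mul_clique hl g).trans (by omega)

end RAAG

end

section

/-! ### Edge paths in cube complexes -/

namespace CubeFace

lemma comp_vertex {n k : ℕ} (ψ : CubeFace n k) (x : Fin n → Bool) :
    ψ.comp (vertex x) = vertex (ψ.apply x) :=
  CubeFace.ext (Function.Embedding.ext fun i => i.elim0) rfl

lemma comp_edge {n k : ℕ} (ψ : CubeFace n k) (i : Fin n) (x : Fin n → Bool) :
    ψ.comp (edge i x) = edge (ψ.coord i) (ψ.apply x) := rfl

lemma edge_apply {n : ℕ} (i : Fin n) (x : Fin n → Bool) (y : Fin 1 → Bool) :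
    (edge i x).apply y = Function.update x i (xor (y 0) (x i)) := by
  funext j
  by_cases h : j = i
  · subst h
    rw [Function.update_self]
    exact apply_coord (edge j x) y 0
  · rw [Function.update_of_ne h, apply, dif_neg]
    · rfl
    · rintro ⟨i', rfl⟩
      exact h rfl

/-- A reflection of the cube. -/
def reflect {n : ℕ} (b : Fin n → Bool) : CubeFace n n := ⟨Function.Embedding.refl _, b⟩

lemma reflect_apply {n : ℕ} (b x : Fin n → Bool) : (reflect b).apply x = fun j => xor (x j) (b j) :=
  funext fun j => apply_coord (reflect b) x j

end CubeFace

universe u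

namespace CubeComplex

variable {Y : CubeComplex.{u}}

lemma restrict_vertex_edge {n : ℕ} (x : Fin 1 → Bool) (i : Fin n) (y : Fin n → Bool)
    (q : Y.cube n) : Y.restrict (CubeFace.vertex x) (Y.restrict (CubeFace.edge i y) q) =
      Y.restrict (CubeFace.vertex (Function.update y i (xor (x 0) (y i)))) q := by
  rw [← Y.restrict_comp, CubeFace.comp_vertex, CubeFace.edge_apply]

/-- The inverse edge. -/
def reverseEdge {a b : Y.Vertex} (e : a ⟶ b) : b ⟶ a :=
  have h (x : Bool) : Function.update (fun _ : Fin 1 => true) 0 (xor x true) = fun _ => !x :=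
    funext fun i => by rw [Subsingleton.elim i 0, Function.update_self, Bool.xor_true]
  ⟨Y.restrict (CubeFace.edge 0 fun _ => true) e.1,
    (restrict_vertex_edge _ _ _ _).trans ((by rw [h]; rfl :
      _ = Y.restrict (CubeFace.vertex fun _ => true) e.1).trans e.2.2),
    (restrict_vertex_edge _ _ _ _).trans ((by rw [h]; rfl :
      _ = Y.restrict (CubeFace.vertex fun _ => false) e.1).trans e.2.1)⟩

lemma restrict_edge_edge {n : ℕ} (i : Fin n) (x : Fin n → Bool) (q : Y.cube n) :
    Y.restrict (CubeFace.edge 0 fun _ => true) (Y.restrict (CubeFace.edge i x) q) =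
      Y.restrict (CubeFace.edge i (Function.update x i (!x i))) q := by
  rw [← Y.restrict_comp, CubeFace.comp_edge, CubeFace.edge_apply, Bool.true_xor]
  rfl

lemma reverseEdge_reverseEdge {a b : Y.Vertex} (e : a ⟶ b) :
    reverseEdge (reverseEdge e) = e := by
  apply Subtype.ext
  change Y.restrict _ (Y.restrict _ e.1) = _
  rw [restrict_edge_edge]
  have h : CubeFace.edge (0 : Fin 1) (Function.update (fun _ => true) 0 (!true)) =
      CubeFace.id 1 := by
    refine CubeFace.ext (Function.Embedding.ext fun i => Subsingleton.elim _ _) (funext fun i => ?_)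
    rw [Subsingleton.elim i 0]
    rfl
  rw [h, Y.restrict_id]

/-- The homotopy class of an edge path. -/
def homotopyClass {a b : Y.Vertex} (p : Quiver.Path a b) :
    (⟨a⟩ : Y.FundamentalGroupoid) ⟶ ⟨b⟩ :=
  (CategoryTheory.Quotient.functor (ElementaryHomotopy Y)).map p

open CategoryTheory

lemma homotopyClass_comp {a b c : Y.Vertex} (p : Quiver.Path a b) (q : Quiver.Path b c) :
    homotopyClass (p.comp q) = homotopyClass p ≫ homotopyClass q :=
  (CategoryTheory.Quotient.functor (ElementaryHomotopy Y)).map_comp p q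

lemma homotopyClass_nil (a : Y.Vertex) : homotopyClass (.nil : Quiver.Path a a) = 𝟙 _ :=
  (CategoryTheory.Quotient.functor (ElementaryHomotopy Y)).map_id a

lemma homotopyClass_cons {a b c : Y.Vertex} (p : Quiver.Path a b) (e : b ⟶ c) :
    homotopyClass (p.cons e) = homotopyClass p ≫ homotopyClass e.toPath :=
  homotopyClass_comp p e.toPath

lemma ElementaryHomotopy.homotopyClass_eq {a b : Y.Vertex} {p q : Quiver.Path a b}
    (h : ElementaryHomotopy Y p q) : homotopyClass p = homotopyClass q :=
  CategoryTheory.Quotient.sound _ h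

lemma homotopyClass_surjective {a b : Y.Vertex} (x : (⟨a⟩ : Y.FundamentalGroupoid) ⟶ ⟨b⟩) :
    ∃ p : Quiver.Path a b, homotopyClass p = x :=
  (CategoryTheory.Quotient.functor (ElementaryHomotopy Y)).map_surjective x

lemma homotopyClass_toPath_reverseEdge {a b : Y.Vertex} (e : a ⟶ b) :
    homotopyClass e.toPath ≫ homotopyClass (reverseEdge e).toPath = 𝟙 _ := by
  rw [← homotopyClass_comp, (ElementaryHomotopy.backtrack e (reverseEdge e) rfl).homotopyClass_eq,
    homotopyClass_nil]

end CubeComplex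

namespace CubeMap

open CubeComplex CategoryTheory RAAG

variable {V : Type*} {Γ : SimpleGraph V} {Y : CubeComplex.{u}} (f : CubeMap Y (salvettiComplex Γ))

/-- The letter spelled by the image of an edge. -/
def letter {a b : Y.Vertex} (e : a ⟶ b) : Letter V := (f.toFun 1 e.1).1 0

lemma label_cons {a b c : Y.Vertex} (p : Quiver.Path a b) (e : b ⟶ c) :
    f.label (p.cons e) = f.label p * (f.letter e).toGroup Γ := rfl

lemma label_comp {a b c : Y.Vertex} (p : Quiver.Path a b) (q : Quiver.Path b c) :
    f.label (p.comp q) = f.label p * f.label q := by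
  induction q with
  | nil => exact (mul_one _).symm
  | cons q e ih => rw [Quiver.Path.comp_cons, label_cons, label_cons, ih, mul_assoc]

lemma length_label_le {a b : Y.Vertex} (p : Quiver.Path a b) :
    length (f.label p) ≤ p.length := by
  induction p with
  | nil => exact length_one.le
  | cons p e ih =>
    rw [label_cons, Quiver.Path.length_cons]
    exact (length_mul_toGroup_le _ _).trans (Nat.succ_le_succ ih)

lemma toFun_restrict_edge {n : ℕ} (i : Fin n) (x : Fin n → Bool) (q : Y.cube n) :
    (f.toFun 1 (Y.restrict (CubeFace.edge i x) q)).1 0 =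
      (((f.toFun n q).1 i).1, xor (x i) ((f.toFun n q).1 i).2) := by
  rw [f.map_restrict]
  rfl

lemma letter_eq {a b : Y.Vertex} {e : a ⟶ b} {n : ℕ} {i : Fin n} {x : Fin n → Bool} {q : Y.cube n}
    (h : e.1 = Y.restrict (CubeFace.edge i x) q) :
    f.letter e = (((f.toFun n q).1 i).1, xor (x i) ((f.toFun n q).1 i).2) := by
  rw [← toFun_restrict_edge, ← h]
  rfl

lemma letter_reverseEdge {a b : Y.Vertex} (e : a ⟶ b) :
    f.letter (reverseEdge e) = (f.letter e).inv := by
  rw [f.letter_eq (e := reverseEdge e) rfl, Bool.true_xor]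
  rfl

lemma exists_reverse {a b : Y.Vertex} (p : Quiver.Path a b) : ∃ q : Quiver.Path b a,
    f.label q = (f.label p)⁻¹ ∧ homotopyClass p ≫ homotopyClass q = 𝟙 _ ∧
      homotopyClass q ≫ homotopyClass p = 𝟙 _ := by
  induction p with
  | nil => exact ⟨.nil, by simp [label], by simp [homotopyClass_nil], by simp [homotopyClass_nil]⟩
  | cons p e ih =>
    obtain ⟨q, h1, h2, h3⟩ := ih
    have h4 := homotopyClass_toPath_reverseEdge (reverseEdge e)
    rw [reverseEdge_reverseEdge] at h4
    refine ⟨(reverseEdge e).toPath.comp q, ?_, ?_, ?_⟩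
    · rw [label_comp, h1, label_cons, mul_inv_rev]
      congr 1
      change 1 * (f.letter (reverseEdge e)).toGroup Γ = _
      rw [letter_reverseEdge, one_mul, Letter.toGroup_inv]
    · rw [homotopyClass_cons, homotopyClass_comp, Category.assoc,
        reassoc_of% homotopyClass_toPath_reverseEdge e, h2]
    · rw [homotopyClass_cons, homotopyClass_comp, Category.assoc, reassoc_of% h3, h4]

lemma label_eq_of_elementaryHomotopy {a b : Y.Vertex} {p q : Quiver.Path a b}
    (h : ElementaryHomotopy Y p q) : f.label p = f.label q := by
  rcases h with ⟨e, e', h⟩ | ⟨e₁, e₂, e₃, e₄, q, h₁, h₂, h₃, h₄⟩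
  · obtain rfl : e' = reverseEdge e := Subtype.ext h
    rw [label_comp]
    change (1 * (f.letter e).toGroup Γ) * (1 * (f.letter (reverseEdge e)).toGroup Γ) = 1
    rw [letter_reverseEdge, Letter.toGroup_inv]
    group
  · rw [label_comp, label_comp]
    change (1 * (f.letter e₁).toGroup Γ) * (1 * (f.letter e₂).toGroup Γ) =
      (1 * (f.letter e₃).toGroup Γ) * (1 * (f.letter e₄).toGroup Γ)
    simp only [letter, h₁, h₂, h₃, h₄, toFun_restrict_edge, one_mul, Matrix.cons_val_zero,
      Matrix.cons_val_one, Bool.false_xor]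
    exact (toGroup_commute ((f.toFun 2 q).2 Fin.zero_ne_one)).eq

/-- The inverse of the label, as a functor on the fundamental groupoid. -/
def labelFunctor : Y.FundamentalGroupoid ⥤ SingleObj (RAAG Γ) :=
  CategoryTheory.Quotient.lift _
    { obj := fun _ => SingleObj.star _
      map := fun p => (f.label p)⁻¹
      map_id := fun _ => inv_one
      map_comp := fun p q => (congrArg Inv.inv (f.label_comp p q)).trans (mul_inv_rev _ _) }
    fun _ _ _ _ h => congrArg Inv.inv (f.label_eq_of_elementaryHomotopy h)

lemma labelFunctor_map {a b : Y.Vertex} (p : Quiver.Path a b) :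
    f.labelFunctor.map (homotopyClass p) = (f.label p)⁻¹ := rfl

lemma label_eq_of_homotopyClass_eq {a b : Y.Vertex} {p q : Quiver.Path a b}
    (h : homotopyClass p = homotopyClass q) : f.label p = f.label q := by
  have h1 := congrArg f.labelFunctor.map h
  rw [labelFunctor_map, labelFunctor_map] at h1
  exact inv_injective h1

/-- The homomorphism of fundamental groups induced by the map. -/
def labelHom (y : Y.Vertex) : Y.FundamentalGroup y →* RAAG Γ where
  toFun x := f.labelFunctor.map x.hom
  map_one' := f.labelFunctor.map_id _
  map_mul' x x' := f.labelFunctor.map_comp x'.hom x.hom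

lemma labelHom_apply {y : Y.Vertex} {x : Y.FundamentalGroup y} {p : Quiver.Path y y}
    (h : homotopyClass p = x.hom) : f.labelHom y x = (f.label p)⁻¹ := by
  rw [← labelFunctor_map, h]
  rfl

end CubeMap

namespace CubeMap.IsLocalIsometry

open CubeComplex CategoryTheory RAAG

variable {V : Type*} {Γ : SimpleGraph V} {Y : CubeComplex.{u}} {f : CubeMap Y (salvettiComplex Γ)}
  (hf : f.IsLocalIsometry)
include hf

lemma edge_eq {a b c : Y.Vertex} (e : a ⟶ b) (e' : a ⟶ c) (h : f.letter e = f.letter e') :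
    e.1 = e'.1 := by
  refine hf.injective _ _ (e.2.1.trans e'.2.1.symm) (Subtype.ext (funext fun i => ?_))
  rw [Subsingleton.elim i 0]
  exact h

/-- Two consecutive edges with commuting letters lie in a square. -/
lemma exists_square {a b d : Y.Vertex} (e₁ : a ⟶ b) (e₂ : b ⟶ d)
    (h : Γ.Adj (f.letter e₁).1 (f.letter e₂).1) : ∃ (c : Y.Vertex) (e₃ : a ⟶ c) (e₄ : c ⟶ d),
      ElementaryHomotopy Y (e₁.toPath.comp e₂.toPath) (e₃.toPath.comp e₄.toPath) ∧
        f.letter e₃ = f.letter e₂ ∧ f.letter e₄ = f.letter e₁ := by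
  let w : Fin 2 → Letter V := ![(f.letter e₁).inv, f.letter e₂]
  have hw : Pairwise fun i j => Γ.Adj (w i).1 (w j).1 := by
    intro i j hij
    fin_cases i <;> fin_cases j
    · exact (hij rfl).elim
    · exact h
    · exact h.symm
    · exact (hij rfl).elim
  obtain ⟨q, hq, hqe⟩ := hf.full (n := 2) b ![(reverseEdge e₁).1, e₂.1] ⟨w, hw⟩ (by
    intro i
    fin_cases i
    · exact (reverseEdge e₁).2.1
    · exact e₂.2.1) (Subtype.ext (funext fun i => i.elim0)) (by
    intro i
    refine Subtype.ext (funext fun j => ?_)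
    rw [Subsingleton.elim j 0]
    fin_cases i
    · change ((w 0).1, xor false (w 0).2) = f.letter (reverseEdge e₁)
      rw [CubeMap.letter_reverseEdge, Bool.false_xor]
      rfl
    · change ((w 1).1, xor false (w 1).2) = f.letter e₂
      rw [Bool.false_xor]
      rfl)
  have h0 : Y.restrict (CubeFace.edge 0 fun _ => false) q = (reverseEdge e₁).1 := hqe 0
  have h1 : Y.restrict (CubeFace.edge 1 fun _ => false) q = e₂.1 := hqe 1
  have hedge : ∀ (i : Fin 2) (x : Fin 2 → Bool),
      Y.restrict (CubeFace.edge i x) (Y.restrict (CubeFace.reflect ![true, false]) q) =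
        Y.restrict (CubeFace.edge i fun j => xor (x j) (![true, false] j)) q := by
    intro i x
    rw [← Y.restrict_comp, CubeFace.comp_edge, CubeFace.reflect_apply]
    rfl
  have hvertex : ∀ (i : Fin 2) (x y : Fin 2 → Bool), (∀ j, y j = x j) →
      Y.restrict (CubeFace.edge i x) q = Y.restrict (CubeFace.edge i y) q := by
    intro i x y hxy
    rw [funext hxy]
  have he₁ : e₁.1 = Y.restrict (CubeFace.edge 0 ![true, false]) q := by
    have h2 := congrArg Subtype.val (reverseEdge_reverseEdge e₁)
    change Y.restrict _ (reverseEdge e₁).1 = _ at h2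
    rw [← h2, ← h0, restrict_edge_edge]
    apply hvertex
    intro j; fin_cases j <;> rfl
  have hv : ∀ (x : Bool) (i : Fin 2) (y z : Fin 2 → Bool),
      (∀ j, Function.update y i (xor x (y i)) j = z j) →
        Y.restrict (CubeFace.vertex fun _ => x) (Y.restrict (CubeFace.edge i y) q) =
          Y.restrict (CubeFace.vertex z) q := by
    intro x i y z h
    rw [restrict_vertex_edge, funext h]
  have ha : Y.restrict (CubeFace.vertex ![true, false]) q = a := by
    refine Eq.trans ?_ e₁.2.1
    rw [he₁]
    refine (hv _ _ _ _ ?_).symm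
    intro j; fin_cases j <;> rfl
  have hd : Y.restrict (CubeFace.vertex ![false, true]) q = d := by
    refine Eq.trans ?_ e₂.2.2
    rw [← h1]
    refine (hv _ _ _ _ ?_).symm
    intro j; fin_cases j <;> rfl
  let c : Y.Vertex := Y.restrict (CubeFace.vertex ![true, true]) q
  let e₃ : a ⟶ c := ⟨Y.restrict (CubeFace.edge 1 ![true, false]) q,
    (hv _ _ _ _ (by intro j; fin_cases j <;> rfl)).trans ha,
    hv _ _ _ _ (by intro j; fin_cases j <;> rfl)⟩
  let e₄ : c ⟶ d := ⟨Y.restrict (CubeFace.edge 0 ![true, true]) q,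
    hv _ _ _ _ (by intro j; fin_cases j <;> rfl),
    (hv _ _ _ _ (by intro j; fin_cases j <;> rfl)).trans hd⟩
  refine ⟨c, e₃, e₄, .square e₁ e₂ e₃ e₄ (Y.restrict (CubeFace.reflect ![true, false]) q)
    ?_ ?_ ?_ ?_, ?_, ?_⟩
  · rw [hedge, he₁]
    apply hvertex
    intro j; fin_cases j <;> rfl
  · rw [hedge, ← h1]
    apply hvertex
    intro j; fin_cases j <;> rfl
  · rw [hedge]
    apply hvertex
    intro j; fin_cases j <;> rfl
  · rw [hedge]
    apply hvertex
    intro j; fin_cases j <;> rfl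
  · rw [f.letter_eq (e := e₃) rfl, f.letter_eq h1.symm]
    rfl
  · rw [f.letter_eq (e := e₄) rfl, f.letter_eq he₁]
    rfl

/-- A descent of the label of a geodesic edge path can be moved to the end of the path. -/
lemma exists_cons_of_isDescent {a b : Y.Vertex} {p : Quiver.Path a b} {s : Letter V}
    (hp : p.length = length (f.label p)) (hs : IsDescent (f.label p) s) :
    ∃ (c : Y.Vertex) (q : Quiver.Path a c) (e : c ⟶ b), homotopyClass p = homotopyClass (q.cons e) ∧
      f.letter e = s.inv ∧ q.length + 1 = p.length := by
  induction p generalizing s with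
  | nil => exact (not_isDescent_one s hs).elim
  | cons p e ih =>
    rw [CubeMap.label_cons] at hp hs
    rw [Quiver.Path.length_cons] at hp
    have hle := f.length_label_le p
    by_cases h : s = (f.letter e).inv
    · exact ⟨_, p, e, rfl, by rw [h, Letter.inv_inv], rfl⟩
    have hasc : ¬ IsDescent (f.label p) (f.letter e) := by
      intro h1
      have := length_descent h1
      omega
    have hadj : Γ.Adj s.1 (f.letter e).inv.1 := hs.adj (isDescent_mul_inv_iff.2 hasc) h
    rw [Letter.inv_fst] at hadj
    have hp' : p.length = length (f.label p) := by
      rw [length_ascent hasc] at hp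
      omega
    obtain ⟨c, q, e', h1, h2, h3⟩ := ih hp' ((isDescent_mul_iff hadj).1 hs)
    obtain ⟨d, e₃, e₄, h4, h5, h6⟩ := hf.exists_square e' e (by rw [h2]; exact hadj)
    refine ⟨d, q.cons e₃, e₄, ?_, h6.trans h2, ?_⟩
    · have h7 := h4.homotopyClass_eq
      rw [homotopyClass_comp, homotopyClass_comp] at h7
      rw [homotopyClass_cons, h1, homotopyClass_cons, homotopyClass_cons, homotopyClass_cons,
        Category.assoc, Category.assoc, h7]
    · rw [Quiver.Path.length_cons, Quiver.Path.length_cons, h3]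

/-- Every edge path is homotopic to a geodesic one. -/
lemma exists_geodesic {a b : Y.Vertex} (p : Quiver.Path a b) : ∃ q : Quiver.Path a b,
    homotopyClass p = homotopyClass q ∧ q.length = length (f.label q) := by
  induction p with
  | nil => exact ⟨.nil, rfl, length_one.symm⟩
  | @cons b c p e ih =>
    obtain ⟨q, h1, h2⟩ := ih
    by_cases hs : IsDescent (f.label q) (f.letter e)
    · obtain ⟨d, q', e', h3, h4, h5⟩ := hf.exists_cons_of_isDescent h2 hs
      have h6 := hf.edge_eq (reverseEdge e') e (by
        rw [CubeMap.letter_reverseEdge, h4, Letter.inv_inv])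
      obtain rfl : d = c := by rw [← e.2.2, ← h6, (reverseEdge e').2.2]
      obtain rfl : reverseEdge e' = e := Subtype.ext h6
      have h7 : homotopyClass (p.cons (reverseEdge e')) = homotopyClass q' := by
        rw [homotopyClass_cons, h1, h3, homotopyClass_cons, Category.assoc,
          homotopyClass_toPath_reverseEdge, Category.comp_id]
      refine ⟨q', h7, ?_⟩
      have h8 := f.label_eq_of_homotopyClass_eq h3
      rw [CubeMap.label_cons, h4] at h8
      have h9 : f.label q' = f.label q * (f.letter (reverseEdge e')).toGroup Γ := by
        rw [h8, Letter.toGroup_inv, inv_mul_cancel_right]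
      have h10 := length_descent hs
      rw [h9]
      omega
    · exact ⟨q.cons e, by rw [homotopyClass_cons, homotopyClass_cons, h1], by
        rw [CubeMap.label_cons, length_ascent hs, Quiver.Path.length_cons, h2]⟩

lemma isConvex_coverVertices (y : Y.Vertex) : IsConvex (f.coverVertices y) where
  one_mem := ⟨y, .nil, rfl⟩
  mul_mem := by
    rintro _ ⟨z, p, rfl⟩ _ ⟨w, q, rfl⟩ s hs
    obtain ⟨p', hp', -⟩ := f.exists_reverse p
    obtain ⟨r, h1, h2⟩ := hf.exists_geodesic (p'.comp q)
    have h3 : f.label r = (f.label p)⁻¹ * f.label q := by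
      rw [← f.label_eq_of_homotopyClass_eq h1, CubeMap.label_comp, hp']
    obtain ⟨c, r', e, h4, h5, -⟩ := hf.exists_cons_of_isDescent h2 (h3 ▸ hs)
    refine ⟨c, p.comp r', ?_⟩
    have h6 := f.label_eq_of_homotopyClass_eq h4
    rw [CubeMap.label_cons, h5, Letter.toGroup_inv, h3] at h6
    rw [CubeMap.label_comp, mul_inv_eq_iff_eq_mul.1 h6.symm]
    group

lemma labelHom_injective (y : Y.Vertex) : Function.Injective (f.labelHom y) := by
  rw [injective_iff_map_eq_one]
  intro x hx
  obtain ⟨p, hp⟩ := homotopyClass_surjective x.hom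
  obtain ⟨q, h1, h2⟩ := hf.exists_geodesic p
  rw [f.labelHom_apply (h1.symm.trans hp), inv_eq_one] at hx
  rw [hx, length_one] at h2
  obtain rfl := Quiver.Path.eq_nil_of_length_zero q h2
  apply Iso.ext
  rw [← hp, h1]
  exact homotopyClass_nil y

lemma exists_isCocompact (hY : Y.IsCompact) (y : Y.Vertex) :
    ∃ r, IsCocompact (f.labelHom y) (f.coverVertices y) r := by
  classical
  have : Finite (Σ n, Y.cube n) := hY
  have : Finite Y.Vertex :=
    Finite.of_injective (fun x : Y.cube 0 => (⟨0, x⟩ : Σ n, Y.cube n)) sigma_mk_injective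
  let P : Y.Vertex → RAAG Γ := fun z =>
    if h : Nonempty (Quiver.Path y z) then f.label h.some else 1
  obtain ⟨r, hr⟩ := (Set.finite_range fun z => length (P z)).bddAbove
  refine ⟨r, hf.labelHom_injective y, ?_, ?_⟩
  · rintro g _ ⟨z, q, rfl⟩
    obtain ⟨p, hp⟩ := homotopyClass_surjective g.hom
    obtain ⟨p', h1, -, -⟩ := f.exists_reverse p
    exact ⟨z, p'.comp q, by rw [CubeMap.label_comp, f.labelHom_apply hp, h1]⟩
  · rintro _ ⟨z, q, rfl⟩
    have hz : Nonempty (Quiver.Path y z) := ⟨q⟩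
    obtain ⟨q', h1, h2, h3⟩ := f.exists_reverse q
    obtain ⟨p', h4, h5, h6⟩ := f.exists_reverse hz.some
    let g : Y.FundamentalGroup y :=
      { hom := homotopyClass (hz.some.comp q')
        inv := homotopyClass (q.comp p')
        hom_inv_id := by
          rw [homotopyClass_comp, homotopyClass_comp, Category.assoc, reassoc_of% h3, h5]
        inv_hom_id := by
          rw [homotopyClass_comp, homotopyClass_comp, Category.assoc, reassoc_of% h6, h2] }
    have hg : f.labelHom y g = (f.label (hz.some.comp q'))⁻¹ := f.labelHom_apply rfl
    refine ⟨g, ?_⟩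
    have h7 := hr ⟨z, rfl⟩
    simp only [P, dif_pos hz] at h7
    rw [hg, CubeMap.label_comp, h1, inv_inv, inv_mul_cancel_right]
    exact h7

end CubeMap.IsLocalIsometry

end

theorem mainTheorem5 {V : Type*} [Fintype V] [DecidableEq V] (Γ : SimpleGraph V) :
    ((∃ S : Finset (RAAG Γ), Subgroup.closure (S : Set (RAAG Γ)) = ⊤ ∧
        ∀ n, Nat.card (NonIdealTile Γ Set.univ n) = growthFunction S (n + 1)) ∧
      GrowthIsTileCount Γ Set.univ (RAAG Γ)) ∧
    ∀ (Y : CubeComplex) (f : CubeMap Y (salvettiComplex Γ)) (y : Y.Vertex),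
      Y.IsCompact → f.IsLocalIsometry →
        GrowthIsTileCount Γ (f.coverVertices y) (Y.FundamentalGroup y) := by
  refine ⟨⟨?_, RAAG.isCocompact_id.growthIsTileCount RAAG.isConvex_univ⟩, fun Y f y hY hf => ?_⟩
  · obtain ⟨S, hS, h⟩ := RAAG.exists_dist_mulCayley_eq_height Γ
    refine ⟨S, hS, fun n => Nat.card_congr ((nonIdealTileEquiv Set.univ n).trans
      (Equiv.subtypeEquivRight fun g => ?_))⟩
    rw [h]
    exact and_iff_right trivial
  · obtain ⟨r, hr⟩ := hf.exists_isCocompact hY y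
    exact hr.growthIsTileCount (hf.isConvex_coverVertices y)
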